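/- **Setting.** Let $m\in\{1,2\}$, $k=(k_1,\dots,k_m)\in(\mathbb Z_{\ge 0})^m$, $k\neq 0$, and $$A=A_{m,k}=\prod_{i=1}^m\begin{pmatrix}1&0\\1&1\end{pmatrix}\begin{pmatrix}1&k_i\\0&1\end{pmatrix}\in SL(2,\mathbb Z),$$ $$f_{1,k}=(\eta-2\xi^2)(\eta^2+2\xi^2\eta+\xi^4-\xi^{4+k_1})+\zeta^2,\qquad f_{2,k}=\{(\xi+\eta)^2-\xi^{2+k_1}\}\{(\xi-\eta)^2+\xi^{2+k_2}\}+\zeta^2 .$$ Let $T_A=T^2\times\mathbb R/((p,z+1)\sim(Ap,z))$ be the mapping torus of $A$. Let $v_\pm$ be eigenvectors, $Av_\pm=a^{\pm1}v_\pm$, with $a>1$ and $dvol(v_+,v_-)>0$, and put $\beta_\pm=\pm a^{\mp z}\,dvol_{T^2}(v_\pm,\cdot)$, which are $1$-forms on $T_A$. Let $\Lambda=\sum_{i=1}^3 (x_i\,dy_i-y_i\,dx_i)$ be the standard contact form on $S^5\subset\mathbb C^3$, where $S^5$ is oriented as the boundary of the ball. **Open book.** Let $\mathcal O$ be a supporting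 open-book decomposition of the standard $S^5$, with page angle $\theta$, which is equivalent to the Milnor fibration of $f_{m,k}$ at the origin (by an orientation preserving diffeomorphism of $S^5$) and whose binding is contactomorphic to $(T_A,\ker(\beta_++\beta_-))$. Fix a positive function $\rho$ on $S^5$ with $d\theta\wedge(d(\rho\Lambda))^2>0$ off the binding, and a tubular neighbourhood $T_A\times D^2$ of the binding (contained in an open one, $T_A\times\mathbb C$), with polar coordinates $(r,\theta)$ on the unit disc $D^2$, such that $$\rho\Lambda=f(r)(\beta_++\beta_-)+g(r)\,d\theta\quad\text{on }T_A\times D^2,$$ where $f>0$, $f'<0$ on $(0,1]$, and $g$ is weakly increasing with $g=r^2$ near $r=0$ and $g=1$ near $r=1$. **Lutz tube.** Inserting the $5$-dimensional Lutz tube along the binding produces the form $\alpha_{m,k}$ on $S^5$ that equals $\rho\Lambda$ outside $T_A\times \mathrm{int}\,D^2$ and equals $$a(r)\beta_++b(r)\beta_-+c(r)\,d\theta\quad\text{on }T_A\times D^2 .$$ Here $a,b,c$ are smooth; $a=b=f$ and $c=g$ near $r=1$; $a>0$; near $r=0$ the functions $a$ and $b$ are constant, $b<0$, and $c=-\kappa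 r^2$ with a constant $\kappa>0$; there is $R\in(0,1)$ with $c<0$ on $(0,R)$, $c(R)=0$, and $c>0$ on $(R,1]$; and $2ab\,c'-(ab)'c>0$ on $(0,1]$ (the contact condition). The Lutz tube is $\{r\le R\}$, and its boundary is the hypersurface $\{r=R\}\cong T_A\times S^1$. **Reeb foliation.** A Reeb foliation $\mathcal F_{m,k}$ associated to $\mathcal O$ is the foliation $\ker\eta$, where $\eta=d\theta$ outside $T_A\times \mathrm{int}\,D^2$ and $\eta=f_1(r)\,dz+g_1(r)\,d\theta+e(r)\,dr$ on $T_A\times D^2$. Here $f_1,g_1,e$ are smooth and, for some $r_0\in(0,1)$: $f_1$ is weakly decreasing, $f_1=1$ near $0$, $f_1>0$ on $[0,r_0)$, $f_1=0$ on $[r_0,1]$; $g_1$ is weakly increasing, $g_1=0$ on $[0,r_0]$, $g_1>0$ on $(r_0,1]$, $g_1=1$ near $1$; and $e$ has compact support in $(0,1)$ with $e(r_0)\ne0$. Its compact leaf is $\{r=r_0\}$. If $\operatorname{supp}e\subset(0,R)$, then near $\{r=R\}$ the leaves of $\mathcal F_{m,k}$ are pages of $\mathcal O$. **Theorem.** For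 all data as above, there are Reeb foliations $\mathcal F_{m,k}=\ker\eta$ with $\operatorname{supp} e\subset(0,R)$. For each of them, $\eta$ is a nowhere zero $1$-form with $\eta\wedge d\eta=0$, and there is a smooth family $\{\alpha_t\}_{0\le t\le1}$ of $1$-forms on $S^5$ such that 1. $\alpha_0=\alpha_{m,k}$; 2. $\alpha_t$ is a positive contact form for $0\le t<1$; 3. $\alpha_1$ is nowhere zero and $\alpha_1\wedge d\alpha_1=0$, so $\ker\alpha_1$ is a codimension-one foliation; 4. $\ker\alpha_1$ is obtained from $\mathcal F_{m,k}$ by cutting and turbulizing its page leaves along the boundary $\{r=R\}$ of the Lutz tube. That is, there is a collar $\{|r-R|<\delta\}$, $0<R-\delta<R+\delta<1$, in which $\mathcal F_{m,k}=\ker d\theta$; off the collar $\ker\alpha_1=\mathcal F_{m,k}$ (as hyperplane fields, without co-orientation); and in the collar $\ker\alpha_1=\ker(p(r)\,d\theta+q(r)\,dr)$ with smooth $p,q$ such that $p(r)=0$ exactly for $r=R$, $q(R)\neq0$, and $q=0$ for $|r-R|\ge\delta/2$. -/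

import Mathlib

open scoped ContDiff MatrixGroups

noncomputable section

namespace LutzS5

/-! ### Differential forms on the unit sphere of `ℂ³`

A smooth 1-form on the sphere is the restriction of a 1-form on `ℂ³` that is smooth away from the
origin; only its values on vectors tangent to the sphere are ever used. -/

/-- `ℂ³` with its Euclidean norm. -/
abbrev C3 : Type := EuclideanSpace ℂ (Fin 3)

/-- The unit sphere `S⁵`. -/
def S5 : Set C3 := Metric.sphere 0 1

/-- The tangent space of the sphere at one of its points: the real orthogonal complement. -/
def tangentSpace (p : C3) : Submodule ℝ C3 := (Submodule.span ℝ {p})ᗮ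

/-- 1-forms on `ℂ³`. -/
abbrev Form : Type := C3 → C3 →L[ℝ] ℝ

/-- Smoothness away from the origin. -/
def IsSmoothForm (α : Form) : Prop := ContDiffOn ℝ ∞ α {0}ᶜ

/-- Equality of two 1-forms on `S⁵` at the point `p`. -/
def EqAt (α β : Form) (p : C3) : Prop := ∀ v ∈ tangentSpace p, α p v = β p v

/-- The exterior derivative, `dα(v, w) = (D_v α)(w) - (D_w α)(v)`. -/
def dForm (α : Form) (p v w : C3) : ℝ := fderiv ℝ α p v w - fderiv ℝ α p w v

/-- `η ∧ τ ∧ τ` for a covector `η` and a 2-form `τ`, up to the positive factor `1! 2! 2!`. -/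
def wedge122 (η : C3 →L[ℝ] ℝ) (τ : C3 → C3 → ℝ) (v : Fin 5 → C3) : ℝ :=
  ∑ σ : Equiv.Perm (Fin 5), ((Equiv.Perm.sign σ : ℤ) : ℝ) *
    (η (v (σ 0)) * τ (v (σ 1)) (v (σ 2)) * τ (v (σ 3)) (v (σ 4)))

/-- `η ∧ τ` for a covector `η` and a 2-form `τ`, up to the positive factor `1! 2!`. -/
def wedge12 (η : C3 →L[ℝ] ℝ) (τ : C3 → C3 → ℝ) (v : Fin 3 → C3) : ℝ :=
  ∑ σ : Equiv.Perm (Fin 3), ((Equiv.Perm.sign σ : ℤ) : ℝ) *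
    (η (v (σ 0)) * τ (v (σ 1)) (v (σ 2)))

/-- The real coordinates `(x₁, y₁, x₂, y₂, x₃, y₃)`. -/
def realCoord (v : C3) : Fin 6 → ℝ :=
  ![(v 0).re, (v 0).im, (v 1).re, (v 1).im, (v 2).re, (v 2).im]

/-- `v` is a positively oriented frame of `T_p S⁵`, where `S⁵` is oriented as the boundary of the
ball (outward normal first). -/
def IsPositiveFrame (p : C3) (v : Fin 5 → C3) : Prop :=
  (∀ i, v i ∈ tangentSpace p) ∧
    0 < (Matrix.of (Fin.cons (realCoord p) (fun i => realCoord (v i))) :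
      Matrix (Fin 6) (Fin 6) ℝ).det

/-- `α` restricts to a positive contact form of `S⁵`: `α ∧ (dα)² > 0`. -/
def IsPositiveContact (α : Form) : Prop :=
  ∀ p ∈ S5, ∀ v, IsPositiveFrame p v → 0 < wedge122 (α p) (dForm α p) v

/-- `η` restricts to a nowhere zero form of `S⁵` with `η ∧ dη = 0`, so that `ker η` is (tangent to)
a codimension-one foliation of `S⁵`. -/
def IsFoliationForm (η : Form) : Prop :=
  (∀ p ∈ S5, ∃ v ∈ tangentSpace p, η p v ≠ 0) ∧
    ∀ p ∈ S5, ∀ v : Fin 3 → C3, (∀ i, v i ∈ tangentSpace p) →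
      wedge12 (η p) (dForm η p) v = 0

/-- The hyperplane field `ker η ⊆ T S⁵`. -/
def kerField (η : Form) (p : C3) : Submodule ℝ C3 :=
  tangentSpace p ⊓ LinearMap.ker (η p : C3 →ₗ[ℝ] ℝ)

/-- The coordinate `v ↦ v i`, as a real linear map. -/
def coordCLM (i : Fin 3) : C3 →L[ℝ] ℂ :=
  (EuclideanSpace.proj i : C3 →L[ℂ] ℂ).restrictScalars ℝ

/-- The standard contact form `∑ (xᵢ dyᵢ - yᵢ dxᵢ)`. -/
def stdForm : Form := fun p =>
  ∑ i, ((p i).re • (Complex.imCLM ∘L coordCLM i) - (p i).im • (Complex.reCLM ∘L coordCLM i))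

/-- The form `dθ` of a function `Θ = exp(iθ)` with values in the unit circle. -/
def angleForm (Θ : C3 → ℂ) : Form := fun p =>
  Complex.imCLM ∘L
    (ContinuousLinearMap.mul ℝ ℂ (starRingEnd ℂ (Θ p)) ∘L fderiv ℝ Θ p)

/-! ### The matrices `A_{m,k}` and the polynomials `f_{m,k}` -/

/-- The lower triangular matrix with rows `(1, 0)` and `(1, 1)`. -/
def lowerSL : SL(2, ℤ) := ⟨!![1, 0; 1, 1], by simp [Matrix.det_fin_two]⟩

/-- The upper triangular matrix with rows `(1, j)` and `(0, 1)`. -/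
def upperSL (j : ℕ) : SL(2, ℤ) := ⟨!![1, (j : ℤ); 0, 1], by simp [Matrix.det_fin_two]⟩

/-- `A_{m,k}`, the ordered product of the matrices `lowerSL * upperSL kᵢ`. -/
def monodromy (m : ℕ) (k : Fin m → ℕ) : SL(2, ℤ) :=
  (List.ofFn fun i => lowerSL * upperSL (k i)).prod

/-- The polynomials `f_{1,k}` and `f_{2,k}` in `(ξ, η, ζ)`. -/
def singularity : (m : ℕ) → (Fin m → ℕ) → C3 → ℂ
  | 1, k => fun p =>
      (p 1 - 2 * p 0 ^ 2) *
        (p 1 ^ 2 + 2 * p 0 ^ 2 * p 1 + p 0 ^ 4 - p 0 ^ (4 + k 0)) + p 2 ^ 2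
  | 2, k => fun p =>
      ((p 0 + p 1) ^ 2 - p 0 ^ (2 + k 0)) * ((p 0 - p 1) ^ 2 + p 0 ^ (2 + k 1)) + p 2 ^ 2
  | _, _ => fun _ => 0

/-! ### Mapping tori of hyperbolic matrices and their product with the plane -/

/-- The universal cover `{(x, y, z, w)}` of `T_A × ℂ`, where `T_A` is the mapping torus of `A`. -/
abbrev Cover : Type := ℝ × ℝ × ℝ × ℂ

/-- Two points of the cover lie over the same point of `T_A × ℂ`. Here
`T_A = T² × ℝ / ((p, z + 1) ∼ (A p, z))`. -/
def SamePoint (A : SL(2, ℤ)) (q q' : Cover) : Prop :=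
  (∃ n i j : ℤ,
    q'.1 = ((A ^ n) 0 0 : ℝ) * q.1 + ((A ^ n) 0 1 : ℝ) * q.2.1 + i ∧
    q'.2.1 = ((A ^ n) 1 0 : ℝ) * q.1 + ((A ^ n) 1 1 : ℝ) * q.2.1 + j ∧
    q.2.2.1 = q'.2.2.1 + n) ∧
  q.2.2.2 = q'.2.2.2

/-- Eigenvectors `v₊`, `v₋` of `A` with eigenvalues `a > 1` and `a⁻¹` and with
`dvol(v₊, v₋) > 0`. -/
structure EigenData (A : SL(2, ℤ)) where
  a : ℝ
  vp : ℝ × ℝ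
  vm : ℝ × ℝ
  one_lt : 1 < a
  eig_vp : (A 0 0 : ℝ) * vp.1 + (A 0 1 : ℝ) * vp.2 = a * vp.1 ∧
    (A 1 0 : ℝ) * vp.1 + (A 1 1 : ℝ) * vp.2 = a * vp.2
  eig_vm : (A 0 0 : ℝ) * vm.1 + (A 0 1 : ℝ) * vm.2 = a⁻¹ * vm.1 ∧
    (A 1 0 : ℝ) * vm.1 + (A 1 1 : ℝ) * vm.2 = a⁻¹ * vm.2
  oriented : 0 < vp.1 * vm.2 - vp.2 * vm.1

/-- `β₊ = a^{-z} dvol(v₊, ·)` at `q`, evaluated on the tangent vector `t`. -/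
def EigenData.betaPlus {A : SL(2, ℤ)} (D : EigenData A) (q t : Cover) : ℝ :=
  D.a ^ (-q.2.2.1) * (D.vp.1 * t.2.1 - D.vp.2 * t.1)

/-- `β₋ = - a^z dvol(v₋, ·)` at `q`, evaluated on the tangent vector `t`. -/
def EigenData.betaMinus {A : SL(2, ℤ)} (D : EigenData A) (q t : Cover) : ℝ :=
  -(D.a ^ q.2.2.1 * (D.vm.1 * t.2.1 - D.vm.2 * t.1))

/-- The radius `r = |w|`. -/
def radius (q : Cover) : ℝ := ‖q.2.2.2‖

/-- `dθ` for the polar angle `θ` of `w` (`0` on the core `w = 0`; it only ever occurs there with a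
coefficient that vanishes near the core, or that is a multiple of `r²` near the core). -/
def dTheta (q t : Cover) : ℝ := (starRingEnd ℂ q.2.2.2 * t.2.2.2).im / ‖q.2.2.2‖ ^ 2

/-- `dr` for the radius `r` of `w` (only used with coefficients that vanish near the core). -/
def dRadius (q t : Cover) : ℝ := (starRingEnd ℂ q.2.2.2 * t.2.2.2).re / ‖q.2.2.2‖

/-- `dz`, the pull-back of the length form under the projection of `T_A` to the circle. -/
def dZ (t : Cover) : ℝ := t.2.2.1

/-! ### Supporting open books of the standard `S⁵` with binding `T_A` -/

/-- A supporting open-book decomposition of the standard contact `S⁵` whose binding is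
contactomorphic to `(T_A, β₊ + β₋)`, together with a tubular neighbourhood `T_A × ℂ` of the binding
and a conformal factor `ρ` for which `ρ Λ` is axisymmetric on `T_A × D²`. -/
structure SupportingOpenBook (A : SL(2, ℤ)) where
  /-- the eigenvectors that define `β₊` and `β₋` -/
  eig : EigenData A
  /-- the tubular neighbourhood `T_A × ℂ → S⁵`, lifted to the universal cover -/
  J : Cover → C3
  /-- the page map `exp(iθ)`, defined off the binding -/
  Θ : C3 → ℂ
  /-- the conformal factor -/
  ρ : C3 → ℝ
  f : ℝ → ℝ
  g : ℝ → ℝ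
  J_smooth : ContDiff ℝ ∞ J
  J_mem : ∀ q, J q ∈ S5
  J_immersion : ∀ q, Function.Injective (fderiv ℝ J q)
  J_eq_iff : ∀ q q', J q = J q' ↔ SamePoint A q q'
  Θ_smooth : ContDiffOn ℝ ∞ Θ
    {x | x ≠ 0 ∧ ∀ q : Cover, q.2.2.2 = 0 → ‖x‖⁻¹ • x ≠ J q}
  Θ_unit : ∀ p ∈ S5, (∀ q : Cover, q.2.2.2 = 0 → p ≠ J q) → ‖Θ p‖ = 1
  Θ_tube : ∀ q : Cover, q.2.2.2 ≠ 0 → Θ (J q) = q.2.2.2 / (‖q.2.2.2‖ : ℂ)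
  ρ_smooth : ContDiffOn ℝ ∞ ρ {0}ᶜ
  ρ_pos : ∀ p ∈ S5, 0 < ρ p
  /-- `dθ ∧ (d(ρ Λ))² > 0` off the binding -/
  supporting : ∀ p ∈ S5, (∀ q : Cover, q.2.2.2 = 0 → p ≠ J q) →
    ∀ v, IsPositiveFrame p v →
      0 < wedge122 (angleForm Θ p) (dForm (fun x => ρ x • stdForm x) p) v
  f_smooth : ContDiff ℝ ∞ f
  g_smooth : ContDiff ℝ ∞ g
  f_pos : ∀ r ∈ Set.Icc (0 : ℝ) 1, 0 < f r
  f_decr : ∀ r ∈ Set.Ioc (0 : ℝ) 1, deriv f r < 0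
  g_mono : MonotoneOn g (Set.Icc 0 1)
  g_zero : ∃ ε > 0, ∀ r ∈ Set.Icc (0 : ℝ) ε, g r = r ^ 2
  g_one : ∃ ε > 0, ∀ r ∈ Set.Icc (1 - ε) 1, g r = 1
  /-- `ρ Λ = f(r) (β₊ + β₋) + g(r) dθ` on `T_A × D²` -/
  normal_form : ∀ q, radius q ≤ 1 → ∀ t : Cover,
    ρ (J q) * stdForm (J q) (fderiv ℝ J q t) =
      f (radius q) * (eig.betaPlus q t + eig.betaMinus q t) + g (radius q) * dTheta q t

/-- The binding. -/
def SupportingOpenBook.binding {A : SL(2, ℤ)} (O : SupportingOpenBook A) : Set C3 :=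
  {p | ∃ q : Cover, q.2.2.2 = 0 ∧ p = O.J q}

/-- The image of `T_A × int D²`. -/
def SupportingOpenBook.tube {A : SL(2, ℤ)} (O : SupportingOpenBook A) : Set C3 :=
  {p | ∃ q : Cover, radius q < 1 ∧ p = O.J q}

/-- The open book is equivalent to the Milnor open book of the germ of `F` at the origin: for every
small `ε`, some orientation preserving diffeomorphism `φ` of `S⁵` takes the binding to the link
`{F = 0}` and `exp(iθ)` to `F / |F|`, both taken on the sphere of radius `ε`. -/
def SupportingOpenBook.IsMilnor {A : SL(2, ℤ)} (O : SupportingOpenBook A) (F : C3 → ℂ) : Prop :=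
  ∃ ε₀ > 0, ∀ ε : ℝ, 0 < ε → ε < ε₀ → ∃ φ ψ : C3 → C3,
    ContDiffOn ℝ ∞ φ {0}ᶜ ∧ ContDiffOn ℝ ∞ ψ {0}ᶜ ∧
    Set.MapsTo φ S5 S5 ∧ Set.MapsTo ψ S5 S5 ∧
    Set.LeftInvOn ψ φ S5 ∧ Set.RightInvOn ψ φ S5 ∧
    (∀ p ∈ S5, ∀ v, IsPositiveFrame p v →
      IsPositiveFrame (φ p) (fun i => fderiv ℝ φ p (v i))) ∧
    (∀ p ∈ S5, F (ε • φ p) = 0 ↔ p ∈ O.binding) ∧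
    (∀ p ∈ S5, p ∉ O.binding → O.Θ p = F (ε • φ p) / (‖F (ε • φ p)‖ : ℂ))

/-! ### Insertion of a Lutz tube -/

/-- Coefficients of a contact form `a(r) β₊ + b(r) β₋ + c(r) dθ` on `T_A × D²` which agrees with
`f(r) (β₊ + β₋) + g(r) dθ` near the boundary and for which `{r ≤ R}` is a Lutz tube.

The inequality `turning` says that the form is a positive contact form, equivalently that the
slope `a b / c²` is strictly monotone wherever `c ≠ 0`. For `0 < r < R` one has `c < 0`, and
division by `|c|` gives the contactization `λ - dθ` of an exact symplectic form `dλ` on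
`(0, R) × T_A`, with `λ` a multiple of `β₊ + s β₋` and with `s` running from negative to positive
values; this is the (modified) contactization of `W_A = [-1, 1] × T_A`. At `r = R`, the end `s = 1`,
the coefficient of `dθ` changes its sign (dividing set); the end `s = -1` is capped off at the core
`r = 0` by `T_A` times a disc with the opposite orientation. -/
structure LutzProfile (f g : ℝ → ℝ) where
  R : ℝ
  a : ℝ → ℝ
  b : ℝ → ℝ
  c : ℝ → ℝ
  R_mem : R ∈ Set.Ioo (0 : ℝ) 1
  a_smooth : ContDiff ℝ ∞ a
  b_smooth : ContDiff ℝ ∞ b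
  c_smooth : ContDiff ℝ ∞ c
  a_pos : ∀ r ∈ Set.Icc (0 : ℝ) 1, 0 < a r
  b_core : b 0 < 0
  near_core : ∃ ε > 0, ∃ κ > 0, ∀ r ∈ Set.Icc (0 : ℝ) ε,
    a r = a 0 ∧ b r = b 0 ∧ c r = -κ * r ^ 2
  c_neg : ∀ r ∈ Set.Ioo 0 R, c r < 0
  c_boundary : c R = 0
  c_pos : ∀ r ∈ Set.Ioc R 1, 0 < c r
  turning : ∀ r ∈ Set.Ioc (0 : ℝ) 1,
    0 < 2 * (a r * b r) * deriv c r - deriv (fun s => a s * b s) r * c r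
  near_one : ∃ ε > 0, ∀ r ∈ Set.Icc (1 - ε) 1, a r = f r ∧ b r = f r ∧ c r = g r

/-- `α` is the form obtained from `ρ Λ` by inserting the Lutz tube along the binding. -/
def IsLutzInsertion {A : SL(2, ℤ)} (O : SupportingOpenBook A) (L : LutzProfile O.f O.g)
    (α : Form) : Prop :=
  IsSmoothForm α ∧
  (∀ p ∈ S5, p ∉ O.tube → EqAt α (fun x => O.ρ x • stdForm x) p) ∧
  ∀ q, radius q ≤ 1 → ∀ t : Cover,
    α (O.J q) (fderiv ℝ O.J q t) =
      L.a (radius q) * O.eig.betaPlus q t + L.b (radius q) * O.eig.betaMinus q t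
        + L.c (radius q) * dTheta q t

/-! ### Reeb foliations and turbulization -/

/-- Coefficients of the form `f₁(r) dz + g₁(r) dθ + e(r) dr` on `T_A × D²`, with compact leaf
`{r = r₀}`. -/
structure ReebProfile where
  r₀ : ℝ
  f₁ : ℝ → ℝ
  g₁ : ℝ → ℝ
  e : ℝ → ℝ
  r₀_mem : r₀ ∈ Set.Ioo (0 : ℝ) 1
  f₁_smooth : ContDiff ℝ ∞ f₁
  g₁_smooth : ContDiff ℝ ∞ g₁
  e_smooth : ContDiff ℝ ∞ e
  f₁_near_zero : ∃ ε > 0, ∀ r ∈ Set.Icc (0 : ℝ) ε, f₁ r = 1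
  f₁_anti : AntitoneOn f₁ (Set.Icc 0 1)
  f₁_pos : ∀ r ∈ Set.Ico 0 r₀, 0 < f₁ r
  f₁_zero : ∀ r ∈ Set.Icc r₀ 1, f₁ r = 0
  g₁_near_one : ∃ ε > 0, ∀ r ∈ Set.Icc (1 - ε) 1, g₁ r = 1
  g₁_mono : MonotoneOn g₁ (Set.Icc 0 1)
  g₁_zero : ∀ r ∈ Set.Icc 0 r₀, g₁ r = 0
  g₁_pos : ∀ r ∈ Set.Ioc r₀ 1, 0 < g₁ r
  e_support : tsupport e ⊆ Set.Ioo 0 1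
  e_ne : e r₀ ≠ 0

/-- `η` defines the Reeb foliation associated to the open book `O` (and to the fibration `z` of its
binding over the circle): `η = dθ` off the tube, so that the leaves are pages there, and
`η = f₁ dz + g₁ dθ + e dr` on `T_A × D²`. -/
def IsReebForm {A : SL(2, ℤ)} (O : SupportingOpenBook A) (P : ReebProfile) (η : Form) : Prop :=
  IsSmoothForm η ∧
  (∀ p ∈ S5, p ∉ O.tube → EqAt η (angleForm O.Θ) p) ∧
  ∀ q, radius q ≤ 1 → ∀ t : Cover,
    η (O.J q) (fderiv ℝ O.J q t) =
      P.f₁ (radius q) * dZ t + P.g₁ (radius q) * dTheta q t + P.e (radius q) * dRadius q t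

/-- The hyperplane field `D'` is obtained from `D` by cutting along the hypersurface `{r = R}` of
the tube and turbulizing the page leaves along it: `D` is tangent to the pages in a collar of the
hypersurface, `D'` agrees with `D` off the collar, and in the collar `D' = ker (p(r) dθ + q(r) dr)`,
where `p` vanishes exactly at `R`, `q R ≠ 0`, and `q` vanishes near the two ends of the collar.
Thus `{r = R}` is a compact leaf of `D'` onto which the cut pages spiral from both sides. -/
def IsTurbulization {A : SL(2, ℤ)} (O : SupportingOpenBook A) (R : ℝ)
    (D D' : C3 → Submodule ℝ C3) : Prop :=
  ∃ δ > 0, 0 < R - δ ∧ R + δ < 1 ∧ ∃ p q : ℝ → ℝ,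
    ContDiff ℝ ∞ p ∧ ContDiff ℝ ∞ q ∧
    (∀ r, |r - R| < δ → (p r = 0 ↔ r = R)) ∧
    q R ≠ 0 ∧ (∀ r, δ / 2 ≤ |r - R| → q r = 0) ∧
    (∀ x ∈ S5, (∀ y : Cover, |radius y - R| < δ → x ≠ O.J y) → D' x = D x) ∧
    (∀ y : Cover, |radius y - R| < δ → ∀ t : Cover,
      (fderiv ℝ O.J y t ∈ D (O.J y) ↔ dTheta y t = 0)) ∧
    (∀ y : Cover, |radius y - R| < δ → ∀ t : Cover,
      (fderiv ℝ O.J y t ∈ D' (O.J y) ↔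
        p (radius y) * dTheta y t + q (radius y) * dRadius y t = 0))

/-- `α s`, `0 ≤ s ≤ 1`, is a smooth family of 1-forms on `S⁵`, consisting of positive contact forms
for `s < 1` and of a form defining a codimension-one foliation for `s = 1`. -/
def IsContactToFoliation (α : ℝ → Form) : Prop :=
  ContDiffOn ℝ ∞ (fun x : ℝ × C3 => α x.1 x.2) (Set.Icc 0 1 ×ˢ {0}ᶜ) ∧
  (∀ s ∈ Set.Ico (0 : ℝ) 1, IsPositiveContact (α s)) ∧
  IsFoliationForm (α 1)

end LutzS5

end

noncomputable section

namespace LutzS5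

variable {M : SL(2, ℤ)}

/-! On the tube, put the forms `a β₊ + b β₋ + c dθ + H dz + E r dr` into `α ∧ (dα)²`. The result is
a positive constant times `2ab c' - (ab)' c`; the terms in `H` and `E` disappear, because each
contains `dr` or `dz` twice. The coefficients that build the foliation can therefore be added
without cost, and the contact condition only involves `ab` and `c`.

The limit form is `α₁ = θ c dθ + h dz + E r dr` on the tube and `dθ` outside. Here `θ` runs from 0
on `[0, r₀]` to 1 well before `R`, and the data are arranged so that `α₁` is a nonzero multiple of
the Reeb form away from `{r = R}`. Near `R` one has `α₁ = c dθ + q dr` with `q` a bump: since `c`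
changes sign exactly at `R`, this is the turbulization along the boundary of the Lutz tube.

For `(1 - σ) α₀ + σ α₁` the contact expression is `(1 - σ)²` times `(1 - σ + σ θ)(2ab c' - (ab)' c)
+ 2σ ab c θ'`. As `c < 0` and `θ' ≥ 0` inside the tube, the last term is harmless where `ab ≤ 0`.
But `ab` is positive at `R` and may already be so on the support of `θ'`. So `b` is first lowered to
`b - G` with `a G = K c²`, where `K` is a large constant on the support of `θ'` and decreases to 0
at `R`. This shifts the slope `ab / c²` by `-K` and changes the contact expression by `K' c³ ≥ 0`,
so the form stays contact, and now `ab - K c² ≤ 0` wherever `θ' ≠ 0`. The homotopy lowers `b` first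
and then takes the linear path (`exists_deformation`, `Deformation.turning`).

Outside the tube the path is `(1 - σ) ρΛ + σ dθ`. Since `dθ` is closed, positivity follows from the
contact condition for `ρΛ` and the supporting condition of the open book (`isPositiveContact_comb`).

What remains is transfer. Deck-invariant forms on the cover descend to the sphere
(`exists_descend_form`, `exists_glue`), and the coordinate orientation of the tube is the boundary
orientation of the ball. The latter is read off by evaluating `ρΛ ∧ (d(ρΛ))²` in two ways, by a
Pfaffian identity (`wedge122_stdForm`) and by the normal form (`orientation_pos_of_ne`). -/

/-! ### Antisymmetrization sums -/

/-- A permutation amounts to the image `p` of 0 and a permutation of the remaining indices; the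
transposition of 0 and `p` costs a sign unless `p = 0`. Iterating this turns sums over permutations
into cofactor expansions. -/
theorem sum_perm_fin_succ {X : Type*} (n : ℕ) (G : (Fin (n + 1) → X) → ℝ) (v : Fin (n + 1) → X) :
    ∑ σ : Equiv.Perm (Fin (n + 1)), ((Equiv.Perm.sign σ : ℤ) : ℝ) * G (fun i => v (σ i)) =
      ∑ p : Fin (n + 1), (if p = 0 then 1 else -1) *
        ∑ σ : Equiv.Perm (Fin n), ((Equiv.Perm.sign σ : ℤ) : ℝ) *
          G (Fin.cons (v p) (fun j => v (Equiv.swap 0 p (σ j).succ))) := by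
  rw [← Equiv.sum_comp (Equiv.Perm.decomposeFin (n := n)).symm, Fintype.sum_prod_type]
  refine Finset.sum_congr rfl fun p _ => ?_
  rw [Finset.mul_sum]
  refine Finset.sum_congr rfl fun σ _ => ?_
  have h : (fun i => v ((Equiv.Perm.decomposeFin.symm (p, σ)) i)) =
      (Fin.cons (v p) (fun j => v (Equiv.swap 0 p (σ j).succ)) : Fin (n + 1) → X) := by
    funext i
    refine Fin.cases ?_ (fun j => ?_) i
    · simp
    · simp
  rw [h, Equiv.Perm.decomposeFin.symm_sign]
  split_ifs <;> simp

theorem sum_perm_two {X : Type*} (G : X → X → ℝ) (y : Fin 2 → X) :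
    ∑ σ : Equiv.Perm (Fin 2), ((Equiv.Perm.sign σ : ℤ) : ℝ) * G (y (σ 0)) (y (σ 1)) =
      G (y 0) (y 1) - G (y 1) (y 0) := by
  refine (sum_perm_fin_succ 1 (fun u => G (u 0) (u 1)) y).trans ?_
  simp [Fin.sum_univ_succ]
  ring

theorem sum_perm_three {X : Type*} (M : X → X → ℝ) (hM : ∀ i j, M j i = -M i j)
    (n : X → ℝ) (y : Fin 3 → X) :
    ∑ σ : Equiv.Perm (Fin 3), ((Equiv.Perm.sign σ : ℤ) : ℝ) *
      (n (y (σ 0)) * M (y (σ 1)) (y (σ 2))) =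
      2 * (n (y 0) * M (y 1) (y 2) - n (y 1) * M (y 0) (y 2) + n (y 2) * M (y 0) (y 1)) := by
  refine (sum_perm_fin_succ 2 (fun u => n (u 0) * M (u 1) (u 2)) y).trans ?_
  have e : ∀ (b : X) (x : Fin 2 → X),
      (fun u : Fin 3 → X => n (u 0) * M (u 1) (u 2)) (Fin.cons b x) =
        n b * M (x 0) (x 1) := fun _ _ => rfl
  simp only [e]
  have e2 : ∀ (p : Fin 3) (b : X), ∑ σ : Equiv.Perm (Fin 2), ((Equiv.Perm.sign σ : ℤ) : ℝ) *
      (n b * M (y (Equiv.swap 0 p (σ 0).succ)) (y (Equiv.swap 0 p (σ 1).succ))) = _ := fun p b =>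
    sum_perm_two (fun i j => n b * M i j) (fun i => y (Equiv.swap 0 p i.succ))
  simp only [e2]
  simp only [Fin.sum_univ_succ, Fin.sum_univ_zero, Fin.succ_zero_eq_one, Fin.succ_one_eq_two,
    Equiv.swap_apply_def]
  simp [Fin.ext_iff]
  rw [hM (y 1) (y 2), hM (y 0) (y 2), hM (y 0) (y 1)]
  ring

theorem sum_perm_four {X : Type*} (M : X → X → ℝ) (hM : ∀ i j, M j i = -M i j)
    (y : Fin 4 → X) :
    ∑ σ : Equiv.Perm (Fin 4), ((Equiv.Perm.sign σ : ℤ) : ℝ) *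
      (M (y (σ 0)) (y (σ 1)) * M (y (σ 2)) (y (σ 3))) =
      8 * (M (y 0) (y 1) * M (y 2) (y 3) - M (y 0) (y 2) * M (y 1) (y 3)
        + M (y 0) (y 3) * M (y 1) (y 2)) := by
  refine (sum_perm_fin_succ 3 (fun u => M (u 0) (u 1) * M (u 2) (u 3)) y).trans ?_
  have e : ∀ (b : X) (x : Fin 3 → X),
      (fun u : Fin 4 → X => M (u 0) (u 1) * M (u 2) (u 3)) (Fin.cons b x) =
        M b (x 0) * M (x 1) (x 2) := fun _ _ => rfl
  simp only [e]
  have e2 : ∀ (p : Fin 4) (b : X), ∑ σ : Equiv.Perm (Fin 3), ((Equiv.Perm.sign σ : ℤ) : ℝ) *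
      (M b (y (Equiv.swap 0 p (σ 0).succ)) * M (y (Equiv.swap 0 p (σ 1).succ))
        (y (Equiv.swap 0 p (σ 2).succ))) = _ := fun p b =>
    sum_perm_three M hM (M b) (fun i => y (Equiv.swap 0 p i.succ))
  simp only [e2]
  simp only [Fin.sum_univ_succ, Fin.sum_univ_zero, Fin.succ_zero_eq_one, Fin.succ_one_eq_two,
    Equiv.swap_apply_def]
  simp [Fin.ext_iff]
  rw [hM (y 0) (y 1), hM (y 0) (y 2), hM (y 0) (y 3), hM (y 1) (y 2), hM (y 1) (y 3),
    hM (y 2) (y 3)]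
  ring

/-- The factor 8 counts the two orders inside each of the two pairs and the two orders of the pairs.
Each bracket is the Pfaffian of the four remaining indices. -/
theorem sum_perm_five {X : Type*} (n : X → ℝ) (M : X → X → ℝ) (hM : ∀ i j, M j i = -M i j)
    (y : Fin 5 → X) :
    ∑ σ : Equiv.Perm (Fin 5), ((Equiv.Perm.sign σ : ℤ) : ℝ) *
      (n (y (σ 0)) * M (y (σ 1)) (y (σ 2)) * M (y (σ 3)) (y (σ 4))) =
    8 * (n (y 0) * (M (y 1) (y 2) * M (y 3) (y 4) - M (y 1) (y 3) * M (y 2) (y 4)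
          + M (y 1) (y 4) * M (y 2) (y 3))
      - n (y 1) * (M (y 0) (y 2) * M (y 3) (y 4) - M (y 0) (y 3) * M (y 2) (y 4)
          + M (y 0) (y 4) * M (y 2) (y 3))
      + n (y 2) * (M (y 0) (y 1) * M (y 3) (y 4) - M (y 0) (y 3) * M (y 1) (y 4)
          + M (y 0) (y 4) * M (y 1) (y 3))
      - n (y 3) * (M (y 0) (y 1) * M (y 2) (y 4) - M (y 0) (y 2) * M (y 1) (y 4)
          + M (y 0) (y 4) * M (y 1) (y 2))
      + n (y 4) * (M (y 0) (y 1) * M (y 2) (y 3) - M (y 0) (y 2) * M (y 1) (y 3)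
          + M (y 0) (y 3) * M (y 1) (y 2))) := by
  refine (sum_perm_fin_succ 4 (fun u => n (u 0) * M (u 1) (u 2) * M (u 3) (u 4)) y).trans ?_
  have e : ∀ (b : X) (x : Fin 4 → X),
      (fun u : Fin 5 → X => n (u 0) * M (u 1) (u 2) * M (u 3) (u 4)) (Fin.cons b x) =
        n b * (M (x 0) (x 1) * M (x 2) (x 3)) := fun _ _ => mul_assoc _ _ _
  simp only [e, mul_left_comm _ (n _), ← Finset.mul_sum]
  have e2 : ∀ p : Fin 5, ∑ σ : Equiv.Perm (Fin 4), ((Equiv.Perm.sign σ : ℤ) : ℝ) *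
      (M (y (Equiv.swap 0 p (σ 0).succ)) (y (Equiv.swap 0 p (σ 1).succ)) *
        M (y (Equiv.swap 0 p (σ 2).succ)) (y (Equiv.swap 0 p (σ 3).succ))) = _ := fun p =>
    sum_perm_four M hM (fun i => y (Equiv.swap 0 p i.succ))
  simp only [e2]
  simp only [Fin.sum_univ_succ, Fin.sum_univ_zero, Fin.succ_zero_eq_one, Fin.succ_one_eq_two,
    Equiv.swap_apply_def]
  simp [Fin.ext_iff]
  rw [hM (y 0) (y 1), hM (y 0) (y 2), hM (y 0) (y 3)]
  ring

/-! ### Alternating maps, Pfaffians, and the volume form of the standard contact sphere -/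

/-- The multilinear map `η ⊗ τ ⊗ τ`. -/
def tensor122 {V : Type*} [AddCommGroup V] [Module ℝ V] (η : V →ₗ[ℝ] ℝ) (τ : V →ₗ[ℝ] V →ₗ[ℝ] ℝ) :
    MultilinearMap ℝ (fun _ : Fin 5 => V) ℝ :=
  MultilinearMap.mk' (fun v => η (v 0) * τ (v 1) (v 2) * τ (v 3) (v 4))
    (by
      intro v i x y
      fin_cases i <;> simp [Function.update] <;> ring)
    (by
      intro v i c x
      fin_cases i <;> simp [Function.update] <;> ring)

/-- `η ∧ τ ∧ τ` as an alternating map. -/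
def alt122 {V : Type*} [AddCommGroup V] [Module ℝ V] (η : V →ₗ[ℝ] ℝ) (τ : V →ₗ[ℝ] V →ₗ[ℝ] ℝ) :
    V [⋀^Fin 5]→ₗ[ℝ] ℝ :=
  MultilinearMap.alternatization (tensor122 η τ)

theorem alt122_apply {V : Type*} [AddCommGroup V] [Module ℝ V] (η : V →ₗ[ℝ] ℝ)
    (τ : V →ₗ[ℝ] V →ₗ[ℝ] ℝ) (v : Fin 5 → V) :
    alt122 η τ v = ∑ σ : Equiv.Perm (Fin 5), ((Equiv.Perm.sign σ : ℤ) : ℝ) *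
      (η (v (σ 0)) * τ (v (σ 1)) (v (σ 2)) * τ (v (σ 3)) (v (σ 4))) := by
  rw [alt122, MultilinearMap.alternatization_apply]
  refine Finset.sum_congr rfl fun σ _ => ?_
  simp [tensor122, Units.smul_def]

/-- The Pfaffian of `(Ω (vᵢ, vⱼ))` for six vectors. -/
def pfaffianFun {V : Type*} [AddCommGroup V] [Module ℝ V] (Ω : V →ₗ[ℝ] V →ₗ[ℝ] ℝ)
    (v : Fin 6 → V) : ℝ :=
  Ω (v 0) (v 1) * (Ω (v 2) (v 3) * Ω (v 4) (v 5) - Ω (v 2) (v 4) * Ω (v 3) (v 5)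
    + Ω (v 2) (v 5) * Ω (v 3) (v 4))
  - Ω (v 0) (v 2) * (Ω (v 1) (v 3) * Ω (v 4) (v 5) - Ω (v 1) (v 4) * Ω (v 3) (v 5)
    + Ω (v 1) (v 5) * Ω (v 3) (v 4))
  + Ω (v 0) (v 3) * (Ω (v 1) (v 2) * Ω (v 4) (v 5) - Ω (v 1) (v 4) * Ω (v 2) (v 5)
    + Ω (v 1) (v 5) * Ω (v 2) (v 4))
  - Ω (v 0) (v 4) * (Ω (v 1) (v 2) * Ω (v 3) (v 5) - Ω (v 1) (v 3) * Ω (v 2) (v 5)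
    + Ω (v 1) (v 5) * Ω (v 2) (v 3))
  + Ω (v 0) (v 5) * (Ω (v 1) (v 2) * Ω (v 3) (v 4) - Ω (v 1) (v 3) * Ω (v 2) (v 4)
    + Ω (v 1) (v 4) * Ω (v 2) (v 3))

theorem pfaffianFun_eq_zero {V : Type*} [AddCommGroup V] [Module ℝ V] (Ω : V →ₗ[ℝ] V →ₗ[ℝ] ℝ)
    (hΩ : ∀ x, Ω x x = 0) (hs : ∀ x y, Ω y x = -Ω x y) (v : Fin 6 → V) (i j : Fin 6) (hlt : i < j)
    (hij : v i = v j) : pfaffianFun Ω v = 0 := by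
  rw [pfaffianFun]
  fin_cases i <;> fin_cases j <;> first
    | exact absurd hlt (by decide)
    | (simp only [Fin.zero_eta, Fin.mk_one, Fin.reduceFinMk] at hij
       rw [hij]
       simp only [hΩ, hs (v 2) (v 1), hs (v 3) (v 1), hs (v 4) (v 1), hs (v 5) (v 1),
         hs (v 3) (v 2), hs (v 4) (v 2), hs (v 5) (v 2), hs (v 4) (v 3), hs (v 5) (v 3),
         hs (v 5) (v 4)]
       ring)

theorem bilin_antisymm {V : Type*} [AddCommGroup V] [Module ℝ V] (Ω : V →ₗ[ℝ] V →ₗ[ℝ] ℝ)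
    (hΩ : ∀ x, Ω x x = 0) (x y : V) : Ω y x = -Ω x y := by
  have := hΩ (x + y)
  simp only [map_add, LinearMap.add_apply, hΩ] at this
  linarith

set_option maxHeartbeats 1000000 in
/-- The Pfaffian as an alternating map. -/
def pfaffian {V : Type*} [AddCommGroup V] [Module ℝ V] (Ω : V →ₗ[ℝ] V →ₗ[ℝ] ℝ)
    (hΩ : ∀ x, Ω x x = 0) : V [⋀^Fin 6]→ₗ[ℝ] ℝ :=
  { MultilinearMap.mk' (pfaffianFun Ω)
      (by
        intro v i x y
        fin_cases i <;> simp [pfaffianFun, Function.update] <;> ring)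
      (by
        intro v i c x
        fin_cases i <;> simp [pfaffianFun, Function.update] <;> ring) with
    map_eq_zero_of_eq' := by
      intro v i j hij hne
      rcases lt_or_gt_of_ne hne with h | h
      · exact pfaffianFun_eq_zero Ω hΩ (bilin_antisymm Ω hΩ) v i j h hij
      · exact pfaffianFun_eq_zero Ω hΩ (bilin_antisymm Ω hΩ) v j i h hij.symm }

theorem pfaffian_apply {V : Type*} [AddCommGroup V] [Module ℝ V] (Ω : V →ₗ[ℝ] V →ₗ[ℝ] ℝ)
    (hΩ : ∀ x, Ω x x = 0) (v : Fin 6 → V) : pfaffian Ω hΩ v = pfaffianFun Ω v := rfl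

/-- With `n = Ω p`, the expansion `sum_perm_five` is exactly the expansion of the 6 × 6 Pfaffian
along the row of `p`. -/
theorem sum_perm_eq_pfaffian {V : Type*} [AddCommGroup V] [Module ℝ V] (Ω : V →ₗ[ℝ] V →ₗ[ℝ] ℝ)
    (hΩ : ∀ x, Ω x x = 0) (p : V) (v : Fin 5 → V) :
    ∑ σ : Equiv.Perm (Fin 5), ((Equiv.Perm.sign σ : ℤ) : ℝ) *
      (Ω p (v (σ 0)) * Ω (v (σ 1)) (v (σ 2)) * Ω (v (σ 3)) (v (σ 4))) =
    8 * pfaffian Ω hΩ (Fin.cons p v) := by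
  exact sum_perm_five (fun x => Ω p x) (fun x y => Ω x y) (bilin_antisymm Ω hΩ) v

/-- The standard symplectic form of `ℝ⁶`. -/
def omega6 : (Fin 6 → ℝ) →ₗ[ℝ] (Fin 6 → ℝ) →ₗ[ℝ] ℝ :=
  LinearMap.mk₂ ℝ (fun x y => x 0 * y 1 - x 1 * y 0 + (x 2 * y 3 - x 3 * y 2)
      + (x 4 * y 5 - x 5 * y 4))
    (by intros; simp; ring) (by intros; simp; ring) (by intros; simp; ring)
    (by intros; simp; ring)

theorem omega6_self (x : Fin 6 → ℝ) : omega6 x x = 0 := by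
  simp [omega6]; ring

/-- Both sides are alternating in six vectors of a six-dimensional space, so it suffices that both
are 1 on the standard basis. -/
theorem pfaffian_omega6 (v : Fin 6 → Fin 6 → ℝ) :
    pfaffian omega6 omega6_self v = (Matrix.of v).det := by
  have h1 : pfaffian omega6 omega6_self (Pi.basisFun ℝ (Fin 6)) = 1 := by
    rw [pfaffian_apply]
    simp [pfaffianFun, omega6]
  have h := AlternatingMap.eq_smul_basis_det (Pi.basisFun ℝ (Fin 6))
    (pfaffian omega6 omega6_self)
  rw [h1, one_smul, Pi.basisFun_det] at h
  rw [h]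
  exact Matrix.det_apply (Matrix.of v) ▸ Matrix.det_apply v

theorem realCoord_add (v w : C3) : realCoord (v + w) = realCoord v + realCoord w := by
  funext i
  fin_cases i <;> simp [realCoord]

theorem realCoord_smul (c : ℝ) (v : C3) : realCoord (c • v) = c • realCoord v := by
  funext i
  fin_cases i <;> simp [realCoord]

/-- `realCoord` as a linear map. -/
def realCoordₗ : C3 →ₗ[ℝ] Fin 6 → ℝ where
  toFun := realCoord
  map_add' := realCoord_add
  map_smul' := realCoord_smul

/-- The contact form is the contraction of the symplectic form with the radial vector; this is what
brings in the Pfaffian. -/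
theorem stdForm_apply (p v : C3) : stdForm p v = omega6 (realCoord p) (realCoord v) := by
  simp [stdForm, omega6, realCoord, coordCLM, Fin.sum_univ_succ]
  ring

/-- `stdForm` as a linear map. -/
def stdFormL : C3 →L[ℝ] C3 →L[ℝ] ℝ :=
  LinearMap.toContinuousLinearMap
    { toFun := stdForm
      map_add' := fun x y => by
        ext v; simp [stdForm_apply, realCoord_add]
      map_smul' := fun c x => by
        ext v; simp [stdForm_apply, realCoord_smul] }

theorem stdForm_eq : stdForm = stdFormL := rfl

theorem contDiff_stdForm : ContDiff ℝ ∞ stdForm := stdFormL.contDiff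

theorem fderiv_stdForm (p v : C3) : fderiv ℝ stdForm p v = stdForm v := by
  rw [stdForm_eq, ContinuousLinearMap.fderiv]

/-- Here `d(ρΛ) = dρ ∧ Λ + 2ρ ω`, and the first term dies against `Λ`. What is left is `4ρ³ Λ ∧ ω²`
with `Λ = ω(p, ·)`, which is a Pfaffian and hence a determinant. -/
theorem wedge122_stdForm (ρ : C3 → ℝ) (p : C3) (hρ : DifferentiableAt ℝ ρ p) (v : Fin 5 → C3) :
    wedge122 (ρ p • stdForm p) (dForm (fun x => ρ x • stdForm x) p) v =
      32 * ρ p ^ 3 * (Matrix.of (Fin.cons (realCoord p) (fun i => realCoord (v i))) :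
        Matrix (Fin 6) (Fin 6) ℝ).det := by
  have hd : ∀ x y, dForm (fun x => ρ x • stdForm x) p x y =
      fderiv ℝ ρ p x * stdForm p y - fderiv ℝ ρ p y * stdForm p x +
        2 * ρ p * omega6 (realCoord x) (realCoord y) := by
    intro x y
    have : omega6 (realCoord y) (realCoord x) = - omega6 (realCoord x) (realCoord y) := by
      simp [omega6]; ring
    rw [dForm, fderiv_fun_smul hρ (contDiff_stdForm.differentiable (by simp) p)]
    simp [fderiv_stdForm]
    rw [stdForm_apply x y, stdForm_apply y x, this]
    ring
  have hs : ∀ x y, dForm (fun x => ρ x • stdForm x) p y x =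
      - dForm (fun x => ρ x • stdForm x) p x y := by
    intro x y; simp [dForm]
  have h0 := sum_perm_eq_pfaffian omega6 omega6_self (realCoord p) (fun i => realCoord (v i))
  rw [pfaffian_omega6] at h0
  have h1 := sum_perm_five (fun x => omega6 (realCoord p) x) (fun x y => omega6 x y)
      (bilin_antisymm omega6 omega6_self) (fun i => realCoord (v i))
  have h2 := h1.symm.trans h0
  rw [wedge122, sum_perm_five (fun x => (ρ p • stdForm p) x) _ hs v]
  simp only [hd, smul_apply, smul_eq_mul, stdForm_apply]
  -- The coefficient is `ρ · (2ρ)²`; the terms with derivatives of `ρ` cancel identically.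
  linear_combination (4 * ρ p ^ 3) * h2

/-! ### Exterior derivatives on normed spaces -/

/-- The exterior derivative of a 1-form on a normed space. -/
def extD {E : Type*} [NormedAddCommGroup E] [NormedSpace ℝ E] (τ : E → E →L[ℝ] ℝ) (x v w : E) : ℝ :=
  fderiv ℝ τ x v w - fderiv ℝ τ x w v

theorem extD_congr {E : Type*} [NormedAddCommGroup E] [NormedSpace ℝ E] {τ τ' : E → E →L[ℝ] ℝ}
    {x : E} (h : τ =ᶠ[nhds x] τ') (v w : E) : extD τ x v w = extD τ' x v w := by
  rw [extD, extD, h.fderiv_eq]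

theorem extD_swap {E : Type*} [NormedAddCommGroup E] [NormedSpace ℝ E] (τ : E → E →L[ℝ] ℝ)
    (x v w : E) : extD τ x w v = -extD τ x v w := by
  simp [extD]

/-- The exterior derivative at a point, as a bilinear map. -/
def extDₗ {E : Type*} [NormedAddCommGroup E] [NormedSpace ℝ E] (τ : E → E →L[ℝ] ℝ) (x : E) :
    E →ₗ[ℝ] E →ₗ[ℝ] ℝ :=
  LinearMap.mk₂ ℝ (extD τ x) (by intros; simp [extD]; ring) (by intros; simp [extD]; ring)
    (by intros; simp [extD]; ring) (by intros; simp [extD]; ring)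

/-- The second derivative of `φ` enters symmetrically and cancels in the antisymmetrization. -/
theorem extD_pullback {E F : Type*} [NormedAddCommGroup E] [NormedSpace ℝ E]
    [NormedAddCommGroup F] [NormedSpace ℝ F] {φ : E → F} {τ : F → F →L[ℝ] ℝ} {x : E}
    (hφ : ContDiffAt ℝ 2 φ x) (hτ : DifferentiableAt ℝ τ (φ x)) (v w : E) :
    extD (fun y => (τ (φ y)).comp (fderiv ℝ φ y)) x v w =
      extD τ (φ x) (fderiv ℝ φ x v) (fderiv ℝ φ x w) := by
  have h1 : DifferentiableAt ℝ φ x := hφ.differentiableAt (by simp)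
  have h2 : DifferentiableAt ℝ (fderiv ℝ φ) x :=
    (hφ.fderiv_right (m := 1) (by norm_num)).differentiableAt (by simp)
  have h3 := (hτ.hasFDerivAt.comp x h1.hasFDerivAt).clm_comp h2.hasFDerivAt
  have hs : fderiv ℝ (fderiv ℝ φ) x v w = fderiv ℝ (fderiv ℝ φ) x w v :=
    hφ.isSymmSndFDerivAt (by simp) v w
  have h4 : fderiv ℝ (fun y => (τ (φ y)).comp (fderiv ℝ φ y)) x = _ := h3.fderiv
  rw [extD, extD, h4]
  simp [hs]

/-! ### The universal cover of the tube -/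

/-- Coordinates on the cover. -/
def coverEquiv : Cover ≃ₗ[ℝ] (Fin 5 → ℝ) where
  toFun t := ![t.1, t.2.1, t.2.2.1, t.2.2.2.re, t.2.2.2.im]
  invFun x := (x 0, x 1, x 2, ⟨x 3, x 4⟩)
  map_add' s t := by funext i; fin_cases i <;> simp
  map_smul' c t := by funext i; fin_cases i <;> simp
  left_inv t := by simp
  right_inv x := by funext i; fin_cases i <;> simp

/-- The coordinate basis of the cover. -/
def coverBasis : Module.Basis (Fin 5) ℝ Cover := Module.Basis.ofEquivFun coverEquiv

theorem coverBasis_apply (i : Fin 5) : coverBasis i = coverEquiv.symm (Pi.single i 1) := by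
  simp [coverBasis]

theorem finrank_cover : Module.finrank ℝ Cover = 5 := by
  rw [Module.finrank_eq_card_basis coverBasis]; simp

def cX : Cover →L[ℝ] ℝ := ContinuousLinearMap.fst ℝ _ _
def cY : Cover →L[ℝ] ℝ := ContinuousLinearMap.fst ℝ _ _ ∘L ContinuousLinearMap.snd ℝ _ _
def cZ : Cover →L[ℝ] ℝ :=
  ContinuousLinearMap.fst ℝ _ _ ∘L ContinuousLinearMap.snd ℝ _ _ ∘L ContinuousLinearMap.snd ℝ _ _
def cW : Cover →L[ℝ] ℂ :=
  ContinuousLinearMap.snd ℝ _ _ ∘L ContinuousLinearMap.snd ℝ _ _ ∘L ContinuousLinearMap.snd ℝ _ _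

@[simp] theorem cX_apply (t : Cover) : cX t = t.1 := rfl
@[simp] theorem cY_apply (t : Cover) : cY t = t.2.1 := rfl
@[simp] theorem cZ_apply (t : Cover) : cZ t = t.2.2.1 := rfl
@[simp] theorem cW_apply (t : Cover) : cW t = t.2.2.2 := rfl

/-- The covector `Re (w̄ dw) = r dr` on `ℂ`. -/
def radialCovector (w : ℂ) : ℂ →L[ℝ] ℝ := w.re • Complex.reCLM + w.im • Complex.imCLM

@[simp] theorem radialCovector_apply (w v : ℂ) :
    radialCovector w v = w.re * v.re + w.im * v.im := by
  simp [radialCovector]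

/-- `φ` has derivative `φ₁ r dr` at `w`. -/
def HasRadialDeriv (φ : ℂ → ℝ) (φ₁ : ℝ) (w : ℂ) : Prop :=
  HasFDerivAt φ (φ₁ • radialCovector w) w

variable {M : SL(2, ℤ)}

/-- `dvol (v₊, ·)` and `- dvol (v₋, ·)`. -/
def EigenData.covP (D : EigenData M) : Cover →L[ℝ] ℝ := D.vp.1 • cY - D.vp.2 • cX
def EigenData.covM (D : EigenData M) : Cover →L[ℝ] ℝ := -(D.vm.1 • cY - D.vm.2 • cX)

/-- The 1-form `A β₊ + B β₋ + C r² dθ + H dz + E r dr` on the cover. -/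
def tubeForm (D : EigenData M) (A B C H E : ℂ → ℝ) (q : Cover) : Cover →L[ℝ] ℝ :=
  (A (cW q) * Real.exp (-(Real.log D.a * cZ q))) • D.covP
    + (B (cW q) * Real.exp (Real.log D.a * cZ q)) • D.covM
    + H (cW q) • cZ
    + (E (cW q) * (cW q).re - C (cW q) * (cW q).im) • (Complex.reCLM ∘L cW)
    + (E (cW q) * (cW q).im + C (cW q) * (cW q).re) • (Complex.imCLM ∘L cW)

theorem EigenData.a_pos (D : EigenData M) : 0 < D.a := zero_lt_one.trans D.one_lt

theorem betaPlus_eq (D : EigenData M) (q t : Cover) :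
    D.betaPlus q t = Real.exp (-(Real.log D.a * cZ q)) * D.covP t := by
  rw [EigenData.betaPlus, Real.rpow_def_of_pos D.a_pos]
  simp [EigenData.covP]

theorem betaMinus_eq (D : EigenData M) (q t : Cover) :
    D.betaMinus q t = Real.exp (Real.log D.a * cZ q) * D.covM t := by
  rw [EigenData.betaMinus, Real.rpow_def_of_pos D.a_pos]
  simp [EigenData.covM]
  ring

theorem tubeForm_apply (D : EigenData M) (A B C H E : ℂ → ℝ) (q t : Cover) :
    tubeForm D A B C H E q t = A q.2.2.2 * D.betaPlus q t + B q.2.2.2 * D.betaMinus q t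
      + C q.2.2.2 * (starRingEnd ℂ q.2.2.2 * t.2.2.2).im + H q.2.2.2 * dZ t
      + E q.2.2.2 * (starRingEnd ℂ q.2.2.2 * t.2.2.2).re := by
  rw [betaPlus_eq, betaMinus_eq]
  simp [tubeForm, dZ]
  ring

theorem contDiff_tubeForm (D : EigenData M) {A B C H E : ℂ → ℝ} (hA : ContDiff ℝ ∞ A)
    (hB : ContDiff ℝ ∞ B) (hC : ContDiff ℝ ∞ C) (hH : ContDiff ℝ ∞ H) (hE : ContDiff ℝ ∞ E) :
    ContDiff ℝ ∞ (tubeForm D A B C H E) := by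
  have hre : ContDiff ℝ ∞ (fun q : Cover => (cW q).re) :=
    Complex.reCLM.contDiff.comp cW.contDiff
  have him : ContDiff ℝ ∞ (fun q : Cover => (cW q).im) :=
    Complex.imCLM.contDiff.comp cW.contDiff
  have hz : ContDiff ℝ ∞ (fun q : Cover => Real.log D.a * cZ q) :=
    contDiff_const.mul cZ.contDiff
  have hA := hA.comp cW.contDiff
  have hB := hB.comp cW.contDiff
  have hC := hC.comp cW.contDiff
  have hH := hH.comp cW.contDiff
  have hE := hE.comp cW.contDiff
  exact (((((hA.mul hz.neg.exp).smul contDiff_const).add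
    ((hB.mul hz.exp).smul contDiff_const)).add (hH.smul contDiff_const)).add
    (((hE.mul hre).sub (hC.mul him)).smul contDiff_const)).add
    (((hE.mul him).add (hC.mul hre)).smul contDiff_const)

/-- Radial derivatives are measured against `r dr`, so `φ₁` stands for `φ' / r` and makes sense on
the core. The inputs are `dβ₊ = -log a dz ∧ β₊`, `dβ₋ = log a dz ∧ β₋` and `d(r² dθ) = 2 dx ∧ dy`.
The coefficient `E` drops out because a radial multiple of `r dr` is closed. -/
theorem extD_tubeForm (D : EigenData M) {A B C H E : ℂ → ℝ} {A₁ B₁ C₁ H₁ E₁ : ℝ} {q : Cover}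
    (hA : HasRadialDeriv A A₁ q.2.2.2) (hB : HasRadialDeriv B B₁ q.2.2.2)
    (hC : HasRadialDeriv C C₁ q.2.2.2) (hH : HasRadialDeriv H H₁ q.2.2.2)
    (hE : HasRadialDeriv E E₁ q.2.2.2) (s t : Cover) :
    extD (tubeForm D A B C H E) q s t =
      (A₁ * (radialCovector q.2.2.2 s.2.2.2 * D.betaPlus q t
          - radialCovector q.2.2.2 t.2.2.2 * D.betaPlus q s)
        - Real.log D.a * A q.2.2.2 * (s.2.2.1 * D.betaPlus q t - t.2.2.1 * D.betaPlus q s))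
      + (B₁ * (radialCovector q.2.2.2 s.2.2.2 * D.betaMinus q t
          - radialCovector q.2.2.2 t.2.2.2 * D.betaMinus q s)
        + Real.log D.a * B q.2.2.2 * (s.2.2.1 * D.betaMinus q t - t.2.2.1 * D.betaMinus q s))
      + H₁ * (radialCovector q.2.2.2 s.2.2.2 * t.2.2.1 - radialCovector q.2.2.2 t.2.2.2 * s.2.2.1)
      + (2 * C q.2.2.2 + C₁ * (q.2.2.2.re ^ 2 + q.2.2.2.im ^ 2)) *
        (s.2.2.2.re * t.2.2.2.im - s.2.2.2.im * t.2.2.2.re) := by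
  have comp : ∀ {φ : ℂ → ℝ} {φ₁ : ℝ}, HasRadialDeriv φ φ₁ q.2.2.2 →
      HasFDerivAt (fun q : Cover => φ (cW q)) ((φ₁ • radialCovector q.2.2.2) ∘L cW) q :=
    fun h => HasFDerivAt.comp q (show HasFDerivAt _ _ (cW q) from h) cW.hasFDerivAt
  have hre : HasFDerivAt (fun q : Cover => (cW q).re) (Complex.reCLM ∘L cW) q :=
    (Complex.reCLM ∘L cW).hasFDerivAt
  have him : HasFDerivAt (fun q : Cover => (cW q).im) (Complex.imCLM ∘L cW) q :=
    (Complex.imCLM ∘L cW).hasFDerivAt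
  have hz : HasFDerivAt (fun q : Cover => Real.log D.a * cZ q) (Real.log D.a • cZ) q :=
    cZ.hasFDerivAt.const_mul _
  have h := ((((((comp hA).mul hz.neg.exp).smul_const D.covP).add
    (((comp hB).mul hz.exp).smul_const D.covM)).add ((comp hH).smul_const cZ)).add
    ((((comp hE).mul hre).sub ((comp hC).mul him)).smul_const (Complex.reCLM ∘L cW))).add
    ((((comp hE).mul him).add ((comp hC).mul hre)).smul_const (Complex.imCLM ∘L cW))
  have h' : fderiv ℝ (tubeForm D A B C H E) q = _ := h.fderiv
  rw [extD, h']
  simp only [betaPlus_eq, betaMinus_eq]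
  simp
  ring

theorem cover_sum_eq_det (η : Cover →L[ℝ] ℝ) (τ : Cover →ₗ[ℝ] Cover →ₗ[ℝ] ℝ)
    (v : Fin 5 → Cover) :
    ∑ σ : Equiv.Perm (Fin 5), ((Equiv.Perm.sign σ : ℤ) : ℝ) *
      (η (v (σ 0)) * τ (v (σ 1)) (v (σ 2)) * τ (v (σ 3)) (v (σ 4))) =
    (∑ σ : Equiv.Perm (Fin 5), ((Equiv.Perm.sign σ : ℤ) : ℝ) *
      (η (coverBasis (σ 0)) * τ (coverBasis (σ 1)) (coverBasis (σ 2)) *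
        τ (coverBasis (σ 3)) (coverBasis (σ 4)))) * coverBasis.det v := by
  have h := alt122_apply (η : Cover →ₗ[ℝ] ℝ) τ
  have h2 := AlternatingMap.eq_smul_basis_det coverBasis (alt122 (η : Cover →ₗ[ℝ] ℝ) τ)
  have h3 := congrArg (fun f => f v) h2
  simp only [AlternatingMap.smul_apply, h] at h3
  exact h3

/-- `α ∧ (dα)²` for a radial form on the tube. -/
theorem tubeForm_contact (D : EigenData M) {A B C H E : ℂ → ℝ} {A₁ B₁ C₁ H₁ E₁ : ℝ} {q : Cover}
    (hA : HasRadialDeriv A A₁ q.2.2.2) (hB : HasRadialDeriv B B₁ q.2.2.2)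
    (hC : HasRadialDeriv C C₁ q.2.2.2) (hH : HasRadialDeriv H H₁ q.2.2.2)
    (hE : HasRadialDeriv E E₁ q.2.2.2) (v : Fin 5 → Cover) :
    ∑ σ : Equiv.Perm (Fin 5), ((Equiv.Perm.sign σ : ℤ) : ℝ) *
      (tubeForm D A B C H E q (v (σ 0)) * extD (tubeForm D A B C H E) q (v (σ 1)) (v (σ 2)) *
        extD (tubeForm D A B C H E) q (v (σ 3)) (v (σ 4))) =
    8 * Real.log D.a * (D.vp.1 * D.vm.2 - D.vp.2 * D.vm.1) *
      (2 * (A q.2.2.2 * B q.2.2.2) *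
          (2 * C q.2.2.2 + C₁ * (q.2.2.2.re ^ 2 + q.2.2.2.im ^ 2))
        - (A₁ * B q.2.2.2 + A q.2.2.2 * B₁) *
          ((q.2.2.2.re ^ 2 + q.2.2.2.im ^ 2) * C q.2.2.2)) * coverBasis.det v := by
  refine (cover_sum_eq_det (tubeForm D A B C H E q) (extDₗ (tubeForm D A B C H E) q) v).trans ?_
  congr 1
  -- The only `z`-dependence of `β₊ ∧ β₋` is this product, so the volume factor is independent of
  -- `z`.
  have hexp : Real.exp (-(Real.log D.a * cZ q)) * Real.exp (Real.log D.a * cZ q) = 1 := by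
    rw [← Real.exp_add]; simp
  refine (sum_perm_five (fun x => tubeForm D A B C H E q x)
    (fun x y => extD (tubeForm D A B C H E) q x y) (extD_swap _ q) coverBasis).trans ?_
  simp only [extD_tubeForm D hA hB hC hH hE, tubeForm_apply, betaPlus_eq, betaMinus_eq,
    coverBasis_apply, coverEquiv, EigenData.covP, EigenData.covM, dZ]
  generalize Real.exp (-(Real.log D.a * cZ q)) = x at *
  generalize Real.exp (Real.log D.a * cZ q) = y at *
  simp
  linear_combination (8 * Real.log D.a * (D.vp.1 * D.vm.2 - D.vp.2 * D.vm.1) *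
      (2 * (A q.2.2.2 * B q.2.2.2) *
          (2 * C q.2.2.2 + C₁ * (q.2.2.2.re ^ 2 + q.2.2.2.im ^ 2))
        - (A₁ * B q.2.2.2 + A q.2.2.2 * B₁) *
          ((q.2.2.2.re ^ 2 + q.2.2.2.im ^ 2) * C q.2.2.2))) * hexp

/-! ### Deck transformations -/

/-- Since `A` preserves area and `A v = a v`, one has `dvol(v, A u) = a⁻¹ dvol(v, u)`; the induction
runs in both directions. -/
theorem zpow_eigen (A : SL(2, ℤ)) (v : ℝ × ℝ) (a : ℝ) (ha : a ≠ 0)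
    (h1 : (A 0 0 : ℝ) * v.1 + (A 0 1 : ℝ) * v.2 = a * v.1)
    (h2 : (A 1 0 : ℝ) * v.1 + (A 1 1 : ℝ) * v.2 = a * v.2) (n : ℤ) : ∀ x y : ℝ,
    v.1 * (((A ^ n) 1 0 : ℝ) * x + ((A ^ n) 1 1 : ℝ) * y)
      - v.2 * (((A ^ n) 0 0 : ℝ) * x + ((A ^ n) 0 1 : ℝ) * y) = a ^ (-n) * (v.1 * y - v.2 * x) := by
  have hdet : (A 0 0 : ℝ) * A 1 1 - (A 0 1 : ℝ) * A 1 0 = 1 := by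
    have := A.det_coe
    rw [Matrix.det_fin_two] at this
    exact_mod_cast this
  induction n using Int.induction_on with
  | zero => intro x y; simp
  | succ n ih =>
    intro x y
    have e := ih ((A 0 0 : ℝ) * x + (A 0 1 : ℝ) * y) ((A 1 0 : ℝ) * x + (A 1 1 : ℝ) * y)
    have hz : a ^ (-((n : ℤ) + 1)) = a ^ (-(n : ℤ)) * a⁻¹ := by
      rw [neg_add, zpow_add₀ ha, zpow_neg_one]
    rw [zpow_add_one, hz]
    simp only [Matrix.SpecialLinearGroup.coe_mul, Matrix.mul_apply, Fin.sum_univ_two]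
    push_cast
    have key : v.1 * ((A 1 0 : ℝ) * x + (A 1 1 : ℝ) * y) - v.2 * ((A 0 0 : ℝ) * x + (A 0 1 : ℝ) * y)
        = a⁻¹ * (v.1 * y - v.2 * x) := by
      field_simp
      linear_combination (-((A 1 0 : ℝ) * x + (A 1 1 : ℝ) * y)) * h1 +
        ((A 0 0 : ℝ) * x + (A 0 1 : ℝ) * y) * h2 + (v.1 * y - v.2 * x) * hdet
    rw [key] at e
    linear_combination e
  | pred n ih =>
    intro x y
    have e := ih ((A 1 1 : ℝ) * x - (A 0 1 : ℝ) * y) (-(A 1 0 : ℝ) * x + (A 0 0 : ℝ) * y)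
    have hz : a ^ (-(-(n : ℤ) - 1)) = a ^ (-(-(n : ℤ))) * a := by
      rw [neg_sub, sub_neg_eq_add, add_comm, zpow_add₀ ha, zpow_one, neg_neg]
    have hi : ∀ i j, (A ^ (-(n : ℤ) - 1)) i j =
        (A ^ (-(n : ℤ))) i 0 * (A⁻¹) 0 j + (A ^ (-(n : ℤ))) i 1 * (A⁻¹) 1 j := by
      intro i j
      rw [zpow_sub_one, Matrix.SpecialLinearGroup.coe_mul, Matrix.mul_apply, Fin.sum_univ_two]
    have i00 : (A⁻¹) 0 0 = A 1 1 := by rw [Matrix.SpecialLinearGroup.SL2_inv_expl]; rfl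
    have i01 : (A⁻¹) 0 1 = -A 0 1 := by rw [Matrix.SpecialLinearGroup.SL2_inv_expl]; rfl
    have i10 : (A⁻¹) 1 0 = -A 1 0 := by rw [Matrix.SpecialLinearGroup.SL2_inv_expl]; rfl
    have i11 : (A⁻¹) 1 1 = A 0 0 := by rw [Matrix.SpecialLinearGroup.SL2_inv_expl]; rfl
    rw [hz, hi, hi, hi, hi, i00, i01, i10, i11]
    push_cast
    have key : v.1 * (-(A 1 0 : ℝ) * x + (A 0 0 : ℝ) * y) -
        v.2 * ((A 1 1 : ℝ) * x - (A 0 1 : ℝ) * y) = a * (v.1 * y - v.2 * x) := by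
      linear_combination y * h1 - x * h2
    rw [key] at e
    linear_combination e

/-- `Γ` is the linear part of the deck transformation taking `q` to `q'`. It multiplies `dvol(v₊,
·)` and `dvol(v₋, ·)` by `a^(-n)` and `a^n`, and the shift of `z` by `-n` in the prefactors `a^(-z)`
and `a^z` undoes this. -/
theorem SupportingOpenBook.exists_deck (O : SupportingOpenBook M) {q q' : Cover}
    (h : SamePoint M q q') : ∃ Γ : Cover →L[ℝ] Cover,
      (∀ t, fderiv ℝ O.J q' (Γ t) = fderiv ℝ O.J q t) ∧
      ∀ A B C H E t, tubeForm O.eig A B C H E q' (Γ t) = tubeForm O.eig A B C H E q t := by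
  obtain ⟨⟨n, i, j, h1, h2, h3⟩, h4⟩ := h
  let Γ : Cover →L[ℝ] Cover :=
    ((((M ^ n) 0 0 : ℝ) • cX + ((M ^ n) 0 1 : ℝ) • cY)).prod
      (((((M ^ n) 1 0 : ℝ) • cX + ((M ^ n) 1 1 : ℝ) • cY)).prod (cZ.prod cW))
  have hΓ : ∀ t, Γ t = (((M ^ n) 0 0 : ℝ) * t.1 + ((M ^ n) 0 1 : ℝ) * t.2.1,
      ((M ^ n) 1 0 : ℝ) * t.1 + ((M ^ n) 1 1 : ℝ) * t.2.1, t.2.2.1, t.2.2.2) := fun t => rfl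
  let c : Cover := ((i : ℝ), (j : ℝ), (-(n : ℝ)), 0)
  have hγ : ∀ x, O.J (Γ x + c) = O.J x := fun x =>
    ((O.J_eq_iff x (Γ x + c)).2 ⟨⟨n, i, j, by simp [hΓ, c], by simp [hΓ, c], by simp [hΓ, c]⟩,
      by simp [hΓ, c]⟩).symm
  have hq : Γ q + c = q' := by
    ext1
    · simp [hΓ, c, h1]
    · ext1
      · simp [hΓ, c, h2]
      · ext1
        · simp [hΓ, c]; linarith
        · simp [hΓ, c, h4]
  refine ⟨Γ, fun t => ?_, fun A B C H E t => ?_⟩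
  · have hd : HasFDerivAt (fun x => O.J (Γ x + c)) ((fderiv ℝ O.J q').comp Γ) q := by
      refine HasFDerivAt.comp q (f := fun x => Γ x + c) ?_ (Γ.hasFDerivAt.add_const c)
      rw [hq]
      exact (O.J_smooth.differentiable (by simp) q').hasFDerivAt
    simp only [hγ] at hd
    rw [show fderiv ℝ O.J q = _ from hd.fderiv]; rfl
  · have hp := zpow_eigen M O.eig.vp O.eig.a O.eig.a_pos.ne' O.eig.eig_vp.1 O.eig.eig_vp.2 n t.1 t.2.1
    have hm := zpow_eigen M O.eig.vm O.eig.a⁻¹ (inv_pos.2 O.eig.a_pos).ne' O.eig.eig_vm.1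
      O.eig.eig_vm.2 n t.1 t.2.1
    have hbp : O.eig.betaPlus q' (Γ t) = O.eig.betaPlus q t := by
      simp only [EigenData.betaPlus, hΓ]
      rw [hp, show -q.2.2.1 = -q'.2.2.1 + ((-n : ℤ) : ℝ) by rw [h3]; push_cast; ring,
        Real.rpow_add O.eig.a_pos, Real.rpow_intCast]
      ring
    have hbm : O.eig.betaMinus q' (Γ t) = O.eig.betaMinus q t := by
      simp only [EigenData.betaMinus, hΓ]
      rw [hm, h3, Real.rpow_add O.eig.a_pos, Real.rpow_intCast, inv_zpow', neg_neg]
      ring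
    rw [tubeForm_apply, tubeForm_apply, hbp, hbm, ← h4]
    rfl

/-! ### The tube as a subset of the sphere -/

theorem mem_tangentSpace {p v : C3} : v ∈ tangentSpace p ↔ inner ℝ p v = 0 :=
  Submodule.mem_orthogonal_singleton_iff_inner_right

theorem mem_S5 {p : C3} : p ∈ S5 ↔ ‖p‖ = 1 := by simp [S5]

theorem ne_zero_of_mem_S5 {p : C3} (hp : p ∈ S5) : p ≠ 0 := by
  rintro rfl
  simp [mem_S5] at hp

theorem finrank_C3 : Module.finrank ℝ C3 = 6 := by
  rw [finrank_real_of_complex, finrank_euclideanSpace]; simp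

theorem finrank_tangentSpace {p : C3} (hp : p ∈ S5) : Module.finrank ℝ (tangentSpace p) = 5 := by
  have : Fact (Module.finrank ℝ C3 = 5 + 1) := ⟨finrank_C3⟩
  exact Submodule.finrank_orthogonal_span_singleton (ne_zero_of_mem_S5 hp)

namespace SupportingOpenBook
variable (O : SupportingOpenBook M)

theorem norm_J (q : Cover) : ‖O.J q‖ = 1 := mem_S5.1 (O.J_mem q)

theorem J_ne_zero (q : Cover) : O.J q ≠ 0 := ne_zero_of_mem_S5 (O.J_mem q)

theorem differentiableAt_J (q : Cover) : DifferentiableAt ℝ O.J q :=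
  O.J_smooth.differentiable (by simp) q

theorem contDiff_fderiv_J : ContDiff ℝ ∞ (fderiv ℝ O.J) :=
  (contDiff_infty_iff_fderiv.1 O.J_smooth).2

theorem inner_J_fderiv (q t : Cover) : inner ℝ (O.J q) (fderiv ℝ O.J q t) = 0 := by
  have h := (O.differentiableAt_J q).hasFDerivAt.norm_sq
  have h2 : (fun x => ‖O.J x‖ ^ 2) = fun _ => (1 : ℝ) := by
    funext x; rw [O.norm_J]; norm_num
  rw [h2] at h
  have h3 := DFunLike.congr_fun (h.unique (hasFDerivAt_const (1 : ℝ) q)) t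
  simpa using h3

theorem fderiv_J_mem (q t : Cover) : fderiv ℝ O.J q t ∈ tangentSpace (O.J q) :=
  mem_tangentSpace.2 (O.inner_J_fderiv q t)

/-- The differential is injective from dimension 5 into the 5-dimensional tangent space, hence onto
it. All pointwise checks on the tube can thus be made on the cover. -/
theorem exists_fderiv_J_eq (q : Cover) {v : C3} (hv : v ∈ tangentSpace (O.J q)) :
    ∃ t, fderiv ℝ O.J q t = v := by
  have hle : LinearMap.range (fderiv ℝ O.J q : Cover →ₗ[ℝ] C3) ≤ tangentSpace (O.J q) := by
    rintro _ ⟨t, rfl⟩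
    exact O.fderiv_J_mem q t
  have hr : Module.finrank ℝ (LinearMap.range (fderiv ℝ O.J q : Cover →ₗ[ℝ] C3)) = 5 := by
    rw [LinearMap.finrank_range_of_inj (O.J_immersion q), finrank_cover]
  have he := Submodule.eq_of_le_of_finrank_eq hle (by rw [hr, finrank_tangentSpace (O.J_mem q)])
  rw [← he] at hv
  exact hv

/-! ### Polar parametrization and local sections -/

/-- The derivative at `(q, s)` of the polar parametrization `(q, s) ↦ s J(q)`. -/
def polarDeriv (q : Cover) (s : ℝ) : Cover × ℝ →L[ℝ] C3 :=
  s • (fderiv ℝ O.J q ∘L ContinuousLinearMap.fst ℝ Cover ℝ)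
    + (ContinuousLinearMap.snd ℝ Cover ℝ).smulRight (O.J q)

theorem polarDeriv_apply (q : Cover) (s : ℝ) (t : Cover × ℝ) :
    O.polarDeriv q s t = s • fderiv ℝ O.J q t.1 + t.2 • O.J q := rfl

theorem hasFDerivAt_polar (q : Cover) (s : ℝ) :
    HasFDerivAt (fun x : Cover × ℝ => x.2 • O.J x.1) (O.polarDeriv q s) (q, s) := by
  have h := (hasFDerivAt_snd (𝕜 := ℝ) (p := (q, s))).smul
    ((O.differentiableAt_J q).hasFDerivAt.comp (q, s) (hasFDerivAt_fst (𝕜 := ℝ) (p := (q, s))))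
  exact h

theorem contDiff_polar : ContDiff ℝ ∞ (fun x : Cover × ℝ => x.2 • O.J x.1) :=
  contDiff_snd.smul (O.J_smooth.comp contDiff_fst)

theorem polarDeriv_injective (q : Cover) {s : ℝ} (hs : s ≠ 0) :
    Function.Injective (O.polarDeriv q s) := by
  rw [injective_iff_map_eq_zero]
  intro t ht
  rw [polarDeriv_apply] at ht
  have h2 : t.2 = 0 := by
    have := congrArg (inner ℝ (O.J q)) ht
    rw [inner_add_right, inner_smul_right, inner_smul_right, O.inner_J_fderiv,
      real_inner_self_eq_norm_sq, O.norm_J] at this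
    simpa using this
  rw [h2, zero_smul, add_zero, smul_eq_zero] at ht
  have h1 : t.1 = 0 := O.J_immersion q ((ht.resolve_left hs).trans (map_zero _).symm)
  exact Prod.ext h1 h2

theorem exists_polarEquiv (q : Cover) {s : ℝ} (hs : s ≠ 0) :
    ∃ e : (Cover × ℝ) ≃L[ℝ] C3, (e : Cover × ℝ →L[ℝ] C3) = O.polarDeriv q s := by
  refine ⟨(LinearEquiv.ofInjectiveOfFinrankEq (O.polarDeriv q s : Cover × ℝ →ₗ[ℝ] C3)
    (O.polarDeriv_injective q hs) ?_).toContinuousLinearEquiv, ?_⟩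
  · rw [Module.finrank_prod, finrank_cover, finrank_C3, Module.finrank_self]
  · exact ContinuousLinearMap.ext fun x => rfl

/-- Near a point over `J q₀` the sphere is parametrized by a smooth local inverse of `J`. -/
theorem exists_local_section {q₀ : Cover} {x₀ : C3} (hx : x₀ ≠ 0) (h : O.J q₀ = ‖x₀‖⁻¹ • x₀) :
    ∃ Q : C3 → Cover, ContDiffAt ℝ ∞ Q x₀ ∧ Q x₀ = q₀ ∧
      ∀ᶠ x in nhds x₀, O.J (Q x) = ‖x‖⁻¹ • x := by
  have hn : ‖x₀‖ ≠ 0 := norm_ne_zero_iff.2 hx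
  obtain ⟨e, he⟩ := O.exists_polarEquiv q₀ hn
  have hd : HasFDerivAt (fun x : Cover × ℝ => x.2 • O.J x.1) (e : Cover × ℝ →L[ℝ] C3)
      (q₀, ‖x₀‖) := he ▸ O.hasFDerivAt_polar q₀ ‖x₀‖
  have hc : ContDiffAt ℝ ∞ (fun x : Cover × ℝ => x.2 • O.J x.1) (q₀, ‖x₀‖) :=
    O.contDiff_polar.contDiffAt
  have hx0 : (fun x : Cover × ℝ => x.2 • O.J x.1) (q₀, ‖x₀‖) = x₀ := by
    simp only
    rw [h, smul_smul, mul_inv_cancel₀ hn, one_smul]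
  have hne : (∞ : WithTop ℕ∞) ≠ 0 := by simp
  have hs := hc.to_localInverse hd hne
  have hi := hc.localInverse_apply_image hd hne
  have hr := (hc.hasStrictFDerivAt' hd hne).eventually_right_inverse
  simp only at hx0
  simp only [hx0] at hs hi hr
  refine ⟨fun x => (hc.localInverse hd hne x).1, contDiff_fst.contDiffAt.comp x₀ hs, congrArg Prod.fst hi, ?_⟩
  -- Positivity of the second component forces it to be `‖x‖`, so that the first component is a
  -- preimage of `x / ‖x‖`.
  have hpos : ∀ᶠ x in nhds x₀, 0 < (hc.localInverse hd hne x).2 := by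
    have : ContinuousAt (fun x => (hc.localInverse hd hne x).2) x₀ :=
      continuous_snd.continuousAt.comp hs.continuousAt
    refine this.eventually_const_lt ?_
    simp only [hi]
    exact norm_pos_iff.2 hx
  filter_upwards [hr, hpos] with x hx1 hx2
  have hx1 : (hc.localInverse hd hne x).2 • O.J (hc.localInverse hd hne x).1 = x := hx1
  have hxn : ‖x‖ = (hc.localInverse hd hne x).2 := by
    conv_lhs => rw [← hx1]
    rw [norm_smul, O.norm_J, mul_one, Real.norm_of_nonneg hx2.le]
  rw [eq_inv_smul_iff₀ (by rw [hxn]; exact hx2.ne'), hxn]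
  exact hx1

/-! ### Closed tubes, descent to the sphere, and gluing -/

/-- The image of `{r ≤ r₁}`. -/
def closedTube (r₁ : ℝ) : Set C3 := {p | ∃ q, radius q ≤ r₁ ∧ O.J q = p}

theorem isCompact_closedTube (r₁ : ℝ) : IsCompact (O.closedTube r₁) := by
  have hK : IsCompact (Set.Icc (0 : ℝ) 1 ×ˢ (Set.Icc (0 : ℝ) 1 ×ˢ (Set.Icc (0 : ℝ) 1 ×ˢ
      Metric.closedBall (0 : ℂ) r₁))) :=
    isCompact_Icc.prod (isCompact_Icc.prod (isCompact_Icc.prod (isCompact_closedBall _ _)))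
  suffices h : O.closedTube r₁ = O.J '' _ from h ▸ hK.image O.J_smooth.continuous
  ext p
  constructor
  · rintro ⟨q, hq, rfl⟩
    -- The deck transformation with this `n` brings `z` into `[0, 1)`; integer translations then
    -- reduce the two torus coordinates, giving a point of a compact fundamental domain.
    set n := ⌊q.2.2.1⌋
    set X := ((M ^ n) 0 0 : ℝ) * q.1 + ((M ^ n) 0 1 : ℝ) * q.2.1
    set Y := ((M ^ n) 1 0 : ℝ) * q.1 + ((M ^ n) 1 1 : ℝ) * q.2.1
    refine ⟨(Int.fract X, Int.fract Y, Int.fract q.2.2.1, q.2.2.2), ⟨?_, ?_, ?_, ?_⟩, ?_⟩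
    · exact ⟨Int.fract_nonneg _, (Int.fract_lt_one _).le⟩
    · exact ⟨Int.fract_nonneg _, (Int.fract_lt_one _).le⟩
    · exact ⟨Int.fract_nonneg _, (Int.fract_lt_one _).le⟩
    · simpa [radius] using hq
    · refine ((O.J_eq_iff q (Int.fract X, Int.fract Y, Int.fract q.2.2.1, q.2.2.2)).2 ⟨⟨n, -⌊X⌋, -⌊Y⌋, ?_, ?_, ?_⟩, rfl⟩).symm
      · change Int.fract X = X + ((-⌊X⌋ : ℤ) : ℝ)
        rw [Int.fract, Int.cast_neg]; ring
      · change Int.fract Y = Y + ((-⌊Y⌋ : ℤ) : ℝ)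
        rw [Int.fract, Int.cast_neg]; ring
      · simp [n]
  · rintro ⟨q, ⟨_, _, _, hq⟩, rfl⟩
    exact ⟨q, by simpa [radius] using hq, rfl⟩

theorem eventually_notMem_closedTube {r₁ : ℝ} {x₀ : C3} (hx : x₀ ≠ 0)
    (h : ‖x₀‖⁻¹ • x₀ ∉ O.closedTube r₁) : ∀ᶠ x in nhds x₀, ‖x‖⁻¹ • x ∉ O.closedTube r₁ := by
  have hc : ContinuousAt (fun x : C3 => ‖x‖⁻¹ • x) x₀ :=
    (continuousAt_id.norm.inv₀ (norm_ne_zero_iff.2 hx)).smul continuousAt_id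
  exact hc.eventually_mem ((O.isCompact_closedTube r₁).isClosed.isOpen_compl.mem_nhds h)

theorem radius_eq_of_J_eq {q q' : Cover} (h : O.J q = O.J q') : radius q = radius q' := by
  rw [radius, radius, ((O.J_eq_iff q q').1 h).2]

/-- A deck-invariant map supported in a tube descends to the sphere. -/
theorem exists_descend {X : Type*} [NormedAddCommGroup X] [NormedSpace ℝ X] (F : Cover → X)
    (hF : ContDiff ℝ ∞ F) (hinv : ∀ q q', O.J q = O.J q' → F q = F q') (r₁ : ℝ)
    (hsupp : ∀ q, r₁ ≤ radius q → F q = 0) :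
    ∃ G : C3 → X, ContDiffOn ℝ ∞ G {0}ᶜ ∧ (∀ q x, O.J q = ‖x‖⁻¹ • x → G x = F q) ∧
      ∀ x, ‖x‖⁻¹ • x ∉ O.closedTube r₁ → G x = 0 := by
  classical
  let G : C3 → X := fun x => if h : ∃ q, O.J q = ‖x‖⁻¹ • x then F h.choose else 0
  have hG : ∀ q x, O.J q = ‖x‖⁻¹ • x → G x = F q := by
    intro q x h
    have hex : ∃ q, O.J q = ‖x‖⁻¹ • x := ⟨q, h⟩
    simp only [G, dif_pos hex]
    exact hinv _ _ (hex.choose_spec.trans h.symm)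
  have h0 : ∀ x, ‖x‖⁻¹ • x ∉ O.closedTube r₁ → G x = 0 := by
    intro x hx
    by_cases hex : ∃ q, O.J q = ‖x‖⁻¹ • x
    · obtain ⟨q, hq⟩ := hex
      rw [hG q x hq]
      refine hsupp q (le_of_not_ge fun hle => hx ⟨q, hle, hq⟩)
    · simp only [G, dif_neg hex]
  refine ⟨G, fun x₀ hx => ContDiffAt.contDiffWithinAt ?_, hG, h0⟩
  by_cases hmem : ‖x₀‖⁻¹ • x₀ ∈ O.closedTube r₁
  · obtain ⟨q₀, -, hq₀⟩ := hmem
    obtain ⟨Q, hQ, hQ0, hQe⟩ := O.exists_local_section hx hq₀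
    refine (hF.contDiffAt.comp x₀ hQ).congr_of_eventuallyEq ?_
    filter_upwards [hQe] with x hxe using hG (Q x) x hxe
  · refine contDiffAt_const (c := (0 : X)) |>.congr_of_eventuallyEq ?_
    filter_upwards [O.eventually_notMem_closedTube hx hmem] with x hxe using h0 x hxe

theorem contDiff_polarDeriv : ContDiff ℝ ∞ (fun q => O.polarDeriv q 1) := by
  have h1 : ContDiff ℝ ∞ (fun q => fderiv ℝ O.J q ∘L ContinuousLinearMap.fst ℝ Cover ℝ) :=
    O.contDiff_fderiv_J.clm_comp contDiff_const
  have h2 : ContDiff ℝ ∞ (fun q => (ContinuousLinearMap.snd ℝ Cover ℝ).smulRight (O.J q)) :=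
    ContDiff.smulRight contDiff_const O.J_smooth
  simp only [polarDeriv]
  exact (h1.const_smul (1 : ℝ)).add h2

theorem contDiff_polarDeriv_inverse : ContDiff ℝ ∞ (fun q => (O.polarDeriv q 1).inverse) := by
  rw [contDiff_iff_contDiffAt]
  intro q
  obtain ⟨e, he⟩ := O.exists_polarEquiv q one_ne_zero
  have h3 : ContDiffAt ℝ ∞ ContinuousLinearMap.inverse (O.polarDeriv q 1) :=
    he ▸ contDiffAt_map_inverse e
  exact h3.comp q O.contDiff_polarDeriv.contDiffAt

/-- A deck-invariant 1-form supported in a tube descends to the sphere. -/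
theorem exists_descend_form (τ : Cover → Cover →L[ℝ] ℝ) (hτ : ContDiff ℝ ∞ τ)
    (hinv : ∀ q q', SamePoint M q q' → ∃ Γ : Cover → Cover,
      (∀ t, fderiv ℝ O.J q' (Γ t) = fderiv ℝ O.J q t) ∧ ∀ t, τ q' (Γ t) = τ q t)
    (r₁ : ℝ) (hsupp : ∀ q, r₁ ≤ radius q → τ q = 0) :
    ∃ ψ : Form, IsSmoothForm ψ ∧ (∀ q t, ψ (O.J q) (fderiv ℝ O.J q t) = τ q t) ∧
      ∀ x, ‖x‖⁻¹ • x ∉ O.closedTube r₁ → ψ x = 0 := by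
  -- The covector is carried to `ℂ³` by the polar frame and set to vanish on the radial direction.
  -- The radial direction depends only on the image point, so the result is deck-invariant.
  let F : Cover → C3 →L[ℝ] ℝ := fun q =>
    (τ q ∘L ContinuousLinearMap.fst ℝ Cover ℝ) ∘L (O.polarDeriv q 1).inverse
  have hinverse : ∀ q t, (O.polarDeriv q 1).inverse (O.polarDeriv q 1 t) = t := by
    intro q t
    obtain ⟨e, he⟩ := O.exists_polarEquiv q one_ne_zero
    rw [← he, ContinuousLinearMap.inverse_equiv]
    exact e.symm_apply_apply t
  have hF1 : ∀ q t, F q (fderiv ℝ O.J q t) = τ q t := by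
    intro q t
    have : fderiv ℝ O.J q t = O.polarDeriv q 1 (t, 0) := by simp [polarDeriv_apply]
    simp only [F, ContinuousLinearMap.comp_apply]
    rw [this, hinverse]; rfl
  have hF2 : ∀ q, F q (O.J q) = 0 := by
    intro q
    have : O.J q = O.polarDeriv q 1 (0, 1) := by simp [polarDeriv_apply]
    simp only [F, ContinuousLinearMap.comp_apply]
    conv_lhs => rw [this]
    rw [hinverse]; simp
  have hsm : ContDiff ℝ ∞ F := by
    have h1 : ContDiff ℝ ∞ (fun q => τ q ∘L ContinuousLinearMap.fst ℝ Cover ℝ) :=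
      hτ.clm_comp contDiff_const
    exact h1.clm_comp O.contDiff_polarDeriv_inverse
  have hFinv : ∀ q q', O.J q = O.J q' → F q = F q' := by
    intro q q' h
    obtain ⟨Γ, hΓ, hτΓ⟩ := hinv q q' ((O.J_eq_iff q q').1 h)
    obtain ⟨e, he⟩ := O.exists_polarEquiv q one_ne_zero
    ext v
    obtain ⟨t, rfl⟩ := e.surjective v
    have ht : e t = fderiv ℝ O.J q t.1 + t.2 • O.J q := by
      have : e t = O.polarDeriv q 1 t := by rw [← he]; rfl
      rw [this, polarDeriv_apply, one_smul]
    rw [ht, map_add, map_add, map_smul, map_smul, hF1, hF2, ← hΓ, hF1, h, hF2, hτΓ]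
  obtain ⟨G, hG1, hG2, hG3⟩ := O.exists_descend F hsm hFinv r₁ (fun q hq => by
    simp [F, hsupp q hq])
  refine ⟨G, hG1, fun q t => ?_, hG3⟩
  rw [hG2 q (O.J q) (by rw [O.norm_J]; simp), hF1]

theorem not_closedTube_of_not_tube {p : C3} (hp : p ∉ O.tube) {r₁ : ℝ} (h : r₁ < 1) :
    p ∉ O.closedTube r₁ := by
  rintro ⟨q, hq, rfl⟩
  exact hp ⟨q, hq.trans_lt h, rfl⟩

theorem notMem_binding_iff {p : C3} :
    (∀ q : Cover, q.2.2.2 = 0 → p ≠ O.J q) ↔ p ∉ O.closedTube 0 := by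
  constructor
  · rintro h ⟨q, hq, rfl⟩
    exact h q (norm_le_zero_iff.1 hq) rfl
  · rintro h q hq rfl
    exact h ⟨q, by simp [radius, hq], rfl⟩

/-- A radial form on the tube and a form off the binding which agree near the boundary of the tube
are glued to a form on the sphere. -/
theorem exists_glue (ext : Form)
    (hext : ∀ x, x ≠ 0 → ‖x‖⁻¹ • x ∉ O.closedTube 0 → ContDiffAt ℝ ∞ ext x)
    {A B C H E : ℂ → ℝ} (hA : ContDiff ℝ ∞ A)
    (hB : ContDiff ℝ ∞ B) (hC : ContDiff ℝ ∞ C) (hH : ContDiff ℝ ∞ H) (hE : ContDiff ℝ ∞ E)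
    {rₐ : ℝ} (hr0 : 0 < rₐ) (hr1 : rₐ < 1)
    (hagree : ∀ q, rₐ ≤ radius q → radius q ≤ 1 → ∀ t,
      ext (O.J q) (fderiv ℝ O.J q t) = tubeForm O.eig A B C H E q t) :
    ∃ ψ : Form, IsSmoothForm ψ ∧
      (∀ q, radius q ≤ 1 → ∀ t, ψ (O.J q) (fderiv ℝ O.J q t) = tubeForm O.eig A B C H E q t) ∧
      ∀ p ∈ S5, p ∉ O.tube → ψ =ᶠ[nhds p] ext := by
  obtain ⟨r₁, h1, h2⟩ := exists_between hr1
  have hsq : rₐ ^ 2 < r₁ ^ 2 := by gcongr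
  -- The cutoff is a function of `r²` so that it is smooth across the core: it is 1 for `r ≤ rₐ` and
  -- 0 for `r ≥ r₁`.
  let k : Cover → ℝ := fun q =>
    Real.smoothTransition ((r₁ ^ 2 - ((cW q).re ^ 2 + (cW q).im ^ 2)) / (r₁ ^ 2 - rₐ ^ 2))
  have hnorm : ∀ q : Cover, (cW q).re ^ 2 + (cW q).im ^ 2 = radius q ^ 2 := by
    intro q
    rw [radius, Complex.sq_norm, Complex.normSq_apply, cW_apply]; ring
  have hr : ∀ q, 0 ≤ radius q := fun q => norm_nonneg _
  have hk : ContDiff ℝ ∞ k := by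
    have hre : ContDiff ℝ ∞ (fun q : Cover => (cW q).re) :=
      Complex.reCLM.contDiff.comp cW.contDiff
    have him : ContDiff ℝ ∞ (fun q : Cover => (cW q).im) :=
      Complex.imCLM.contDiff.comp cW.contDiff
    exact Real.smoothTransition.contDiff.comp
      ((contDiff_const.sub ((hre.pow 2).add (him.pow 2))).div_const _)
  have hk1 : ∀ q, radius q ≤ rₐ → k q = 1 := by
    intro q hq
    apply Real.smoothTransition.one_of_one_le
    rw [hnorm, le_div_iff₀ (sub_pos.2 hsq), one_mul]
    have : radius q ^ 2 ≤ rₐ ^ 2 := by gcongr; exact hr q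
    linarith
  have hk0 : ∀ q, r₁ ≤ radius q → k q = 0 := by
    intro q hq
    apply Real.smoothTransition.zero_of_nonpos
    rw [hnorm]
    have : r₁ ^ 2 ≤ radius q ^ 2 := by have := hr0.trans h1; gcongr
    exact div_nonpos_of_nonpos_of_nonneg (by linarith) (by linarith)
  have hkinv : ∀ q q', O.J q = O.J q' → k q = k q' := by
    intro q q' h
    simp only [k, hnorm, O.radius_eq_of_J_eq h]
  obtain ⟨κ, hκ1, hκ2, hκ3⟩ := O.exists_descend k hk hkinv r₁ hk0
  obtain ⟨ψ, hψ1, hψ2, hψ3⟩ := O.exists_descend_form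
    (fun q => k q • tubeForm O.eig A B C H E q) (hk.smul (contDiff_tubeForm _ hA hB hC hH hE))
    (fun q q' h => by
      obtain ⟨Γ, hΓ1, hΓ2⟩ := O.exists_deck h
      refine ⟨Γ, hΓ1, fun t => ?_⟩
      simp [hΓ2, hkinv q q' ((O.J_eq_iff q q').2 h)])
    r₁ (fun q hq => by simp [hk0 q hq])
  refine ⟨fun x => ψ x + (1 - κ x) • ext x, ?_, ?_, ?_⟩
  · refine hψ1.add fun x₀ hx => ContDiffAt.contDiffWithinAt ?_
    by_cases hmem : ‖x₀‖⁻¹ • x₀ ∈ O.closedTube 0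
    · obtain ⟨q₀, hr₀, hq₀⟩ := hmem
      obtain ⟨Q, hQ, hQ0, hQe⟩ := O.exists_local_section hx hq₀
      have hrad : ∀ᶠ x in nhds x₀, radius (Q x) < rₐ := by
        have hc : ContinuousAt (fun x => radius (Q x)) x₀ :=
          (cW.continuous.norm.continuousAt).comp hQ.continuousAt
        refine hc.eventually_lt_const ?_
        simp only [hQ0]; linarith
      -- `ext` may be singular on the binding, but its coefficient `1 - κ` vanishes identically
      -- nearby.
      refine contDiffAt_const (c := (0 : C3 →L[ℝ] ℝ)) |>.congr_of_eventuallyEq ?_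
      filter_upwards [hQe, hrad] with x h1 h2
      rw [hκ2 _ _ h1, hk1 _ h2.le, sub_self, zero_smul]
    · exact (contDiffAt_const.sub (hκ1.contDiffAt (isOpen_compl_singleton.mem_nhds hx))).smul
        (hext x₀ hx hmem)
  · intro q hq t
    have hkq : κ (O.J q) = k q := hκ2 q _ (by rw [O.norm_J]; simp)
    simp only [add_apply, smul_apply, hψ2, hkq, smul_eq_mul]
    rcases le_total (radius q) rₐ with h | h
    · rw [hk1 q h]; ring
    · rw [hagree q h hq]; ring
  · intro p hp hpt
    have hn : ‖p‖⁻¹ • p = p := by rw [mem_S5.1 hp]; simp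
    filter_upwards [O.eventually_notMem_closedTube (r₁ := r₁) (ne_zero_of_mem_S5 hp)
      (hn.symm ▸ O.not_closedTube_of_not_tube hpt h2)] with x hx
    rw [hψ3 x hx, hκ3 x hx]; simp

end SupportingOpenBook

/-! ### Radial functions -/

/-- `φ(|w|)` is a smooth function of `w ∈ ℂ`. -/
def Radial (φ : ℝ → ℝ) : Prop := ContDiff ℝ ∞ (fun w : ℂ => φ ‖w‖)

theorem Radial.of_core {φ : ℝ → ℝ} (h : ∀ r > 0, ContDiffAt ℝ ∞ φ r) {ε : ℝ} (hε : 0 < ε)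
    (hc : ∀ r ∈ Set.Icc 0 ε, φ r = φ 0) : Radial φ := by
  rw [Radial, contDiff_iff_contDiffAt]
  intro w
  rcases eq_or_ne w 0 with rfl | hw
  · refine (contDiffAt_const (c := φ 0)).congr_of_eventuallyEq ?_
    filter_upwards [Metric.ball_mem_nhds (0 : ℂ) hε] with w hw
    exact hc _ ⟨norm_nonneg w, (mem_ball_zero_iff.1 hw).le⟩
  · exact (h _ (norm_pos_iff.2 hw)).comp w (contDiffAt_norm ℝ hw)

theorem Radial.const (c : ℝ) : Radial (fun _ => c) := contDiff_const
theorem Radial.sq : Radial (fun r => r ^ 2) := contDiff_norm_sq ℝ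
theorem Radial.mul {φ ψ : ℝ → ℝ} (h : Radial φ) (h' : Radial ψ) : Radial (fun r => φ r * ψ r) :=
  ContDiff.mul h h'
theorem Radial.add {φ ψ : ℝ → ℝ} (h : Radial φ) (h' : Radial ψ) : Radial (fun r => φ r + ψ r) :=
  ContDiff.add h h'
theorem Radial.sub {φ ψ : ℝ → ℝ} (h : Radial φ) (h' : Radial ψ) : Radial (fun r => φ r - ψ r) :=
  ContDiff.sub h h'

theorem hasFDerivAt_norm_complex {w : ℂ} (hw : w ≠ 0) :
    HasFDerivAt (fun w : ℂ => ‖w‖) (‖w‖⁻¹ • radialCovector w) w := by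
  have h := (hasStrictFDerivAt_norm_sq w).hasFDerivAt.sqrt
    (pow_ne_zero 2 (norm_ne_zero_iff.2 hw))
  have h2 : (fun w : ℂ => √(‖w‖ ^ 2)) = fun w => ‖w‖ := by
    funext w; exact Real.sqrt_sq (norm_nonneg w)
  simp only [h2] at h
  refine h.congr_fderiv ?_
  ext v
  all_goals simp [Real.sqrt_sq]
  ring

theorem hasRadialDeriv_of_ne {φ : ℝ → ℝ} {φ' : ℝ} {w : ℂ} (hw : w ≠ 0)
    (h : HasDerivAt φ φ' ‖w‖) : HasRadialDeriv (fun w => φ ‖w‖) (φ' / ‖w‖) w := by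
  have h2 := h.comp_hasFDerivAt w (hasFDerivAt_norm_complex hw)
  rw [smul_smul, ← div_eq_mul_inv] at h2
  exact h2

/-- A radial function is even, so its derivative at the origin vanishes. As `r dr` vanishes there
too, any value of `c` is admissible. -/
theorem hasRadialDeriv_zero {φ : ℝ → ℝ} (h : Radial φ) (c : ℝ) :
    HasRadialDeriv (fun w => φ ‖w‖) c 0 := by
  have hd : HasFDerivAt (fun w : ℂ => φ ‖w‖) (fderiv ℝ (fun w : ℂ => φ ‖w‖) 0) 0 :=
    (h.differentiable (by simp) 0).hasFDerivAt
  have hd' : HasFDerivAt (fun w : ℂ => φ ‖w‖) (fderiv ℝ (fun w : ℂ => φ ‖w‖) 0) (-(0 : ℂ)) := by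
    rw [neg_zero]; exact hd
  have hid : HasFDerivAt (fun w : ℂ => -w) (-(ContinuousLinearMap.id ℝ ℂ)) 0 :=
    (hasFDerivAt_id (𝕜 := ℝ) (0 : ℂ)).neg
  have hneg := (hd'.comp (0 : ℂ) hid).congr_of_eventuallyEq
    (f₁ := fun w : ℂ => φ ‖w‖) (Filter.Eventually.of_forall fun w => by simp)
  have hu := hneg.unique hd
  have h0 : fderiv ℝ (fun w : ℂ => φ ‖w‖) 0 = 0 := by
    refine ContinuousLinearMap.ext fun v => ?_
    have := DFunLike.congr_fun hu v
    simp only [ContinuousLinearMap.comp_apply, neg_apply, ContinuousLinearMap.id_apply, map_neg]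
      at this
    rw [zero_apply]; linarith
  rw [h0] at hd
  refine hd.congr_fderiv ?_
  ext v
  simp

/-! ### Frames of the sphere -/

/-- `det (p, ·)` as an alternating map. -/
@[irreducible] def frameDet (p : C3) : C3 [⋀^Fin 5]→ₗ[ℝ] ℝ :=
  ((Matrix.detRowAlternating (n := Fin 6) (R := ℝ)).curryLeft (realCoord p)).compLinearMap realCoordₗ

theorem detRowAlternating_apply (X : Fin 6 → Fin 6 → ℝ) :
    (Matrix.detRowAlternating : (Fin 6 → ℝ) [⋀^Fin 6]→ₗ[ℝ] ℝ) X = (Matrix.of X).det :=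
  Matrix.det_apply (Matrix.of X) ▸ Matrix.det_apply X

theorem frameDet_apply (p : C3) (v : Fin 5 → C3) : frameDet p v =
    (Matrix.of (Fin.cons (realCoord p) (fun i => realCoord (v i))) :
      Matrix (Fin 6) (Fin 6) ℝ).det := by
  rw [frameDet, AlternatingMap.compLinearMap_apply, AlternatingMap.curryLeft_apply_apply,
    detRowAlternating_apply]
  rfl

/-- Positive frames exist, so the supporting inequality is not vacuous at any point; this is how `dθ
≠ 0` is obtained off the tube. -/
theorem exists_positiveFrame {p : C3} (hp : p ∈ S5) : ∃ v, IsPositiveFrame p v := by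
  have hfr := finrank_tangentSpace hp
  let b := Module.finBasisOfFinrankEq ℝ (tangentSpace p) hfr
  let v : Fin 5 → C3 := fun i => b i
  have hv : ∀ i, v i ∈ tangentSpace p := fun i => (b i).2
  have hli : LinearIndependent ℝ v :=
    b.linearIndependent.map' (tangentSpace p).subtype (Submodule.ker_subtype _)
  have hspan : Submodule.span ℝ (Set.range v) ≤ tangentSpace p := by
    rw [Submodule.span_le]; rintro _ ⟨i, rfl⟩; exact hv i
  have hli2 : LinearIndependent ℝ (Fin.cons p v : Fin 6 → C3) := by
    refine LinearIndependent.finCons hli fun hmem => ?_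
    have := mem_tangentSpace.1 (hspan hmem)
    rw [real_inner_self_eq_norm_sq, mem_S5.1 hp] at this
    norm_num at this
  have hinj : LinearMap.ker realCoordₗ = ⊥ := by
    rw [LinearMap.ker_eq_bot']
    intro x hx
    have h : ∀ i, realCoord x i = 0 := fun i => congrFun hx i
    ext i
    fin_cases i
    · exact Complex.ext (h 0) (h 1)
    · exact Complex.ext (h 2) (h 3)
    · exact Complex.ext (h 4) (h 5)
  have hli3 := hli2.map' realCoordₗ hinj
  have hdet : frameDet p v ≠ 0 := by
    rw [frameDet_apply]
    have hrow : realCoordₗ ∘ (Fin.cons p v : Fin 6 → C3) =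
        (Fin.cons (realCoord p) (fun i => realCoord (v i)) : Fin 6 → Fin 6 → ℝ) := by
      funext i
      refine Fin.cases ?_ (fun j => ?_) i <;> rfl
    rw [hrow] at hli3
    exact IsUnit.ne_zero ((Matrix.isUnit_iff_isUnit_det _).1
      (Matrix.linearIndependent_rows_iff_isUnit.1 hli3))
  rcases lt_or_gt_of_ne hdet with h | h
  · refine ⟨Function.update v 0 (-v 0), fun i => ?_, ?_⟩
    · by_cases hi : i = 0
      · subst hi; simpa using hv 0
      · simpa [Function.update_of_ne hi] using hv i
    · rw [← frameDet_apply, ← neg_one_smul ℝ (v 0), AlternatingMap.map_update_smul,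
        Function.update_eq_self]
      simpa using h
  · exact ⟨v, hv, frameDet_apply p v ▸ h⟩

/-! ### The page form -/

/-- The curve is `p + t v` normalized; its norm is stationary at `t = 0` because `v` is orthogonal
to `p`. Since `|Θ| = 1` is known only on the sphere, it must be differentiated along curves in the
sphere. -/
theorem hasDerivAt_normalize {p v : C3} (hp : p ∈ S5) (hv : v ∈ tangentSpace p) :
    ∃ c : ℝ → C3, c 0 = p ∧ (∀ t, c t ∈ S5) ∧ HasDerivAt c v 0 := by
  have hpos : ∀ t : ℝ, 0 < 1 + t ^ 2 * ‖v‖ ^ 2 := fun t => by positivity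
  refine ⟨fun t => (√(1 + t ^ 2 * ‖v‖ ^ 2))⁻¹ • (p + t • v), by simp, fun t => ?_, ?_⟩
  · have hn : ‖p + t • v‖ = √(1 + t ^ 2 * ‖v‖ ^ 2) := by
      rw [eq_comm, Real.sqrt_eq_iff_mul_self_eq (hpos t).le (norm_nonneg _), ← pow_two,
        norm_add_sq_real, inner_smul_right, mem_tangentSpace.1 hv, mem_S5.1 hp, norm_smul, mul_pow,
        Real.norm_eq_abs, sq_abs]
      ring
    rw [mem_S5, norm_smul, hn, norm_inv, Real.norm_of_nonneg (Real.sqrt_nonneg _)]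
    exact inv_mul_cancel₀ (Real.sqrt_pos.2 (hpos t)).ne'
  · have h1 : HasDerivAt (fun t : ℝ => 1 + t ^ 2 * ‖v‖ ^ 2) 0 0 := by
      have := (((hasDerivAt_id (0 : ℝ)).pow 2).mul_const (‖v‖ ^ 2)).const_add 1
      simpa using this
    have h2 : HasDerivAt (fun t : ℝ => (√(1 + t ^ 2 * ‖v‖ ^ 2))⁻¹) 0 0 := by
      exact ((h1.sqrt (by simp)).inv (by simp)).congr_deriv (by simp)
    have h3 : HasDerivAt (fun t : ℝ => p + t • v) v 0 := by
      have := ((hasDerivAt_id (0 : ℝ)).smul_const v).const_add p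
      simpa using this
    exact (h2.smul h3).congr_deriv (by simp)

namespace SupportingOpenBook
variable (O : SupportingOpenBook M)

theorem contDiffAt_Θ {x : C3} (hx : x ≠ 0) (h : ‖x‖⁻¹ • x ∉ O.closedTube 0) :
    ContDiffAt ℝ ∞ O.Θ x := by
  refine O.Θ_smooth.contDiffAt ?_
  filter_upwards [O.eventually_notMem_closedTube hx h, isOpen_compl_singleton.mem_nhds hx]
    with y h1 h2
  exact ⟨h2, O.notMem_binding_iff.2 h1⟩

theorem fderiv_re {x : C3} (hx : DifferentiableAt ℝ O.Θ x) :
    fderiv ℝ (fun y => (O.Θ y).re) x = Complex.reCLM ∘L fderiv ℝ O.Θ x :=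
  (Complex.reCLM.hasFDerivAt.comp x hx.hasFDerivAt).fderiv

theorem fderiv_im {x : C3} (hx : DifferentiableAt ℝ O.Θ x) :
    fderiv ℝ (fun y => (O.Θ y).im) x = Complex.imCLM ∘L fderiv ℝ O.Θ x :=
  (Complex.imCLM.hasFDerivAt.comp x hx.hasFDerivAt).fderiv

theorem angleForm_eventuallyEq {x : C3} (hx : x ≠ 0) (h : ‖x‖⁻¹ • x ∉ O.closedTube 0) :
    angleForm O.Θ =ᶠ[nhds x] fun y =>
      (O.Θ y).re • fderiv ℝ (fun y => (O.Θ y).im) y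
        - (O.Θ y).im • fderiv ℝ (fun y => (O.Θ y).re) y := by
  filter_upwards [(((O.contDiffAt_Θ hx h).of_le (m := 1) (by simp)).eventually (by simp))] with y hy
  have hd : DifferentiableAt ℝ O.Θ y := hy.differentiableAt (by simp)
  rw [O.fderiv_re hd, O.fderiv_im hd]
  ext v
  simp [angleForm]
  ring

theorem contDiffAt_angleForm {x : C3} (hx : x ≠ 0) (h : ‖x‖⁻¹ • x ∉ O.closedTube 0) :
    ContDiffAt ℝ ∞ (angleForm O.Θ) x := by
  have hΘ := O.contDiffAt_Θ hx h
  have hre : ContDiffAt ℝ ∞ (fun y => (O.Θ y).re) x := Complex.reCLM.contDiff.contDiffAt.comp x hΘ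
  have him : ContDiffAt ℝ ∞ (fun y => (O.Θ y).im) x := Complex.imCLM.contDiff.contDiffAt.comp x hΘ
  exact ((hre.smul (him.fderiv_right (m := ∞) (by simp))).sub
    (him.smul (hre.fderiv_right (m := ∞) (by simp)))).congr_of_eventuallyEq
    (O.angleForm_eventuallyEq hx h)

theorem inv_norm_smul_of_mem {p : C3} (hp : p ∈ S5) : ‖p‖⁻¹ • p = p := by
  rw [mem_S5.1 hp]; simp

theorem tangent_Θ {p : C3} (hp : p ∈ S5) (h : p ∉ O.closedTube 0) {v : C3}
    (hv : v ∈ tangentSpace p) :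
    (O.Θ p).re * fderiv ℝ (fun y => (O.Θ y).re) p v
      + (O.Θ p).im * fderiv ℝ (fun y => (O.Θ y).im) p v = 0 := by
  have hn := inv_norm_smul_of_mem hp
  have hΘ : DifferentiableAt ℝ O.Θ p :=
    (O.contDiffAt_Θ (ne_zero_of_mem_S5 hp) (hn.symm ▸ h)).differentiableAt (by simp)
  obtain ⟨c, hc0, hcS, hc⟩ := hasDerivAt_normalize hp hv
  have hev : ∀ᶠ t in nhds (0 : ℝ), (O.Θ (c t)).re ^ 2 + (O.Θ (c t)).im ^ 2 = 1 := by
    have hnear := O.eventually_notMem_closedTube (r₁ := 0) (ne_zero_of_mem_S5 hp) (hn.symm ▸ h)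
    rw [← hc0] at hnear
    filter_upwards [hc.continuousAt.eventually hnear] with t ht
    rw [inv_norm_smul_of_mem (hcS t)] at ht
    have h1 := O.Θ_unit (c t) (hcS t) (O.notMem_binding_iff.2 ht)
    have h2 := Complex.sq_norm (O.Θ (c t))
    rw [h1, Complex.normSq_apply] at h2
    linarith
  have hd : HasFDerivAt O.Θ (fderiv ℝ O.Θ p) (c 0) := hc0.symm ▸ hΘ.hasFDerivAt
  have hcomp : HasDerivAt (fun t => O.Θ (c t)) (fderiv ℝ O.Θ p v) 0 := hd.comp_hasDerivAt 0 hc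
  have hre : HasDerivAt (fun t => (O.Θ (c t)).re) (fderiv ℝ O.Θ p v).re 0 :=
    Complex.reCLM.hasFDerivAt.comp_hasDerivAt 0 hcomp
  have him : HasDerivAt (fun t => (O.Θ (c t)).im) (fderiv ℝ O.Θ p v).im 0 :=
    Complex.imCLM.hasFDerivAt.comp_hasDerivAt 0 hcomp
  have hsum := (hre.pow 2).add (him.pow 2)
  have hconst : HasDerivAt (fun t => (O.Θ (c t)).re ^ 2 + (O.Θ (c t)).im ^ 2) 0 0 :=
    (hasDerivAt_const (0 : ℝ) (1 : ℝ)).congr_of_eventuallyEq hev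
  have := hsum.unique hconst
  rw [O.fderiv_re hΘ, O.fderiv_im hΘ]
  simp [hc0] at this ⊢
  linarith

/-- `d(angleForm)` is `2 d(Re Θ) ∧ d(Im Θ)`. On tangent vectors `Θ` takes values in a circle, so the
two differentials are dependent. -/
theorem dForm_angleForm {p : C3} (hp : p ∈ S5) (h : p ∉ O.closedTube 0) {v w : C3}
    (hv : v ∈ tangentSpace p) (hw : w ∈ tangentSpace p) : dForm (angleForm O.Θ) p v w = 0 := by
  have hn := inv_norm_smul_of_mem hp
  have h0 := ne_zero_of_mem_S5 hp
  have h' : ‖p‖⁻¹ • p ∉ O.closedTube 0 := hn.symm ▸ h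
  have hΘ := O.contDiffAt_Θ h0 h'
  have hre : ContDiffAt ℝ ∞ (fun y => (O.Θ y).re) p := Complex.reCLM.contDiff.contDiffAt.comp p hΘ
  have him : ContDiffAt ℝ ∞ (fun y => (O.Θ y).im) p := Complex.imCLM.contDiff.contDiffAt.comp p hΘ
  have hsr := (hre.isSymmSndFDerivAt (by simp; exact WithTop.coe_le_coe.2 (le_top : (2 : ℕ∞) ≤ ⊤))) v w
  have hsi := (him.isSymmSndFDerivAt (by simp; exact WithTop.coe_le_coe.2 (le_top : (2 : ℕ∞) ≤ ⊤))) v w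
  have tv := O.tangent_Θ hp h hv
  have tw := O.tangent_Θ hp h hw
  have hunit : (O.Θ p).re ^ 2 + (O.Θ p).im ^ 2 = 1 := by
    have h2 := Complex.sq_norm (O.Θ p)
    rw [O.Θ_unit p hp (O.notMem_binding_iff.2 h), Complex.normSq_apply] at h2
    linarith
  have d1 := (hre.differentiableAt (by simp)).hasFDerivAt
  have d2 := (him.differentiableAt (by simp)).hasFDerivAt
  have e1 := ((hre.fderiv_right (m := ∞) (by simp)).differentiableAt (by simp)).hasFDerivAt
  have e2 := ((him.fderiv_right (m := ∞) (by simp)).differentiableAt (by simp)).hasFDerivAt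
  have hd := ((d1.smul e2).sub (d2.smul e1)).congr_of_eventuallyEq (O.angleForm_eventuallyEq h0 h')
  rw [dForm, hd.fderiv]
  simp only [sub_apply, add_apply, smul_apply, ContinuousLinearMap.smulRight_apply, smul_eq_mul,
    hsr, hsi]
  generalize (fderiv ℝ (fun y => (O.Θ y).re) p) v = a at *
  generalize (fderiv ℝ (fun y => (O.Θ y).re) p) w = b at *
  generalize (fderiv ℝ (fun y => (O.Θ y).im) p) v = c at *
  generalize (fderiv ℝ (fun y => (O.Θ y).im) p) w = d at *
  generalize (O.Θ p).re = x at *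
  generalize (O.Θ p).im = y at *
  -- The vectors `(a, c)` and `(b, d)` are both orthogonal to the unit vector `(x, y)` of the plane,
  -- hence parallel.
  have hx : a * d - b * c = 0 := by
    linear_combination (-(a * d - b * c)) * hunit + (x * d - y * b) * tv + (y * a - x * c) * tw
  linear_combination 2 * hx

theorem angleForm_tube {q : Cover} (hq : q.2.2.2 ≠ 0) (t : Cover) :
    angleForm O.Θ (O.J q) (fderiv ℝ O.J q t) = dTheta q t := by
  have hmem := O.J_mem q
  have hnot : O.J q ∉ O.closedTube 0 := by
    rintro ⟨q', hq', he⟩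
    refine hq ?_
    have := O.radius_eq_of_J_eq he
    rw [this, radius] at hq'
    exact norm_le_zero_iff.1 hq'
  have hΘ : DifferentiableAt ℝ O.Θ (O.J q) :=
    (O.contDiffAt_Θ (O.J_ne_zero q) ((inv_norm_smul_of_mem hmem).symm ▸ hnot)).differentiableAt
      (by simp)
  have h1 := hΘ.hasFDerivAt.comp q (O.differentiableAt_J q).hasFDerivAt
  have hn0 : ‖cW q‖ ≠ 0 := norm_ne_zero_iff.2 hq
  have h2 : HasFDerivAt (fun w : ℂ => ‖w‖⁻¹ • w) _ (cW q) :=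
    (((hasDerivAt_inv hn0).comp_hasFDerivAt (cW q) (hasFDerivAt_norm_complex (w := cW q) hq))).smul
      (hasFDerivAt_id (𝕜 := ℝ) (cW q))
  have h3 := HasFDerivAt.comp q h2 cW.hasFDerivAt
  have hev : (O.Θ ∘ O.J) =ᶠ[nhds q] ((fun w : ℂ => ‖w‖⁻¹ • w) ∘ cW) := by
    have : ∀ᶠ q' in nhds q, cW q' ≠ 0 := cW.continuous.continuousAt.eventually_ne hq
    filter_upwards [this] with q' hq'
    simp only [Function.comp_apply]
    rw [O.Θ_tube q' hq', cW_apply, div_eq_inv_mul, Complex.real_smul, Complex.ofReal_inv]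
  have he := (h3.congr_of_eventuallyEq hev).unique h1
  have he2 : fderiv ℝ O.Θ (O.J q) (fderiv ℝ O.J q t) = ‖q.2.2.2‖⁻¹ • t.2.2.2 +
      (-(‖q.2.2.2‖ ^ 2)⁻¹ * (‖q.2.2.2‖⁻¹ * radialCovector q.2.2.2 t.2.2.2)) • q.2.2.2 :=
    (DFunLike.congr_fun he t).symm
  have hn : ‖q.2.2.2‖ ≠ 0 := hn0
  simp only [angleForm, ContinuousLinearMap.comp_apply, he2, O.Θ_tube q hq]
  generalize -(‖q.2.2.2‖ ^ 2)⁻¹ * (‖q.2.2.2‖⁻¹ * radialCovector q.2.2.2 t.2.2.2) = c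
  rw [dTheta]
  simp
  field_simp
  ring

end SupportingOpenBook

theorem deriv_nonneg_of_monotoneOn {φ : ℝ → ℝ} {φ' a b r : ℝ} (h : MonotoneOn φ (Set.Icc a b))
    (hr : r ∈ Set.Ioo a b) (hd : HasDerivAt φ φ' r) : 0 ≤ φ' := by
  have := h.derivWithin_nonneg (x := r)
  rwa [hd.hasDerivWithinAt.derivWithin
    ((uniqueDiffOn_Icc (hr.1.trans hr.2)) r ⟨hr.1.le, hr.2.le⟩)] at this

namespace SupportingOpenBook
variable (O : SupportingOpenBook M)

/-! ### Forms on the sphere pulled back to the tube -/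

theorem dForm_fderiv_J {α : Form} {q : Cover} (hα : DifferentiableAt ℝ α (O.J q))
    {τ : Cover → Cover →L[ℝ] ℝ}
    (hev : ∀ᶠ y in nhds q, ∀ t, α (O.J y) (fderiv ℝ O.J y t) = τ y t) (s t : Cover) :
    dForm α (O.J q) (fderiv ℝ O.J q s) (fderiv ℝ O.J q t) = extD τ q s t := by
  have h : (fun y => (α (O.J y)).comp (fderiv ℝ O.J y)) =ᶠ[nhds q] τ := by
    filter_upwards [hev] with y hy using ContinuousLinearMap.ext hy
  rw [← extD_congr h, extD_pullback (O.J_smooth.contDiffAt.of_le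
    (WithTop.coe_le_coe.2 (le_top : (2 : ℕ∞) ≤ ⊤))) hα]
  rfl

theorem wedge122_fderiv_J {α : Form} {q : Cover} (hα : DifferentiableAt ℝ α (O.J q))
    {τ : Cover → Cover →L[ℝ] ℝ}
    (hev : ∀ᶠ y in nhds q, ∀ t, α (O.J y) (fderiv ℝ O.J y t) = τ y t) (v : Fin 5 → Cover) :
    wedge122 (α (O.J q)) (dForm α (O.J q)) (fun i => fderiv ℝ O.J q (v i)) =
      ∑ σ : Equiv.Perm (Fin 5), ((Equiv.Perm.sign σ : ℤ) : ℝ) *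
        (τ q (v (σ 0)) * extD τ q (v (σ 1)) (v (σ 2)) * extD τ q (v (σ 3)) (v (σ 4))) := by
  simp only [wedge122, O.dForm_fderiv_J hα hev, hev.self_of_nhds]

theorem wedge12_fderiv_J {α : Form} {q : Cover} (hα : DifferentiableAt ℝ α (O.J q))
    {τ : Cover → Cover →L[ℝ] ℝ}
    (hev : ∀ᶠ y in nhds q, ∀ t, α (O.J y) (fderiv ℝ O.J y t) = τ y t) (v : Fin 3 → Cover) :
    wedge12 (α (O.J q)) (dForm α (O.J q)) (fun i => fderiv ℝ O.J q (v i)) =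
      ∑ σ : Equiv.Perm (Fin 3), ((Equiv.Perm.sign σ : ℤ) : ℝ) *
        (τ q (v (σ 0)) * extD τ q (v (σ 1)) (v (σ 2))) := by
  simp only [wedge12, O.dForm_fderiv_J hα hev, hev.self_of_nhds]

theorem isOpen_radius_lt (r : ℝ) : IsOpen {q : Cover | radius q < r} :=
  isOpen_lt cW.continuous.norm continuous_const

theorem differentiableAt_ρ {p : C3} (hp : p ∈ S5) : DifferentiableAt ℝ O.ρ p :=
  (O.ρ_smooth.contDiffAt (isOpen_compl_singleton.mem_nhds (ne_zero_of_mem_S5 hp))).differentiableAt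
    (by simp)

theorem contDiffAt_conformal {p : C3} (hp : p ≠ 0) :
    ContDiffAt ℝ ∞ (fun x => O.ρ x • stdForm x) p :=
  (O.ρ_smooth.contDiffAt (isOpen_compl_singleton.mem_nhds hp)).smul contDiff_stdForm.contDiffAt

theorem radius_sq (q : Cover) : q.2.2.2.re ^ 2 + q.2.2.2.im ^ 2 = ‖q.2.2.2‖ ^ 2 := by
  rw [Complex.sq_norm, Complex.normSq_apply]; ring

theorem g_pos {r : ℝ} (h0 : 0 < r) (h1 : r ≤ 1) : 0 < O.g r := by
  obtain ⟨ε, hε, hg⟩ := O.g_zero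
  have hm : 0 < min r ε := lt_min h0 hε
  have := O.g_mono (a := min r ε) (b := r) ⟨hm.le, (min_le_left _ _).trans h1⟩ ⟨h0.le, h1⟩
    (min_le_left _ _)
  rw [hg _ ⟨hm.le, min_le_right _ _⟩] at this
  exact (by positivity : 0 < (min r ε) ^ 2).trans_le this

theorem eig_const_pos : 0 < 8 * Real.log O.eig.a *
    (O.eig.vp.1 * O.eig.vm.2 - O.eig.vp.2 * O.eig.vm.1) :=
  mul_pos (mul_pos (by norm_num) (Real.log_pos O.eig.one_lt)) O.eig.oriented

/-! ### Orientation of the tube, and the contact and integrability conditions on it -/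

/-- The determinant of the coordinate frame of the tube. -/
def orientation (q : Cover) : ℝ := frameDet (O.J q) (fun i => fderiv ℝ O.J q (coverBasis i))

theorem frameDet_fderiv_J (q : Cover) (v : Fin 5 → Cover) :
    frameDet (O.J q) (fun i => fderiv ℝ O.J q (v i)) = O.orientation q * coverBasis.det v := by
  have h := AlternatingMap.eq_smul_basis_det coverBasis
    ((frameDet (O.J q)).compLinearMap (fderiv ℝ O.J q : Cover →ₗ[ℝ] C3))
  exact DFunLike.congr_fun h v

/-- The volume of `ρΛ` on the coordinate frame is `32 ρ³` times this determinant by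
`wedge122_stdForm`. By the normal form it is also a positive multiple of `2f(f g' - f' g) / r`,
which is positive since `f > 0`, `f' < 0`, `g > 0` and `g' ≥ 0`. -/
theorem orientation_pos_of_ne {q : Cover} (h1 : radius q < 1) (hq : q.2.2.2 ≠ 0) :
    0 < O.orientation q := by
  have hr0 : 0 < ‖q.2.2.2‖ := norm_pos_iff.2 hq
  set r := ‖q.2.2.2‖ with hr
  have hr1 : r < 1 := h1
  have hf := (O.f_smooth.differentiable (by simp) r).hasDerivAt
  have hg := (O.g_smooth.differentiable (by simp) r).hasDerivAt
  have hC : HasDerivAt (fun r => O.g r / r ^ 2)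
      ((deriv O.g r * r ^ 2 - O.g r * (2 * r)) / (r ^ 2) ^ 2) r := by
    have := hg.div ((hasDerivAt_id r).pow 2) (by simpa using hr0.ne')
    exact this.congr_deriv (by simp)
  have hz : HasRadialDeriv (fun _ => 0) 0 q.2.2.2 := by
    have := hasFDerivAt_const (𝕜 := ℝ) (0 : ℝ) q.2.2.2
    exact this.congr_fderiv (by simp)
  have hev : ∀ᶠ y in nhds q, ∀ t, (fun x => O.ρ x • stdForm x) (O.J y) (fderiv ℝ O.J y t) =
      tubeForm O.eig (fun w => O.f ‖w‖) (fun w => O.f ‖w‖) (fun w => O.g ‖w‖ / ‖w‖ ^ 2)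
        (fun _ => 0) (fun _ => 0) y t := by
    filter_upwards [(isOpen_radius_lt 1).mem_nhds h1,
      cW.continuous.continuousAt.eventually_ne hq] with y hy1 hy2 t
    have := O.normal_form y (le_of_lt hy1) t
    simp only [smul_apply, smul_eq_mul]
    rw [this, tubeForm_apply, radius, dTheta]
    have : ‖y.2.2.2‖ ≠ 0 := norm_ne_zero_iff.2 hy2
    field_simp
    ring
  have e1 := O.wedge122_fderiv_J
    ((O.contDiffAt_conformal (O.J_ne_zero q)).differentiableAt (by simp)) hev coverBasis
  rw [tubeForm_contact O.eig (hasRadialDeriv_of_ne hq hf) (hasRadialDeriv_of_ne hq hf)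
    (hasRadialDeriv_of_ne hq hC) hz hz, coverBasis.det_self, mul_one] at e1
  have e2 := wedge122_stdForm O.ρ (O.J q) (O.differentiableAt_ρ (O.J_mem q))
    (fun i => fderiv ℝ O.J q (coverBasis i))
  rw [← frameDet_apply] at e2
  have e3 := e2.symm.trans e1
  have hT : 0 < 2 * (O.f r * O.f r) * (2 * (O.g r / r ^ 2) +
      (deriv O.g r * r ^ 2 - O.g r * (2 * r)) / (r ^ 2) ^ 2 / r *
        (q.2.2.2.re ^ 2 + q.2.2.2.im ^ 2)) -
      (deriv O.f r / r * O.f r + O.f r * (deriv O.f r / r)) *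
        ((q.2.2.2.re ^ 2 + q.2.2.2.im ^ 2) * (O.g r / r ^ 2)) := by
    rw [radius_sq, ← hr]
    have : 2 * (O.f r * O.f r) * (2 * (O.g r / r ^ 2) +
      (deriv O.g r * r ^ 2 - O.g r * (2 * r)) / (r ^ 2) ^ 2 / r * r ^ 2) -
      (deriv O.f r / r * O.f r + O.f r * (deriv O.f r / r)) * (r ^ 2 * (O.g r / r ^ 2)) =
      2 * O.f r * (O.f r * deriv O.g r + (-deriv O.f r) * O.g r) / r := by
      field_simp
      ring
    rw [this]
    have hfp := O.f_pos r ⟨hr0.le, hr1.le⟩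
    have hfd := O.f_decr r ⟨hr0, hr1.le⟩
    have hgp := O.g_pos hr0 hr1.le
    have hgd := deriv_nonneg_of_monotoneOn O.g_mono ⟨hr0, hr1⟩ hg
    have h1 : 0 ≤ O.f r * deriv O.g r := by positivity
    have h2 : 0 < (-deriv O.f r) * O.g r := mul_pos (by linarith) hgp
    positivity
  have hpos := mul_pos O.eig_const_pos hT
  rw [← e3] at hpos
  have hρ := O.ρ_pos _ (O.J_mem q)
  exact pos_of_mul_pos_right hpos (by positivity)

theorem continuous_orientation : Continuous O.orientation := by
  have h : O.orientation = fun q => (Matrix.of (Fin.cons (realCoordₗ (O.J q))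
      (fun i => realCoordₗ (fderiv ℝ O.J q (coverBasis i)))) : Matrix (Fin 6) (Fin 6) ℝ).det := by
    funext q; exact frameDet_apply _ _
  rw [h]
  have hc : Continuous realCoordₗ := realCoordₗ.continuous_of_finiteDimensional
  refine Continuous.matrix_det ?_
  refine continuous_pi fun i => ?_
  refine Fin.cases ?_ (fun j => ?_) i
  · exact hc.comp O.J_smooth.continuous
  · exact hc.comp (O.contDiff_fderiv_J.continuous.clm_apply continuous_const)

/-- On the core the sign is a limit from `r > 0`. The weak inequality is enough, because it is only
used when its product with another determinant is known to be positive. -/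
theorem orientation_nonneg {q : Cover} (h1 : radius q < 1) : 0 ≤ O.orientation q := by
  by_cases hq : q.2.2.2 = 0
  · have hc : Continuous (fun s : ℝ => O.orientation (q.1, q.2.1, q.2.2.1, (s : ℂ))) :=
      O.continuous_orientation.comp (continuous_const.prodMk (continuous_const.prodMk
        (continuous_const.prodMk Complex.continuous_ofReal)))
    have ht : Filter.Tendsto (fun s : ℝ => O.orientation (q.1, q.2.1, q.2.2.1, (s : ℂ)))
        (nhdsWithin 0 (Set.Ioi 0)) (nhds (O.orientation q)) := by
      have := (hc.tendsto 0).mono_left (nhdsWithin_le_nhds (s := Set.Ioi 0))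
      have hq' : (q.1, q.2.1, q.2.2.1, ((0 : ℝ) : ℂ)) = q := by
        rw [Complex.ofReal_zero, ← hq]
      rwa [hq'] at this
    refine ge_of_tendsto ht ?_
    filter_upwards [Ioo_mem_nhdsGT (zero_lt_one (α := ℝ))] with s hs
    refine (O.orientation_pos_of_ne ?_ ?_).le
    · simp [radius, abs_of_pos hs.1, hs.2]
    · simpa using hs.1.ne'
  · exact (O.orientation_pos_of_ne h1 hq).le

theorem det_pos_of_positiveFrame {q : Cover} (h1 : radius q < 1) {v : Fin 5 → Cover}
    (hv : IsPositiveFrame (O.J q) (fun i => fderiv ℝ O.J q (v i))) : 0 < coverBasis.det v := by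
  have h := hv.2
  rw [← frameDet_apply, O.frameDet_fderiv_J] at h
  exact pos_of_mul_pos_right h (O.orientation_nonneg h1)

/-- With `c = r² C` and `φ₁ = φ' / r`, the hypothesis `hT` is `(2ab c' - (ab)' c) / r > 0`, in a
form that keeps its meaning on the core. -/
theorem contact_of_tubeForm {α : Form} {q : Cover} (h1 : radius q < 1)
    (hα : DifferentiableAt ℝ α (O.J q)) {A B C H E : ℂ → ℝ} {A₁ B₁ C₁ H₁ E₁ : ℝ}
    (hev : ∀ᶠ y in nhds q, ∀ t, α (O.J y) (fderiv ℝ O.J y t) = tubeForm O.eig A B C H E y t)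
    (hA : HasRadialDeriv A A₁ q.2.2.2) (hB : HasRadialDeriv B B₁ q.2.2.2)
    (hC : HasRadialDeriv C C₁ q.2.2.2) (hH : HasRadialDeriv H H₁ q.2.2.2)
    (hE : HasRadialDeriv E E₁ q.2.2.2)
    (hT : 0 < 2 * (A q.2.2.2 * B q.2.2.2) * (2 * C q.2.2.2 + C₁ * ‖q.2.2.2‖ ^ 2)
        - (A₁ * B q.2.2.2 + A q.2.2.2 * B₁) * (‖q.2.2.2‖ ^ 2 * C q.2.2.2))
    (v : Fin 5 → C3) (hv : IsPositiveFrame (O.J q) v) :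
    0 < wedge122 (α (O.J q)) (dForm α (O.J q)) v := by
  choose t ht using fun i => O.exists_fderiv_J_eq q (hv.1 i)
  obtain rfl : (fun i => fderiv ℝ O.J q (t i)) = v := funext ht
  rw [O.wedge122_fderiv_J hα hev, tubeForm_contact O.eig hA hB hC hH hE, radius_sq]
  exact mul_pos (mul_pos O.eig_const_pos hT) (O.det_pos_of_positiveFrame h1 hv)

/-- Only products of the `dz` data with the `dθ` data, or with their derivatives, survive in `η ∧
dη`. The hypotheses say that these two sets of data are never active together. -/
theorem integrable_of_tubeForm {α : Form} {q : Cover}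
    (hα : DifferentiableAt ℝ α (O.J q)) {C H E : ℂ → ℝ} {C₁ H₁ E₁ : ℝ}
    (hev : ∀ᶠ y in nhds q, ∀ t, α (O.J y) (fderiv ℝ O.J y t) =
      tubeForm O.eig (fun _ => 0) (fun _ => 0) C H E y t)
    (hC : HasRadialDeriv C C₁ q.2.2.2) (hH : HasRadialDeriv H H₁ q.2.2.2)
    (hE : HasRadialDeriv E E₁ q.2.2.2)
    (h1 : H q.2.2.2 * C q.2.2.2 = 0) (h2 : H q.2.2.2 * C₁ = 0) (h3 : H₁ * C q.2.2.2 = 0)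
    (v : Fin 3 → C3) (hv : ∀ i, v i ∈ tangentSpace (O.J q)) :
    wedge12 (α (O.J q)) (dForm α (O.J q)) v = 0 := by
  choose t ht using fun i => O.exists_fderiv_J_eq q (hv i)
  obtain rfl : (fun i => fderiv ℝ O.J q (t i)) = v := funext ht
  have hz : HasRadialDeriv (fun _ => 0) 0 q.2.2.2 := by
    have := hasFDerivAt_const (𝕜 := ℝ) (0 : ℝ) q.2.2.2
    exact this.congr_fderiv (by simp)
  rw [O.wedge12_fderiv_J hα hev]
  refine (sum_perm_three (fun x y => extD (tubeForm O.eig (fun _ => 0) (fun _ => 0) C H E) q x y)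
    (extD_swap _ q) (fun x => tubeForm O.eig (fun _ => 0) (fun _ => 0) C H E q x) t).trans ?_
  simp only [extD_tubeForm O.eig hz hz hC hH hE, tubeForm_apply, radialCovector_apply, dZ]
  generalize H q.2.2.2 = h at *
  generalize C q.2.2.2 = c at *
  simp
  by_cases hh : h = 0
  · subst hh
    rcases mul_eq_zero.1 h3 with h3 | h3 <;> subst h3 <;> ring
  · obtain rfl := (mul_eq_zero.1 h1).resolve_left hh
    obtain rfl := (mul_eq_zero.1 h2).resolve_left hh
    ring

end SupportingOpenBook

/-! ### Profile functions -/

theorem Radial.contDiffAt {φ : ℝ → ℝ} (h : Radial φ) {r : ℝ} (hr : 0 < r) : ContDiffAt ℝ ∞ φ r := by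
  have h1 : ContDiffAt ℝ ∞ (fun s : ℝ => φ ‖(s : ℂ)‖) r :=
    (h.comp Complex.ofRealCLM.contDiff).contDiffAt
  refine h1.congr_of_eventuallyEq ?_
  filter_upwards [lt_mem_nhds hr] with s hs
  rw [Complex.norm_real, Real.norm_of_nonneg hs.le]

theorem Radial.hasDerivAt {φ : ℝ → ℝ} (h : Radial φ) {r : ℝ} (hr : 0 < r) :
    HasDerivAt φ (deriv φ r) r :=
  ((h.contDiffAt hr).differentiableAt (by simp)).hasDerivAt

theorem Radial.hasRadialDeriv {φ : ℝ → ℝ} (h : Radial φ) (w : ℂ) :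
    HasRadialDeriv (fun w => φ ‖w‖) (deriv φ ‖w‖ / ‖w‖) w := by
  rcases eq_or_ne w 0 with rfl | hw
  · exact hasRadialDeriv_zero h _
  · exact hasRadialDeriv_of_ne hw (h.hasDerivAt (norm_pos_iff.2 hw))

/-- Dividing by `r ^ n` leaves a function constant near 0, hence smooth on the plane. This turns
coefficients of `dθ` (`n = 2`) and of `dr` (`n = 1`) into coefficients of the smooth forms `r² dθ`
and `r dr`. -/
theorem exists_radial_div {φ : ℝ → ℝ} (hφ : ∀ r > 0, ContDiffAt ℝ ∞ φ r) (n : ℕ) {κ ε : ℝ}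
    (hε : 0 < ε) (h : ∀ r ∈ Set.Icc 0 ε, φ r = κ * r ^ n) :
    ∃ ψ : ℝ → ℝ, Radial ψ ∧ (∀ r, 0 ≤ r → φ r = r ^ n * ψ r) ∧ ∀ r ∈ Set.Icc 0 ε, ψ r = κ := by
  let ψ : ℝ → ℝ := fun r => if r ≤ ε then κ else φ r / r ^ n
  have hpos : ∀ r > 0, ψ r = φ r / r ^ n := by
    intro r hr
    by_cases hle : r ≤ ε
    · simp only [ψ, if_pos hle]
      rw [h r ⟨hr.le, hle⟩, mul_div_cancel_right₀ _ (pow_ne_zero n hr.ne')]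
    · simp only [ψ, if_neg hle]
  have hcore : ∀ r ∈ Set.Icc 0 ε, ψ r = κ := fun r hr => if_pos hr.2
  refine ⟨ψ, Radial.of_core (fun r hr => ?_) hε
    (fun r hr => by rw [hcore r hr, hcore 0 ⟨le_rfl, hε.le⟩]), fun r hr => ?_, hcore⟩
  · refine ((hφ r hr).div (contDiffAt_id.pow n) (pow_ne_zero n hr.ne')).congr_of_eventuallyEq ?_
    filter_upwards [lt_mem_nhds hr] with s hs using hpos s hs
  · rcases hr.eq_or_lt with rfl | hr
    · rw [hcore 0 ⟨le_rfl, hε.le⟩, h 0 ⟨le_rfl, hε.le⟩, mul_comm]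
    · rw [hpos r hr, mul_div_cancel₀ _ (pow_ne_zero n hr.ne')]

theorem exists_step {a b : ℝ} (hab : a < b) : ∃ μ : ℝ → ℝ, ContDiff ℝ ∞ μ ∧ Monotone μ ∧
    (∀ r, 0 ≤ μ r) ∧ (∀ r, μ r ≤ 1) ∧ (∀ r ≤ a, μ r = 0) ∧ (∀ r, b ≤ r → μ r = 1) := by
  refine ⟨fun r => Real.smoothTransition ((r - a) / (b - a)),
    Real.smoothTransition.contDiff.comp ((contDiff_id.sub contDiff_const).div_const _),
    fun r s h => ?_, fun r => Real.smoothTransition.nonneg _, fun r => Real.smoothTransition.le_one _,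
    fun r hr => ?_, fun r hr => ?_⟩
  · apply Real.smoothTransition.monotone
    have := sub_pos.2 hab
    gcongr
  · exact Real.smoothTransition.zero_of_nonpos
      (div_nonpos_of_nonpos_of_nonneg (by linarith) (by linarith))
  · apply Real.smoothTransition.one_of_one_le
    rw [le_div_iff₀ (sub_pos.2 hab)]; linarith

/-! ### Construction of the deformation and its contact condition -/

/-- The coefficient functions of a deformation of the Lutz form to a foliation. The Lutz form is
first changed into `a β₊ + (b - G) β₋ + c dθ`, and this is joined to `θ c dθ + h dz + E r dr`. -/
structure Deformation {f g : ℝ → ℝ} (L : LutzProfile f g) (P : ReebProfile) where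
  (δ rₐ : ℝ)
  (C K G θ h E q : ℝ → ℝ)
  δ_pos : 0 < δ
  r₀_lt : P.r₀ < L.R - δ
  le_rₐ : L.R + δ ≤ rₐ
  rₐ_lt : rₐ < 1
  C_radial : Radial C
  G_radial : Radial G
  θ_radial : Radial θ
  h_radial : Radial h
  E_radial : Radial E
  C_eq : ∀ r, 0 ≤ r → L.c r = r ^ 2 * C r
  C_core : C 0 < 0
  G_core : G 0 = 0
  G_zero : ∀ r, L.R ≤ r → G r = 0
  G_eq : ∀ r ∈ Set.Icc (0 : ℝ) 1, L.a r * G r = K r * L.c r ^ 2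
  K_diff : ∀ r, DifferentiableAt ℝ K r
  K_cond : ∀ r ∈ Set.Ioo (0 : ℝ) 1, 0 ≤ deriv K r * L.c r ^ 3
  θ_smooth : ContDiff ℝ ∞ θ
  θ_nonneg : ∀ r ∈ Set.Icc (0 : ℝ) 1, 0 ≤ θ r
  θ_zero : ∀ r ∈ Set.Icc (0 : ℝ) P.r₀, θ r = 0
  θ_pos : ∀ r ∈ Set.Ioc P.r₀ 1, 0 < θ r
  θ_cond : ∀ r ∈ Set.Ioo (0 : ℝ) 1,
    0 ≤ (L.a r * L.b r - K r * L.c r ^ 2) * L.c r * deriv θ r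
  h_zero : ∀ r ∈ Set.Icc P.r₀ 1, h r = 0
  near_one : ∀ r ∈ Set.Icc rₐ 1, L.a r = f r ∧ L.b r = f r ∧ L.c r = g r ∧ g r = 1 ∧
    P.g₁ r = 1 ∧ P.e r = 0 ∧ θ r = 1 ∧ E r = 0
  off_collar : ∀ r ∈ Set.Icc (0 : ℝ) 1, δ ≤ |r - L.R| →
    ∃ m ≠ 0, θ r * L.c r = m * P.g₁ r ∧ h r = m * P.f₁ r ∧ E r * r = m * P.e r
  collar : ∀ r, |r - L.R| < δ → P.e r = 0 ∧ E r * r = q r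
  q_smooth : ContDiff ℝ ∞ q
  q_ne : q L.R ≠ 0
  q_zero : ∀ r, δ / 2 ≤ |r - L.R| → q r = 0

/-- The support of `e` is compact in `(0, R)` and contains `r₀`. The gap between it and `R` leaves
room both for the collar and for the interval where `θ` reaches 1. -/
theorem ReebProfile.exists_support {P : ReebProfile} {R : ℝ} (hP : tsupport P.e ⊆ Set.Iio R) :
    ∃ ε > 0, ∃ r₁, P.r₀ < r₁ ∧ r₁ < R ∧ (∀ r ≤ ε, P.e r = 0) ∧ ∀ r, r₁ ≤ r → P.e r = 0 := by
  have hmem : P.r₀ ∈ tsupport P.e := subset_tsupport _ P.e_ne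
  have hc : IsCompact (tsupport P.e) :=
    Metric.isCompact_of_isClosed_isBounded (isClosed_tsupport _)
      (Metric.isBounded_Ioo (0 : ℝ) 1 |>.subset P.e_support)
  obtain ⟨s, hs, hs'⟩ := hc.exists_isGreatest ⟨_, hmem⟩
  obtain ⟨t, ht, ht'⟩ := hc.exists_isLeast ⟨_, hmem⟩
  have h0 : P.r₀ ≤ s := hs' hmem
  have h1 : s < R := hP hs
  have h2 : 0 < t := (P.e_support ht).1
  refine ⟨t / 2, by linarith, (s + R) / 2, by linarith, by linarith, fun r hr => ?_, fun r hr => ?_⟩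
  · refine image_eq_zero_of_notMem_tsupport fun h => ?_
    have := ht' h
    linarith
  · refine image_eq_zero_of_notMem_tsupport fun h => ?_
    have := hs' h
    linarith

/-- A large multiple of `c²` dominates `ab` up to any `r₂ < R`: near the core `ab` is a negative
constant, and on the remaining compact interval `c²` is bounded away from 0. -/
theorem LutzProfile.exists_bound {f g : ℝ → ℝ} (L : LutzProfile f g) {r₂ : ℝ} (h : r₂ < L.R) :
    ∃ K₀ : ℝ, 0 ≤ K₀ ∧ ∀ r ∈ Set.Icc 0 r₂, L.a r * L.b r - K₀ * L.c r ^ 2 ≤ 0 := by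
  obtain ⟨ε, hε, κ, hκ, hcore⟩ := L.near_core
  have hcne : ∀ r ∈ Set.Icc ε r₂, L.c r ^ 2 ≠ 0 := fun r hr =>
    pow_ne_zero 2 (L.c_neg r ⟨hε.trans_le hr.1, hr.2.trans_lt h⟩).ne
  obtain ⟨K, hK⟩ := (isCompact_Icc (a := ε) (b := r₂)).exists_bound_of_continuousOn
    (f := fun r => L.a r * L.b r / L.c r ^ 2)
    ((L.a_smooth.continuous.mul L.b_smooth.continuous).continuousOn.div
      (L.c_smooth.continuous.pow 2).continuousOn hcne)
  refine ⟨max K 0, le_max_right _ _, fun r hr => ?_⟩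
  rcases le_total r ε with hle | hle
  · obtain ⟨ha, hb, -⟩ := hcore r ⟨hr.1, hle⟩
    rw [ha, hb]
    have h1 : L.a 0 * L.b 0 < 0 := mul_neg_of_pos_of_neg (L.a_pos 0 ⟨le_rfl, zero_le_one⟩) L.b_core
    have h2 : 0 ≤ max K 0 * L.c r ^ 2 := mul_nonneg (le_max_right _ _) (sq_nonneg _)
    linarith
  · have h1 := (le_abs_self _).trans (hK r ⟨hle, hr.2⟩)
    have hpos : 0 < L.c r ^ 2 := lt_of_le_of_ne (sq_nonneg _) (hcne r ⟨hle, hr.2⟩).symm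
    rw [div_le_iff₀ hpos] at h1
    have : K * L.c r ^ 2 ≤ max K 0 * L.c r ^ 2 := by gcongr; exact le_max_left _ _
    linarith

theorem deriv_eq_zero_of_const {φ : ℝ → ℝ} {c s r : ℝ} (h : ∀ x, s ≤ x → φ x = c) (hr : s < r) :
    deriv φ r = 0 := by
  have : φ =ᶠ[nhds r] fun _ => c := by
    filter_upwards [lt_mem_nhds hr] with x hx using h x (le_of_lt hx)
  rw [this.deriv_eq, deriv_const]

/-- The radii satisfy `r₀ < r₁ < r₂ < R`. Up to `r₁` the limit form is a multiple of the Reeb form;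
`θ` becomes 1 by `r₂`; `K` is `K₀` up to `r₂` and falls to 0 on `[r₂, R]`; the collar lies beyond
`r₂`. Thus `θ'` is only active where `K` is the full constant. -/
theorem exists_deformation {f g : ℝ → ℝ} (L : LutzProfile f g) (P : ReebProfile)
    (hg : ∃ ε > 0, ∀ r ∈ Set.Icc (1 - ε) 1, g r = 1)
    (hP : tsupport P.e ⊆ Set.Iio L.R) : Nonempty (Deformation L P) := by
  obtain ⟨εe, hεe, r₁, hr01, hr1R, he0, he1⟩ := ReebProfile.exists_support hP
  obtain ⟨ε, hε, κ, hκ, hcore⟩ := L.near_core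
  obtain ⟨εg, hεg, hg⟩ := hg
  obtain ⟨εL, hεL, hL⟩ := L.near_one
  obtain ⟨ε₁, hε₁, hg₁⟩ := P.g₁_near_one
  obtain ⟨εf, hεf, hf₁⟩ := P.f₁_near_zero
  have hr0 := P.r₀_mem.1
  have hR1 := L.R_mem.2
  obtain ⟨r₂, hr12, hr2R⟩ := exists_between hr1R
  obtain ⟨K₀, hK₀, hbound⟩ := L.exists_bound hr2R
  obtain ⟨ν, hν, hνm, hν0, hν1, hνa, hνb⟩ := exists_step hr2R
  obtain ⟨μ, hμ, hμm, hμ0, hμ1, hμa, hμb⟩ := exists_step hr12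
  obtain ⟨χ', hχ, hχm, hχ0, hχ1, hχa, hχb⟩ := exists_step (show P.r₀ / 4 < P.r₀ / 2 by linarith)
  -- The two bounds keep the collar beyond `r₂` and inside the tube.
  let δ := min ((L.R - r₂) / 2) ((1 - L.R) / 2)
  have hδ : 0 < δ := lt_min (by linarith) (by linarith)
  have hδ1 : δ ≤ (L.R - r₂) / 2 := min_le_left _ _
  have hδ2 : δ ≤ (1 - L.R) / 2 := min_le_right _ _
  let rₐ := max (max (1 - εL) (1 - εg)) (max (1 - ε₁) (L.R + δ))
  have hrL : 1 - εL ≤ rₐ := (le_max_left _ _).trans (le_max_left _ _)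
  have hrg : 1 - εg ≤ rₐ := (le_max_right _ _).trans (le_max_left _ _)
  have hr₁ : 1 - ε₁ ≤ rₐ := (le_max_left _ _).trans (le_max_right _ _)
  have hrR : L.R + δ ≤ rₐ := (le_max_right _ _).trans (le_max_right _ _)
  have hra1 : rₐ < 1 := max_lt (max_lt (by linarith) (by linarith)) (max_lt (by linarith) (by linarith))
  obtain ⟨C, hC, hCeq, hC0⟩ := exists_radial_div (φ := L.c) (κ := -κ)
    (fun r _ => L.c_smooth.contDiffAt) 2 hε (fun r hr => (hcore r hr).2.2)
  let K : ℝ → ℝ := fun r => K₀ * (1 - ν r)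
  have hK : ContDiff ℝ ∞ K := contDiff_const.mul (contDiff_const.sub hν)
  have hKR : ∀ r, L.R ≤ r → K r = 0 := fun r hr => by simp [K, hνb r hr]
  have hK2 : ∀ r ≤ r₂, K r = K₀ := fun r hr => by simp [K, hνa r hr]
  have hKanti : Antitone K := fun r s h => by
    have := hνm h
    simp only [K]; gcongr
  -- Since `c = r² C`, the function `G = K c² / a` is `r⁴ G₀`. Beyond `R`, `K = 0`, so the sign of
  -- `a` outside `[0, 1]` is irrelevant.
  let G₀ : ℝ → ℝ := fun r => K r * C r ^ 2 / L.a r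
  have hG₀ : Radial G₀ := by
    have hε2 : 0 < min ε r₂ := lt_min hε (by linarith)
    refine Radial.of_core (fun r hr => ?_) hε2 (fun r hr => ?_)
    · rcases lt_or_ge r 1 with h1 | h1
      · exact (hK.contDiffAt.mul ((hC.contDiffAt hr).pow 2)).div L.a_smooth.contDiffAt
          (L.a_pos r ⟨hr.le, h1.le⟩).ne'
      · refine (contDiffAt_const (c := (0 : ℝ))).congr_of_eventuallyEq ?_
        filter_upwards [lt_mem_nhds (hR1.trans_le h1)] with s hs
        simp [G₀, hKR s (le_of_lt hs)]
    · have h1 : r ∈ Set.Icc 0 ε := ⟨hr.1, hr.2.trans (min_le_left _ _)⟩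
      have h2 : r ≤ r₂ := hr.2.trans (min_le_right _ _)
      simp only [G₀]
      rw [hK2 r h2, hK2 0 (by linarith), hC0 r h1, hC0 0 ⟨le_rfl, hε.le⟩, (hcore r h1).1]
  -- This interpolates from `g₁` (where `μ = 0`) to 1 (where `μ = 1`) and stays monotone, because
  -- both factors `1 - μ` and `1 - g₁` are nonnegative and decreasing.
  let θ : ℝ → ℝ := fun r => 1 - (1 - μ r) * (1 - P.g₁ r)
  have hθ : ContDiff ℝ ∞ θ :=
    contDiff_const.sub ((contDiff_const.sub hμ).mul (contDiff_const.sub P.g₁_smooth))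
  have hg1one : P.g₁ 1 = 1 := hg₁ 1 ⟨by linarith, le_rfl⟩
  have hg1le : ∀ r ∈ Set.Icc (0 : ℝ) 1, P.g₁ r ≤ 1 := fun r hr => by
    rw [← hg1one]; exact P.g₁_mono hr ⟨zero_le_one, le_rfl⟩ hr.2
  have hg1nonneg : ∀ r ∈ Set.Icc (0 : ℝ) 1, 0 ≤ P.g₁ r := fun r hr => by
    rcases le_or_gt r P.r₀ with h | h
    · rw [P.g₁_zero r ⟨hr.1, h⟩]
    · exact (P.g₁_pos r ⟨h, hr.2⟩).le
  have hθge : ∀ r ∈ Set.Icc (0 : ℝ) 1, P.g₁ r ≤ θ r := fun r hr => by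
    have := mul_nonneg (hμ0 r) (sub_nonneg.2 (hg1le r hr))
    simp only [θ]; linarith
  have hθ1 : ∀ r ≤ r₁, θ r = P.g₁ r := fun r hr => by simp [θ, hμa r hr]
  have hθ2 : ∀ r, r₂ ≤ r → θ r = 1 := fun r hr => by simp [θ, hμb r hr]
  have hθzero : ∀ r ∈ Set.Icc (0 : ℝ) P.r₀, θ r = 0 := fun r hr => by
    rw [hθ1 r (hr.2.trans hr01.le), P.g₁_zero r hr]
  have hθmono : MonotoneOn θ (Set.Icc 0 1) := fun r hr s hs h => by
    have h1 := hμm h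
    have h2 := P.g₁_mono hr hs h
    have h3 : (1 - μ s) * (1 - P.g₁ s) ≤ (1 - μ r) * (1 - P.g₁ r) :=
      mul_le_mul (by linarith) (by linarith) (by linarith [hg1le s hs]) (by linarith [hμ1 r])
    simp only [θ]; linarith
  let χ : ℝ → ℝ := fun r => 1 - χ' r
  have hχs : ContDiff ℝ ∞ χ := contDiff_const.sub hχ
  have hχz : ∀ r, P.r₀ / 2 ≤ r → χ r = 0 := fun r hr => by simp [χ, hχb r hr]
  have hχnn : ∀ r, 0 ≤ χ r := fun r => sub_nonneg.2 (hχ1 r)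
  have hc_rad : Radial L.c := by
    have : (fun w : ℂ => L.c ‖w‖) = fun w => ‖w‖ ^ 2 * C ‖w‖ :=
      funext fun w => hCeq _ (norm_nonneg w)
    rw [Radial, this]
    exact Radial.sq.mul hC
  have hχ_rad : Radial χ := Radial.of_core (fun r _ => hχs.contDiffAt)
    (show 0 < P.r₀ / 4 by linarith)
    (fun r hr => by simp [χ, hχa r hr.2, hχa 0 (by linarith)])
  have hf_rad : Radial P.f₁ := Radial.of_core (fun r _ => P.f₁_smooth.contDiffAt) hεf
    (fun r hr => by rw [hf₁ r hr, hf₁ 0 ⟨le_rfl, hεf.le⟩])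
  let q : ContDiffBump L.R := ⟨δ / 4, δ / 2, by linarith, by linarith⟩
  have hqz : ∀ r, δ / 2 ≤ |r - L.R| → q r = 0 := fun r hr => q.zero_of_le_dist hr
  -- The factor between `α₁` and the Reeb form should be `c` so that the `dθ` coefficient is `θ c`,
  -- but `c` vanishes at the core. Subtracting `χ` makes it negative there, and where `χ ≠ 0` one
  -- has `g₁ = 0`, so the `dθ` coefficient is unaffected.
  let m : ℝ → ℝ := fun r => L.c r - χ r
  have hm : ∀ r, 0 ≤ r → r < L.R → m r < 0 := fun r h0 h1 => by
    rcases h0.eq_or_lt with rfl | h0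
    · have hc0 : L.c 0 = 0 := by rw [hCeq 0 le_rfl]; simp
      have hχ00 : χ 0 = 1 := by simp [χ, hχa 0 (by linarith)]
      simp only [m, hc0, hχ00]; norm_num
    · have := L.c_neg r ⟨h0, h1⟩
      have := hχnn r
      simp only [m]; linarith
  have hεE : 0 < min εe (L.R - δ) := lt_min hεe (by linarith)
  obtain ⟨E, hE, hEeq, -⟩ := exists_radial_div (φ := fun r => m r * P.e r + q r) (κ := 0)
    (fun r _ => (((L.c_smooth.sub hχs).mul P.e_smooth).add q.contDiff).contDiffAt) 1 hεE
    (fun r hr => by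
      have h1 : P.e r = 0 := he0 r (hr.2.trans (min_le_left _ _))
      have h2 : r ≤ L.R - δ := hr.2.trans (min_le_right _ _)
      have h3 : q r = 0 := hqz r (by rw [abs_of_nonpos (by linarith)]; linarith)
      simp [h1, h3])
  have hEeq' : ∀ r, 0 ≤ r → E r * r = m r * P.e r + q r := fun r hr => by
    rw [hEeq r hr, pow_one, mul_comm]
  have hqoff : ∀ r, δ ≤ |r - L.R| → q r = 0 := fun r hr => hqz r (by linarith)
  refine ⟨⟨δ, rₐ, C, K, fun r => (r ^ 2 * r ^ 2) * G₀ r, θ, fun r => m r * P.f₁ r, E, q,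
    hδ, by linarith, hrR, hra1, hC, (Radial.sq.mul Radial.sq).mul hG₀, ?_,
    (hc_rad.sub hχ_rad).mul hf_rad, hE, hCeq, ?_, by simp, ?_, ?_,
    fun r => hK.differentiable (by simp) r, ?_, hθ, ?_, hθzero, ?_, ?_, ?_, ?_, ?_, ?_, q.contDiff, ?_, hqz⟩⟩
  · exact Radial.of_core (fun r _ => hθ.contDiffAt) hr0
      (fun r hr => by rw [hθzero r hr, hθzero 0 ⟨le_rfl, hr0.le⟩])
  · rw [hC0 0 ⟨le_rfl, hε.le⟩]; linarith
  · intro r hr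
    simp [G₀, hKR r hr]
  · intro r hr
    have := (L.a_pos r hr).ne'
    rw [hCeq r hr.1]
    simp only [G₀]
    field_simp
  · intro r hr
    rcases le_or_gt r L.R with h | h
    · have h1 : deriv K r ≤ 0 := hKanti.deriv_nonpos
      have h2 : L.c r ≤ 0 := by
        rcases h.eq_or_lt with rfl | h
        · rw [L.c_boundary]
        · exact (L.c_neg r ⟨hr.1, h⟩).le
      exact mul_nonneg_of_nonpos_of_nonpos h1 (Odd.pow_nonpos (by decide) h2)
    · rw [deriv_eq_zero_of_const hKR h, zero_mul]
  · exact fun r hr => (hg1nonneg r hr).trans (hθge r hr)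
  · exact fun r hr => (P.g₁_pos r hr).trans_le (hθge r ⟨hr0.le.trans hr.1.le, hr.2⟩)
  -- Up to `r₂` the signs are `ab - K₀ c² ≤ 0`, `c < 0` and `θ' ≥ 0`; beyond `r₂`, `θ` is constant.
  · intro r hr
    rcases le_or_gt r r₂ with h | h
    · have h1 := hbound r ⟨hr.1.le, h⟩
      rw [← hK2 r h] at h1
      have h2 := L.c_neg r ⟨hr.1, h.trans_lt hr2R⟩
      have h3 := deriv_nonneg_of_monotoneOn hθmono hr (hθ.differentiable (by simp) r).hasDerivAt
      exact mul_nonneg (mul_nonneg_of_nonpos_of_nonpos h1 h2.le) h3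
    · rw [deriv_eq_zero_of_const hθ2 h, mul_zero]
  · intro r hr
    simp [P.f₁_zero r hr]
  · intro r hr
    obtain ⟨h1, h2, h3⟩ := hL r ⟨hrL.trans hr.1, hr.2⟩
    have h4 : L.R + δ ≤ r := hrR.trans hr.1
    have he : P.e r = 0 := he1 r (by linarith)
    have hq : q r = 0 := hqoff r (by rw [abs_of_nonneg (by linarith)]; linarith)
    have hr' : 0 < r := by linarith
    refine ⟨h1, h2, h3, hg r ⟨hrg.trans hr.1, hr.2⟩, hg₁ r ⟨hr₁.trans hr.1, hr.2⟩, he,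
      hθ2 r (by linarith), ?_⟩
    have := hEeq' r hr'.le
    rw [he, hq, mul_zero, add_zero] at this
    exact (mul_eq_zero.1 this).resolve_right hr'.ne'
  · intro r hr hrδ
    rcases le_or_gt r r₁ with h | h
    · refine ⟨m r, (hm r hr.1 (by linarith)).ne, ?_, rfl, ?_⟩
      · rw [hθ1 r h]
        rcases le_or_gt r (P.r₀ / 2) with h' | h'
        · rw [P.g₁_zero r ⟨hr.1, by linarith⟩]; ring
        · simp only [m, hχz r h'.le]; ring
      · rw [hEeq' r hr.1, hqoff r hrδ, add_zero]
    -- Beyond `r₁` both forms are multiples of `dθ` off the collar, and the factor is the quotient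
    -- of their coefficients, nonzero because `r ≠ R`.
    · have hg1 := P.g₁_pos r ⟨by linarith, hr.2⟩
      have hθp := hg1.trans_le (hθge r hr)
      have hcne : L.c r ≠ 0 := by
        rcases lt_trichotomy r L.R with h' | h' | h'
        · exact (L.c_neg r ⟨by linarith, h'⟩).ne
        · rw [h', sub_self, abs_zero] at hrδ; linarith
        · exact (L.c_pos r ⟨h', hr.2⟩).ne'
      refine ⟨θ r * L.c r / P.g₁ r, div_ne_zero (mul_ne_zero hθp.ne' hcne) hg1.ne', ?_, ?_, ?_⟩
      · field_simp
      · simp [P.f₁_zero r ⟨by linarith, hr.2⟩]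
      · rw [hEeq' r hr.1, hqoff r hrδ, he1 r h.le]; simp
  · intro r hr
    rw [abs_lt] at hr
    have he : P.e r = 0 := he1 r (by linarith)
    refine ⟨he, ?_⟩
    rw [hEeq' r (by linarith), he, mul_zero, zero_add]
  · have : q L.R = 1 := q.one_of_mem_closedBall (Metric.mem_closedBall_self q.rIn_pos.le)
    rw [this]; exact one_ne_zero

/-- The contact condition along the deformation. -/
theorem Deformation.turning {f g : ℝ → ℝ} {L : LutzProfile f g} {P : ReebProfile}
    (T : Deformation L P) {l σ : ℝ} (hl : 0 ≤ l) (hσ0 : 0 ≤ σ) (hσ1 : σ < 1)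
    (hlσ : σ = 0 ∨ l = 1) {r : ℝ} (hr0 : 0 ≤ r) (hr1 : r < 1) {A B C : ℝ → ℝ}
    (hA : A = fun r => (1 - σ) * L.a r) (hB : B = fun r => (1 - σ) * (L.b r - l * T.G r))
    (hC : C = fun r => (1 - σ) * T.C r + σ * (T.θ r * T.C r)) :
    0 < 2 * (A r * B r) * (2 * C r + deriv C r / r * r ^ 2)
      - (deriv A r / r * B r + A r * (deriv B r / r)) * (r ^ 2 * C r) := by
  have hs : 0 < 1 - σ := by linarith
  -- On the core the expression reduces to `4 (1 - σ)³ a b C`, with `b < 0` and `C < 0`.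
  rcases hr0.eq_or_lt with rfl | hr
  · have h1 := L.a_pos 0 ⟨le_rfl, zero_le_one⟩
    have h2 := L.b_core
    have h3 := T.C_core
    have h4 := T.θ_zero 0 ⟨le_rfl, P.r₀_mem.1.le⟩
    simp only [hA, hB, hC, T.G_core, h4]
    have : 0 < (1 - σ) ^ 3 * (L.a 0 * (L.b 0 * T.C 0)) :=
      mul_pos (pow_pos hs 3) (mul_pos h1 (mul_pos_of_neg_of_neg h2 h3))
    simp
    nlinarith
  · have ha := (L.a_smooth.differentiable (by simp) r).hasDerivAt
    have hb := (L.b_smooth.differentiable (by simp) r).hasDerivAt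
    have hc := (L.c_smooth.differentiable (by simp) r).hasDerivAt
    have hG := T.G_radial.hasDerivAt hr
    have hCd := T.C_radial.hasDerivAt hr
    have hK := (T.K_diff r).hasDerivAt
    have hθ := (T.θ_smooth.differentiable (by simp) r).hasDerivAt
    have dA : deriv A r = (1 - σ) * deriv L.a r := by
      rw [hA]; exact (ha.const_mul _).deriv
    have dB : deriv B r = (1 - σ) * (deriv L.b r - l * deriv T.G r) := by
      rw [hB]; exact ((hb.sub (hG.const_mul _)).const_mul _).deriv
    have dC : deriv C r = (1 - σ) * deriv T.C r +
        σ * (deriv T.θ r * T.C r + T.θ r * deriv T.C r) := by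
      rw [hC]; exact ((hCd.const_mul _).add ((hθ.mul hCd).const_mul _)).deriv
    have hc' : deriv L.c r = 2 * r * T.C r + r ^ 2 * deriv T.C r := by
      have h1 : HasDerivAt (fun r => r ^ 2 * T.C r) _ r := ((hasDerivAt_id r).pow 2).mul hCd
      have h2 : L.c =ᶠ[nhds r] fun r => r ^ 2 * T.C r := by
        filter_upwards [lt_mem_nhds hr] with s hs using T.C_eq s (le_of_lt hs)
      rw [h2.deriv_eq, h1.deriv]
      simp
    -- This differentiates `a G = K c²`, so that `G'` can be eliminated in favour of `K'` and `c'`.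
    have hG' : deriv L.a r * T.G r + L.a r * deriv T.G r =
        deriv T.K r * L.c r ^ 2 + T.K r * (2 * L.c r * deriv L.c r) := by
      have h1 := ha.mul hG
      have h2 := hK.mul (hc.pow 2)
      have h3 : (L.a * T.G) =ᶠ[nhds r] T.K * L.c ^ 2 := by
        filter_upwards [Ioo_mem_nhds hr hr1] with s hs using T.G_eq s ⟨hs.1.le, hs.2.le⟩
      have := (h2.congr_of_eventuallyEq h3).unique h1
      rw [← this]
      simp
    have hab : deriv (fun s => L.a s * L.b s) r = deriv L.a r * L.b r + L.a r * deriv L.b r :=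
      (ha.mul hb).deriv
    have hT := L.turning r ⟨hr, hr1.le⟩
    rw [hab] at hT
    have hGe := T.G_eq r ⟨hr0, hr1.le⟩
    have hce := T.C_eq r hr0
    have hKc := T.K_cond r ⟨hr, hr1⟩
    have hθn := T.θ_nonneg r ⟨hr0, hr1.le⟩
    have hθc := T.θ_cond r ⟨hr, hr1⟩
    have e1 : r ^ 2 * C r = L.c r * (1 - σ + σ * T.θ r) := by rw [hC, hce]; ring
    have e2 : 2 * r * C r + r ^ 2 * deriv C r =
        (1 - σ) * deriv L.c r + σ * (T.θ r * deriv L.c r + deriv T.θ r * L.c r) := by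
      rw [dC, hc', hce, hC]; ring
    -- The terms with `K c'` cancel, so lowering `b` contributes only `K' c³`. The last summand,
    -- with `θ'`, has a known sign only for `l = 1`, which is why `σ` must be 0 until then.
    have key : 2 * (A r * B r) * (2 * C r + deriv C r / r * r ^ 2)
        - (deriv A r / r * B r + A r * (deriv B r / r)) * (r ^ 2 * C r) =
        (1 - σ) ^ 2 * ((1 - σ + σ * T.θ r) * (2 * (L.a r * L.b r) * deriv L.c r -
            (deriv L.a r * L.b r + L.a r * deriv L.b r) * L.c r + l * (deriv T.K r * L.c r ^ 3))
          + 2 * σ * ((L.a r * L.b r - l * (T.K r * L.c r ^ 2)) * L.c r * deriv T.θ r)) / r := by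
      rw [eq_div_iff hr.ne']
      have : (2 * (A r * B r) * (2 * C r + deriv C r / r * r ^ 2)
        - (deriv A r / r * B r + A r * (deriv B r / r)) * (r ^ 2 * C r)) * r =
        2 * (A r * B r) * (2 * r * C r + r ^ 2 * deriv C r)
        - (deriv A r * B r + A r * deriv B r) * (r ^ 2 * C r) := by
        field_simp
      rw [this, e1, e2, dA, dB, hA, hB]
      linear_combination (1 - σ) ^ 2 * (-2 * l * ((1 - σ) * deriv L.c r +
        σ * (T.θ r * deriv L.c r + deriv T.θ r * L.c r))) * hGe +
        (1 - σ) ^ 2 * l * (L.c r * (1 - σ + σ * T.θ r)) * hG'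
    rw [key]
    have h1 : 0 < 1 - σ + σ * T.θ r := by positivity
    have h2 : 0 ≤ l * (deriv T.K r * L.c r ^ 3) := mul_nonneg hl hKc
    have h3 : 0 ≤ 2 * σ * ((L.a r * L.b r - l * (T.K r * L.c r ^ 2)) * L.c r * deriv T.θ r) := by
      rcases hlσ with rfl | rfl
      · simp
      · rw [one_mul]; positivity
    have h4 := mul_pos h1 (add_pos_of_pos_of_nonneg hT h2)
    have h5 := add_pos_of_pos_of_nonneg h4 h3
    positivity

/-- On the core both sides lose their `dθ` and `dr` terms: division by zero gives 0 in `dTheta` and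
`dRadius`, and the smooth forms `r² dθ` and `r dr` vanish there. -/
theorem tubeForm_polar (D : EigenData M) {A B H : ℂ → ℝ} {C E c e : ℝ → ℝ} {q : Cover}
    (hc : c (radius q) = radius q ^ 2 * C (radius q)) (he : e (radius q) = E (radius q) * radius q)
    (t : Cover) :
    tubeForm D A B (fun w => C ‖w‖) H (fun w => E ‖w‖) q t =
      A q.2.2.2 * D.betaPlus q t + B q.2.2.2 * D.betaMinus q t + H q.2.2.2 * dZ t
        + c (radius q) * dTheta q t + e (radius q) * dRadius q t := by
  rw [tubeForm_apply, hc, he, dTheta, dRadius]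
  simp only [radius]
  rcases eq_or_ne q.2.2.2 0 with h | h
  · simp [h]
  · have := norm_ne_zero_iff.2 h
    field_simp
    ring

theorem radial_a {f g : ℝ → ℝ} (L : LutzProfile f g) : Radial L.a ∧ Radial L.b := by
  obtain ⟨ε, hε, κ, hκ, hcore⟩ := L.near_core
  exact ⟨Radial.of_core (fun r _ => L.a_smooth.contDiffAt) hε (fun r hr => (hcore r hr).1),
    Radial.of_core (fun r _ => L.b_smooth.contDiffAt) hε (fun r hr => (hcore r hr).2.1)⟩

/-! ### Foliation and contact conditions on the whole sphere -/

namespace SupportingOpenBook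
variable (O : SupportingOpenBook M)

theorem notMem_closedTube_zero {p : C3} (hp : p ∉ O.tube) : p ∉ O.closedTube 0 :=
  O.not_closedTube_of_not_tube hp zero_lt_one

/-- A form which is `C r² dθ + H dz + E r dr` on the tube and `dθ` off the tube defines a
foliation. -/
theorem isFoliationForm_of_glue {α : Form} (hα : IsSmoothForm α) {C H E : ℝ → ℝ}
    (hC : Radial C) (hH : Radial H) (hE : Radial E) {r₀ : ℝ}
    (hC0 : ∀ r ∈ Set.Icc 0 r₀, C r = 0) (hH0 : ∀ r ∈ Set.Icc r₀ 1, H r = 0)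
    (hne : ∀ r, 0 ≤ r → r < 1 → H r ≠ 0 ∨ r ^ 2 * C r ≠ 0 ∨ E r * r ≠ 0)
    (htube : ∀ q, radius q ≤ 1 → ∀ t, α (O.J q) (fderiv ℝ O.J q t) =
      tubeForm O.eig (fun _ => 0) (fun _ => 0) (fun w => C ‖w‖) (fun w => H ‖w‖)
        (fun w => E ‖w‖) q t)
    (hoff : ∀ p ∈ S5, p ∉ O.tube → α =ᶠ[nhds p] angleForm O.Θ) : IsFoliationForm α := by
  constructor
  · intro p hp
    by_cases ht : p ∈ O.tube
    · obtain ⟨q, hq, rfl⟩ := ht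
      have hr0 : 0 ≤ radius q := norm_nonneg _
      suffices h : ∃ t, tubeForm O.eig (fun _ => 0) (fun _ => 0) (fun w => C ‖w‖) (fun w => H ‖w‖)
          (fun w => E ‖w‖) q t ≠ 0 by
        obtain ⟨t, ht⟩ := h
        exact ⟨_, O.fderiv_J_mem q t, by rwa [htube q (le_of_lt hq)]⟩
      have hsq : q.2.2.2.re * q.2.2.2.re + q.2.2.2.im * q.2.2.2.im = radius q * radius q := by
        rw [← Complex.normSq_apply, Complex.normSq_eq_norm_sq, radius, pow_two]
      rcases hne _ hr0 hq with h | h | h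
      · refine ⟨(0, 0, 1, 0), ?_⟩
        rw [tubeForm_apply]
        simpa [dZ, radius] using h
      · refine ⟨(0, 0, 0, Complex.I * q.2.2.2), ?_⟩
        rw [tubeForm_apply]
        have e1 : (starRingEnd ℂ q.2.2.2 * (Complex.I * q.2.2.2)).im = radius q ^ 2 := by
          simp; linarith
        have e2 : (starRingEnd ℂ q.2.2.2 * (Complex.I * q.2.2.2)).re = 0 := by
          simp; ring
        simp only [e1, e2, dZ]
        rw [mul_comm] at h
        simpa [radius] using h
      · refine ⟨(0, 0, 0, q.2.2.2), ?_⟩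
        rw [tubeForm_apply]
        have e1 : (starRingEnd ℂ q.2.2.2 * q.2.2.2).im = 0 := by
          simp; ring
        have e2 : (starRingEnd ℂ q.2.2.2 * q.2.2.2).re = radius q * radius q := by
          simp; linarith
        simp only [e1, e2, dZ]
        have h2 := mul_ne_zero h (right_ne_zero_of_mul h)
        simpa [mul_assoc, radius] using h2
    · obtain ⟨v, hv⟩ := exists_positiveFrame hp
      -- If `dθ` vanished on the tangent space, its wedge with `(d(ρΛ))²` would vanish on every
      -- frame, against the supporting condition.
      by_contra! hcon
      have h := O.supporting p hp (O.notMem_binding_iff.2 (O.notMem_closedTube_zero ht)) v hv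
      rw [← (hoff p hp ht).eq_of_nhds, wedge122, Finset.sum_eq_zero] at h
      · exact lt_irrefl _ h
      · intro σ _
        rw [hcon _ (hv.1 _)]; ring
  · intro p hp v hv
    have hd : DifferentiableAt ℝ α p :=
      (hα.contDiffAt (isOpen_compl_singleton.mem_nhds (ne_zero_of_mem_S5 hp))).differentiableAt
        (by simp)
    by_cases ht : p ∈ O.tube
    · obtain ⟨q, hq, rfl⟩ := ht
      have hr0 : 0 ≤ radius q := norm_nonneg _
      have hev : ∀ᶠ y in nhds q, ∀ t, α (O.J y) (fderiv ℝ O.J y t) = tubeForm O.eig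
          (fun _ => 0) (fun _ => 0) (fun w => C ‖w‖) (fun w => H ‖w‖) (fun w => E ‖w‖) y t := by
        filter_upwards [(isOpen_radius_lt 1).mem_nhds hq] with y hy using htube y (le_of_lt hy)
      refine O.integrable_of_tubeForm hd hev (hC.hasRadialDeriv _) (hH.hasRadialDeriv _)
        (hE.hasRadialDeriv _) ?_ ?_ ?_ v hv
      -- The supports of `C` and `H` lie on opposite sides of `r₀`, so each is locally zero where
      -- the other is active; this disposes of the derivatives too.
      · change H (radius q) * C (radius q) = 0
        rcases le_total (radius q) r₀ with h | h
        · rw [hC0 _ ⟨hr0, h⟩, mul_zero]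
        · rw [hH0 _ ⟨h, le_of_lt hq⟩, zero_mul]
      · change H (radius q) * (deriv C (radius q) / radius q) = 0
        rcases lt_or_ge (radius q) r₀ with h | h
        · rcases hr0.eq_or_lt with h0 | h0
          · rw [← h0]; simp
          · have : C =ᶠ[nhds (radius q)] fun _ => 0 := by
              filter_upwards [Ioo_mem_nhds h0 h] with s hs using hC0 s ⟨hs.1.le, hs.2.le⟩
            rw [this.deriv_eq]; simp
        · rw [hH0 _ ⟨h, le_of_lt hq⟩, zero_mul]
      · change deriv H (radius q) / radius q * C (radius q) = 0
        rcases le_or_gt (radius q) r₀ with h | h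
        · rw [hC0 _ ⟨hr0, h⟩, mul_zero]
        · have : H =ᶠ[nhds (radius q)] fun _ => 0 := by
            filter_upwards [Ioo_mem_nhds h hq] with s hs using hH0 s ⟨hs.1.le, hs.2.le⟩
          rw [this.deriv_eq]; simp
    · have h0 : ∀ v ∈ tangentSpace p, ∀ w ∈ tangentSpace p, dForm α p v w = 0 := by
        intro v hv w hw
        rw [show dForm α p v w = dForm (angleForm O.Θ) p v w from extD_congr (hoff p hp ht) v w]
        exact O.dForm_angleForm hp (O.notMem_closedTube_zero ht) hv hw
      rw [wedge12, Finset.sum_eq_zero]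
      intro σ _
      rw [h0 _ (hv _) _ (hv _)]; ring

theorem tubeForm_comb (D : EigenData M) (A B C G C' H E : ℂ → ℝ) (l σ : ℝ) (q t : Cover) :
    (1 - σ) * (tubeForm D A B C (fun _ => 0) (fun _ => 0) q t
        - l * tubeForm D (fun _ => 0) G (fun _ => 0) (fun _ => 0) (fun _ => 0) q t)
      + σ * tubeForm D (fun _ => 0) (fun _ => 0) C' H E q t =
    tubeForm D (fun w => (1 - σ) * A w) (fun w => (1 - σ) * (B w - l * G w))
      (fun w => (1 - σ) * C w + σ * C' w) (fun w => σ * H w) (fun w => σ * E w) q t := by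
  simp only [tubeForm_apply]
  ring

/-- The forms of the deformation are contact. -/
theorem isPositiveContact_comb {L : LutzProfile O.f O.g} {P : ReebProfile} (T : Deformation L P)
    {α₀ β α₁ : Form} (hα₀ : IsSmoothForm α₀) (hβ : IsSmoothForm β) (hα₁ : IsSmoothForm α₁)
    (h₀ : ∀ q, radius q ≤ 1 → ∀ t, α₀ (O.J q) (fderiv ℝ O.J q t) =
      tubeForm O.eig (fun w => L.a ‖w‖) (fun w => L.b ‖w‖) (fun w => T.C ‖w‖) (fun _ => 0)
        (fun _ => 0) q t)
    (hb : ∀ q, radius q ≤ 1 → ∀ t, β (O.J q) (fderiv ℝ O.J q t) =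
      tubeForm O.eig (fun _ => 0) (fun w => T.G ‖w‖) (fun _ => 0) (fun _ => 0) (fun _ => 0) q t)
    (h₁ : ∀ q, radius q ≤ 1 → ∀ t, α₁ (O.J q) (fderiv ℝ O.J q t) =
      tubeForm O.eig (fun _ => 0) (fun _ => 0) (fun w => T.θ ‖w‖ * T.C ‖w‖) (fun w => T.h ‖w‖)
        (fun w => T.E ‖w‖) q t)
    (h₀' : ∀ p ∈ S5, p ∉ O.tube → α₀ =ᶠ[nhds p] fun x => O.ρ x • stdForm x)
    (hb' : ∀ p ∈ S5, p ∉ O.tube → β =ᶠ[nhds p] fun _ => 0)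
    (h₁' : ∀ p ∈ S5, p ∉ O.tube → α₁ =ᶠ[nhds p] angleForm O.Θ)
    {l σ : ℝ} (hl : 0 ≤ l) (hσ0 : 0 ≤ σ) (hσ1 : σ < 1) (hlσ : σ = 0 ∨ l = 1) :
    IsPositiveContact (fun x => (1 - σ) • (α₀ x - l • β x) + σ • α₁ x) := by
  intro p hp v hv
  have hs : 0 < 1 - σ := by linarith
  have hnh := isOpen_compl_singleton.mem_nhds (ne_zero_of_mem_S5 hp)
  by_cases ht : p ∈ O.tube
  · obtain ⟨q, hq, rfl⟩ := ht
    have d0 := (hα₀.contDiffAt hnh).differentiableAt (by simp)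
    have db := (hβ.contDiffAt hnh).differentiableAt (by simp)
    have d1 := (hα₁.contDiffAt hnh).differentiableAt (by simp)
    have hd : DifferentiableAt ℝ (fun x => (1 - σ) • (α₀ x - l • β x) + σ • α₁ x) (O.J q) :=
      ((d0.sub (db.const_smul l)).const_smul (1 - σ)).add (d1.const_smul σ)
    obtain ⟨ha, hbr⟩ := radial_a L
    have rA : Radial (fun r => (1 - σ) * L.a r) := (Radial.const _).mul ha
    have rB : Radial (fun r => (1 - σ) * (L.b r - l * T.G r)) :=
      (Radial.const _).mul (hbr.sub ((Radial.const _).mul T.G_radial))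
    have rC : Radial (fun r => (1 - σ) * T.C r + σ * (T.θ r * T.C r)) :=
      ((Radial.const _).mul T.C_radial).add ((Radial.const _).mul (T.θ_radial.mul T.C_radial))
    have rH : Radial (fun r => σ * T.h r) := (Radial.const _).mul T.h_radial
    have rE : Radial (fun r => σ * T.E r) := (Radial.const _).mul T.E_radial
    refine O.contact_of_tubeForm hq hd ?_ (rA.hasRadialDeriv _) (rB.hasRadialDeriv _)
      (rC.hasRadialDeriv _) (rH.hasRadialDeriv _) (rE.hasRadialDeriv _)
      (T.turning hl hσ0 hσ1 hlσ (norm_nonneg _) hq rfl rfl rfl) v hv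
    filter_upwards [(isOpen_radius_lt 1).mem_nhds hq] with y hy t
    simp only [add_apply, smul_apply, sub_apply, smul_eq_mul, h₀ y (le_of_lt hy),
      hb y (le_of_lt hy), h₁ y (le_of_lt hy)]
    exact tubeForm_comb _ _ _ _ _ _ _ _ l σ y t
  · have hbind := O.notMem_closedTube_zero ht
    have he : (fun x => (1 - σ) • (α₀ x - l • β x) + σ • α₁ x) =ᶠ[nhds p]
        fun x => (1 - σ) • (O.ρ x • stdForm x) + σ • angleForm O.Θ x := by
      filter_upwards [h₀' p hp ht, hb' p hp ht, h₁' p hp ht] with x e1 e2 e3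
      rw [e1, e2, e3, smul_zero, sub_zero]
    have dρ := (O.contDiffAt_conformal (ne_zero_of_mem_S5 hp)).differentiableAt (by simp)
    have dθ := (O.contDiffAt_angleForm (ne_zero_of_mem_S5 hp)
      ((inv_norm_smul_of_mem hp).symm ▸ hbind)).differentiableAt (by simp)
    -- `dθ` is closed along the sphere, so only `ρΛ` contributes to the exterior derivative of the
    -- combination.
    have hd : ∀ x ∈ tangentSpace p, ∀ y ∈ tangentSpace p,
        dForm (fun x => (1 - σ) • (α₀ x - l • β x) + σ • α₁ x) p x y =
          (1 - σ) * dForm (fun x => O.ρ x • stdForm x) p x y := by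
      intro x hx y hy
      have h1 := O.dForm_angleForm hp hbind hx hy
      have hf := ((dρ.hasFDerivAt.const_smul (1 - σ)).add (dθ.hasFDerivAt.const_smul σ)).fderiv
      have hf' : fderiv ℝ (fun x => (1 - σ) • (O.ρ x • stdForm x) + σ • angleForm O.Θ x) p = _ := hf
      rw [dForm, he.fderiv_eq, hf']
      rw [dForm] at h1 ⊢
      simp only [add_apply, smul_apply, smul_eq_mul]
      linear_combination σ * h1
    have h1 := O.supporting p hp (O.notMem_binding_iff.2 hbind) v hv
    have h2 : 0 < wedge122 (O.ρ p • stdForm p) (dForm (fun x => O.ρ x • stdForm x) p) v := by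
      rw [wedge122_stdForm O.ρ p (O.differentiableAt_ρ hp)]
      have := O.ρ_pos p hp
      exact mul_pos (by positivity) hv.2
    have hsum : wedge122 ((fun x => (1 - σ) • (α₀ x - l • β x) + σ • α₁ x) p)
        (dForm (fun x => (1 - σ) • (α₀ x - l • β x) + σ • α₁ x) p) v =
        (1 - σ) ^ 2 * ((1 - σ) * wedge122 (O.ρ p • stdForm p)
            (dForm (fun x => O.ρ x • stdForm x) p) v
          + σ * wedge122 (angleForm O.Θ p) (dForm (fun x => O.ρ x • stdForm x) p) v) := by
      have hp' : (fun x => (1 - σ) • (α₀ x - l • β x) + σ • α₁ x) p =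
          (1 - σ) • (O.ρ p • stdForm p) + σ • angleForm O.Θ p := he.eq_of_nhds
      rw [hp']
      simp only [wedge122, Finset.mul_sum, ← Finset.sum_add_distrib]
      refine Finset.sum_congr rfl fun τ _ => ?_
      rw [hd _ (hv.1 _) _ (hv.1 _), hd _ (hv.1 _) _ (hv.1 _)]
      simp only [add_apply, smul_apply, smul_eq_mul]
      ring
    rw [hsum]
    have := mul_nonneg hσ0 h1.le
    positivity

end SupportingOpenBook

/-! ### Reeb foliations, turbulization, and the final homotopy -/

/-- The compact leaf is placed at `R / 2`, and `e` is a bump supported in `[R/4, 3R/4]`. -/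
theorem exists_reebProfile {R : ℝ} (hR : R ∈ Set.Ioo (0 : ℝ) 1) :
    ∃ P : ReebProfile, tsupport P.e ⊆ Set.Iio R := by
  have h0 := hR.1
  have h1 := hR.2
  let r₀ := R / 2
  have hr0 : 0 < r₀ := by simp only [r₀]; linarith
  have hr1 : r₀ < R := by simp only [r₀]; linarith
  obtain ⟨μ, hμ, hμm, hμ0, hμ1, hμa, hμb⟩ := exists_step (show r₀ / 2 < r₀ by linarith)
  let e : ContDiffBump r₀ := ⟨R / 8, R / 4, by linarith, by linarith⟩
  have hsupp : tsupport e ⊆ Set.Icc (R / 4) (3 * R / 4) := by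
    rw [e.tsupport_eq, Real.closedBall_eq_Icc]
    intro x hx
    simp only [r₀, e] at hx
    exact ⟨by linarith [hx.1], by linarith [hx.2]⟩
  refine ⟨{
    r₀ := r₀
    f₁ := fun r => Real.smoothTransition ((r₀ - r) / (r₀ / 2))
    g₁ := fun r => Real.smoothTransition ((r - r₀) / ((1 - r₀) / 2))
    e := e
    r₀_mem := ⟨hr0, by linarith⟩
    f₁_smooth := Real.smoothTransition.contDiff.comp ((contDiff_const.sub contDiff_id).div_const _)
    g₁_smooth := Real.smoothTransition.contDiff.comp ((contDiff_id.sub contDiff_const).div_const _)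
    e_smooth := e.contDiff
    f₁_near_zero := ⟨r₀ / 2, by linarith, fun r hr => ?_⟩
    f₁_anti := fun r _ s _ h => Real.smoothTransition.monotone (by gcongr)
    f₁_pos := fun r hr => Real.smoothTransition.pos_of_pos
      (div_pos (by linarith [hr.2]) (by linarith))
    f₁_zero := fun r hr => Real.smoothTransition.zero_of_nonpos
      (div_nonpos_of_nonpos_of_nonneg (by linarith [hr.1]) (by linarith))
    g₁_near_one := ⟨(1 - r₀) / 2, by linarith, fun r hr => ?_⟩
    g₁_mono := fun r _ s _ h => Real.smoothTransition.monotone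
      (div_le_div_of_nonneg_right (by linarith) (by linarith))
    g₁_zero := fun r hr => Real.smoothTransition.zero_of_nonpos
      (div_nonpos_of_nonpos_of_nonneg (by linarith [hr.2]) (by linarith))
    g₁_pos := fun r hr => Real.smoothTransition.pos_of_pos
      (div_pos (by linarith [hr.1]) (by linarith))
    e_support := fun x hx => ⟨by linarith [(hsupp hx).1], by linarith [(hsupp hx).2]⟩
    e_ne := ?_ }, fun x hx => ?_⟩
  · apply Real.smoothTransition.one_of_one_le
    rw [le_div_iff₀ (by linarith)]
    linarith [hr.2]
  · apply Real.smoothTransition.one_of_one_le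
    rw [le_div_iff₀ (by linarith)]
    linarith [hr.1]
  · have : e r₀ = 1 := e.one_of_mem_closedBall (Metric.mem_closedBall_self e.rIn_pos.le)
    rw [this]; exact one_ne_zero
  · have := (hsupp hx).2
    simp only [Set.mem_Iio]; linarith

namespace SupportingOpenBook
variable (O : SupportingOpenBook M)

/-- A form defining the Reeb foliation of a profile. -/
theorem exists_reebForm (P : ReebProfile) {R : ℝ} (hP : tsupport P.e ⊆ Set.Iio R) (hR : R < 1) :
    ∃ η : Form, IsReebForm O P η ∧ IsFoliationForm η := by
  obtain ⟨ε, hε, r₁, hr01, hr1R, he0, he1⟩ := ReebProfile.exists_support hP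
  obtain ⟨ε₁, hε₁, hg₁⟩ := P.g₁_near_one
  obtain ⟨εf, hεf, hf₁⟩ := P.f₁_near_zero
  have hr0 := P.r₀_mem.1
  obtain ⟨C, rC, hC, hC0⟩ := exists_radial_div (φ := P.g₁) (κ := 0)
    (fun r _ => P.g₁_smooth.contDiffAt) 2 hr0 (fun r hr => by rw [P.g₁_zero r hr, zero_mul])
  obtain ⟨E, rE, hE, -⟩ := exists_radial_div (φ := P.e) (κ := 0)
    (fun r _ => P.e_smooth.contDiffAt) 1 hε (fun r hr => by rw [he0 r hr.2, zero_mul])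
  have hE' : ∀ r, 0 ≤ r → P.e r = E r * r := fun r hr => by rw [hE r hr, pow_one, mul_comm]
  have rH : Radial P.f₁ := Radial.of_core (fun r _ => P.f₁_smooth.contDiffAt) hεf
    (fun r hr => by rw [hf₁ r hr, hf₁ 0 ⟨le_rfl, hεf.le⟩])
  obtain ⟨η, hη, htube, hoff⟩ := O.exists_glue (angleForm O.Θ)
    (fun x hx h => O.contDiffAt_angleForm hx h) (A := fun _ => 0) (B := fun _ => 0)
    contDiff_const contDiff_const rC rH rE (rₐ := max r₁ (1 - ε₁))
    (lt_max_of_lt_left (hr0.trans hr01)) (max_lt (hr1R.trans hR) (by linarith))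
    (fun q hq hq1 t => by
      have h1 : r₁ ≤ radius q := (le_max_left _ _).trans hq
      have h2 : 1 - ε₁ ≤ radius q := (le_max_right _ _).trans hq
      have hpos : 0 < radius q := by linarith
      rw [O.angleForm_tube (norm_pos_iff.1 hpos),
        tubeForm_polar O.eig (hC _ hpos.le) (hE' _ hpos.le), hg₁ _ ⟨h2, hq1⟩, he1 _ h1,
        show P.f₁ ‖q.2.2.2‖ = 0 from P.f₁_zero _ ⟨hr01.le.trans h1, hq1⟩]
      ring)
  refine ⟨η, ⟨hη, fun p hp ht v _ => by rw [(hoff p hp ht).eq_of_nhds], fun q hq t => ?_⟩,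
    O.isFoliationForm_of_glue hη rC rH rE (r₀ := P.r₀) hC0 P.f₁_zero
      (fun r h0 h1 => ?_) htube hoff⟩
  · rw [htube q hq t, tubeForm_polar O.eig (hC _ (norm_nonneg _)) (hE' _ (norm_nonneg _))]
    simp only [radius]
    ring
  · rw [← hC r h0, ← hE' r h0]
    -- At `r₀` both `f₁` and `g₁` vanish; `e r₀ ≠ 0` keeps the form nonzero.
    rcases lt_trichotomy r P.r₀ with h | h | h
    · exact Or.inl (P.f₁_pos r ⟨h0, h⟩).ne'
    · exact Or.inr (Or.inr (h ▸ P.e_ne))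
    · exact Or.inr (Or.inl (P.g₁_pos r ⟨h, h1.le⟩).ne')

/-- In the collar `h = 0` and `θ > 0`, so `p = θ c` vanishes exactly where `c` does, at `R`.
Elsewhere in the tube the two forms differ by the nonzero factor from `off_collar`. -/
theorem isTurbulization_of_glue {L : LutzProfile O.f O.g} {P : ReebProfile} (T : Deformation L P)
    {η α₁ : Form} (hη : IsReebForm O P η)
    (h₁ : ∀ q, radius q ≤ 1 → ∀ t, α₁ (O.J q) (fderiv ℝ O.J q t) =
      T.h (radius q) * dZ t + T.θ (radius q) * L.c (radius q) * dTheta q t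
        + T.E (radius q) * radius q * dRadius q t)
    (h₁' : ∀ p ∈ S5, p ∉ O.tube → α₁ p = angleForm O.Θ p) :
    IsTurbulization O L.R (kerField η) (kerField α₁) := by
  have hδ := T.δ_pos
  have hr0 := P.r₀_mem.1
  have hr1 := T.r₀_lt
  have hr2 := T.le_rₐ
  have hr3 := T.rₐ_lt
  have hmem : ∀ (ψ : Form) (y t : Cover), fderiv ℝ O.J y t ∈ kerField ψ (O.J y) ↔
      ψ (O.J y) (fderiv ℝ O.J y t) = 0 := fun ψ y t =>
    ⟨fun h => h.2, fun h => ⟨O.fderiv_J_mem y t, h⟩⟩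
  have hcol : ∀ r, |r - L.R| < T.δ → P.r₀ < r ∧ r < 1 := fun r hr => by
    obtain ⟨h1, h2⟩ := abs_lt.1 hr
    exact ⟨by linarith, by linarith⟩
  refine ⟨T.δ, hδ, by linarith, by linarith, fun r => T.θ r * L.c r, T.q,
    T.θ_smooth.mul L.c_smooth, T.q_smooth, fun r hr => ?_, T.q_ne, T.q_zero, fun x hx hoff => ?_,
    fun y hy t => ?_, fun y hy t => ?_⟩
  · obtain ⟨h1, h2⟩ := hcol r hr
    have hθ := T.θ_pos r ⟨h1, h2.le⟩
    refine ⟨fun h => ?_, fun h => by simp [h, L.c_boundary]⟩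
    have hc := (mul_eq_zero.1 h).resolve_left hθ.ne'
    by_contra hne
    rcases lt_or_gt_of_ne hne with h | h
    · exact (L.c_neg r ⟨hr0.trans h1, h⟩).ne hc
    · exact (L.c_pos r ⟨h, h2.le⟩).ne' hc
  · ext v
    refine and_congr_right fun hv => ?_
    change α₁ x v = 0 ↔ η x v = 0
    by_cases ht : x ∈ O.tube
    · obtain ⟨y, hy, rfl⟩ := ht
      obtain ⟨t, rfl⟩ := O.exists_fderiv_J_eq y hv
      have hy' : T.δ ≤ |radius y - L.R| := not_lt.1 fun h => hoff y h rfl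
      obtain ⟨m, hm, e1, e2, e3⟩ := T.off_collar (radius y) ⟨norm_nonneg _, le_of_lt hy⟩ hy'
      rw [h₁ y (le_of_lt hy), hη.2.2 y (le_of_lt hy), e1, e2, e3,
        show ∀ a b c u v w : ℝ, m * a * u + m * b * v + m * c * w = m * (a * u + b * v + c * w) from
          fun _ _ _ _ _ _ => by ring, mul_eq_zero, or_iff_right hm]
    · rw [h₁' x hx ht, hη.2.1 x hx ht v hv]
  · obtain ⟨h1, h2⟩ := hcol _ hy
    rw [hmem, hη.2.2 y h2.le, P.f₁_zero _ ⟨h1.le, h2.le⟩, (T.collar _ hy).1]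
    simp [(P.g₁_pos _ ⟨h1, h2.le⟩).ne']
  · obtain ⟨h1, h2⟩ := hcol _ hy
    rw [hmem, h₁ y h2.le, T.h_zero _ ⟨h1.le, h2.le⟩, (T.collar _ hy).2, zero_mul, zero_add]

/-- The deformation of the contact form with a Lutz tube into a foliation form. -/
theorem exists_contactToFoliation (L : LutzProfile O.f O.g) {P : ReebProfile}
    (hP : tsupport P.e ⊆ Set.Iio L.R) {η : Form} (hη : IsReebForm O P η) :
    ∃ α : ℝ → Form, IsLutzInsertion O L (α 0) ∧ IsContactToFoliation α ∧
      IsTurbulization O L.R (kerField η) (kerField (α 1)) := by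
  obtain ⟨T⟩ := exists_deformation L P O.g_one hP
  have hr0 : 0 < T.rₐ := by linarith [T.le_rₐ, L.R_mem.1, T.δ_pos]
  have hpos : ∀ q : Cover, T.rₐ ≤ radius q → 0 < radius q := fun q hq => hr0.trans_le hq
  have rC : Radial fun r => T.θ r * T.C r := T.θ_radial.mul T.C_radial
  obtain ⟨ra, rb⟩ := radial_a L
  have hC : ∀ q : Cover, L.c (radius q) = radius q ^ 2 * T.C (radius q) := fun q =>
    T.C_eq _ (norm_nonneg _)
  have p₀ : ∀ q t, tubeForm O.eig (fun w => L.a ‖w‖) (fun w => L.b ‖w‖) (fun w => T.C ‖w‖)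
      (fun _ => 0) (fun _ => 0) q t = L.a (radius q) * O.eig.betaPlus q t +
        L.b (radius q) * O.eig.betaMinus q t + L.c (radius q) * dTheta q t := fun q t => by
    have := tubeForm_polar O.eig (A := fun w => L.a ‖w‖) (B := fun w => L.b ‖w‖) (H := fun _ => 0)
      (E := fun _ => 0) (e := fun _ => 0) (hC q) (by simp) t
    rw [zero_mul, zero_mul, add_zero, add_zero] at this
    exact this
  have p₁ : ∀ q t, tubeForm O.eig (fun _ => 0) (fun _ => 0) (fun w => T.θ ‖w‖ * T.C ‖w‖)
      (fun w => T.h ‖w‖) (fun w => T.E ‖w‖) q t = T.h (radius q) * dZ t +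
        T.θ (radius q) * L.c (radius q) * dTheta q t + T.E (radius q) * radius q * dRadius q t :=
      fun q t => by
    have := tubeForm_polar O.eig (A := fun _ => 0) (B := fun _ => 0) (H := fun w => T.h ‖w‖)
      (C := fun r => T.θ r * T.C r) (c := fun r => T.θ r * L.c r) (E := T.E)
      (e := fun r => T.E r * r) (q := q) (by simp only [hC]; ring) rfl t
    rw [zero_mul, zero_mul, add_zero, zero_add] at this
    exact this
  obtain ⟨α₀, s₀, t₀, o₀⟩ := O.exists_glue (fun x => O.ρ x • stdForm x)
    (fun x hx _ => O.contDiffAt_conformal hx) ra rb T.C_radial contDiff_const contDiff_const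
    hr0 T.rₐ_lt (fun q hq hq1 t => by
      obtain ⟨e1, e2, e3, -⟩ := T.near_one _ ⟨hq, hq1⟩
      rw [p₀, e1, e2, e3, ← mul_add]
      exact O.normal_form q hq1 t)
  obtain ⟨β, sb, tb, ob⟩ := O.exists_glue (fun _ => 0) (fun x hx _ => contDiffAt_const)
    (A := fun _ => 0) (C := fun _ => 0) (H := fun _ => 0) (E := fun _ => 0)
    contDiff_const T.G_radial contDiff_const contDiff_const contDiff_const
    hr0 T.rₐ_lt (fun q hq hq1 t => by
      have hG : T.G ‖q.2.2.2‖ = 0 := T.G_zero (radius q) (by linarith [T.le_rₐ, T.δ_pos])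
      rw [tubeForm_apply, hG]
      simp)
  obtain ⟨α₁, s₁, t₁, o₁⟩ := O.exists_glue (angleForm O.Θ)
    (fun x hx h => O.contDiffAt_angleForm hx h) (A := fun _ => 0) (B := fun _ => 0)
    contDiff_const contDiff_const rC T.h_radial T.E_radial
    hr0 T.rₐ_lt (fun q hq hq1 t => by
      obtain ⟨-, -, e3, e4, -, -, e5, e6⟩ := T.near_one _ ⟨hq, hq1⟩
      rw [p₁, O.angleForm_tube (norm_pos_iff.1 (hpos q hq)), e3, e4, e5, e6, T.h_zero _
        ⟨by linarith [T.le_rₐ, T.δ_pos, T.r₀_lt], hq1⟩]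
      ring)
  -- The two stages run one after the other: `l` goes from 0 to 1 on `[0, 1/2]` while `σ = 0`, and
  -- `σ` goes from 0 to 1 on `[1/2, 1]` while `l = 1`. The smooth steps make the concatenation
  -- smooth at `1/2`.
  let l : ℝ → ℝ := fun s => Real.smoothTransition (2 * s)
  let σ : ℝ → ℝ := fun s => Real.smoothTransition (2 * s - 1)
  have sl : ContDiff ℝ ∞ l := Real.smoothTransition.contDiff.comp (contDiff_const.mul contDiff_id)
  have sσ : ContDiff ℝ ∞ σ := Real.smoothTransition.contDiff.comp
    ((contDiff_const.mul contDiff_id).sub contDiff_const)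
  let α : ℝ → Form := fun s x => (1 - σ s) • (α₀ x - l s • β x) + σ s • α₁ x
  have hα0 : α 0 = α₀ := by
    have h1 : l 0 = 0 := Real.smoothTransition.zero_of_nonpos (by norm_num)
    have h2 : σ 0 = 0 := Real.smoothTransition.zero_of_nonpos (by norm_num)
    funext x
    simp [α, h1, h2]
  have hα1 : α 1 = α₁ := by
    have h2 : σ 1 = 1 := Real.smoothTransition.one_of_one_le (by norm_num)
    funext x
    simp [α, h2]
  refine ⟨α, ?_, ⟨?_, fun s hs => ?_, ?_⟩, ?_⟩
  · rw [hα0]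
    exact ⟨s₀, fun p hp ht v _ => by rw [(o₀ p hp ht).eq_of_nhds],
      fun q hq t => by rw [t₀ q hq, p₀]⟩
  · have hm : Set.MapsTo (Prod.snd : ℝ × C3 → C3) (Set.Icc 0 1 ×ˢ {0}ᶜ) {0}ᶜ := fun x hx => hx.2
    have c₀ := s₀.comp (contDiff_snd (𝕜 := ℝ) (E := ℝ)).contDiffOn hm
    have cb := sb.comp (contDiff_snd (𝕜 := ℝ) (E := ℝ)).contDiffOn hm
    have c₁ := s₁.comp (contDiff_snd (𝕜 := ℝ) (E := ℝ)).contDiffOn hm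
    have cl := (sl.comp (contDiff_fst (𝕜 := ℝ) (F := C3))).contDiffOn (s := Set.Icc 0 1 ×ˢ {0}ᶜ)
    have cσ := (sσ.comp (contDiff_fst (𝕜 := ℝ) (F := C3))).contDiffOn (s := Set.Icc 0 1 ×ˢ {0}ᶜ)
    exact ((contDiffOn_const.sub cσ).smul (c₀.sub (cl.smul cb))).add (cσ.smul c₁)
  · refine O.isPositiveContact_comb T s₀ sb s₁ t₀ tb t₁ o₀ ob o₁
      (Real.smoothTransition.nonneg _) (Real.smoothTransition.nonneg _)
      (Real.smoothTransition.lt_one_of_lt_one (by linarith [hs.2])) ?_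
    rcases le_total s (1 / 2) with h | h
    · exact Or.inl (Real.smoothTransition.zero_of_nonpos (by linarith))
    · exact Or.inr (Real.smoothTransition.one_of_one_le (by linarith))
  · rw [hα1]
    refine O.isFoliationForm_of_glue s₁ rC T.h_radial T.E_radial (r₀ := P.r₀)
      (fun r hr => by rw [T.θ_zero r hr, zero_mul]) T.h_zero (fun r h0 h1 => ?_) t₁ o₁
    rw [show r ^ 2 * (T.θ r * T.C r) = T.θ r * L.c r by rw [T.C_eq r h0]; ring]
    -- In the collar `θ c` vanishes only at `R`, where `q ≠ 0`. Off it the form is a nonzero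
    -- multiple of the Reeb form.
    rcases lt_or_ge |r - L.R| T.δ with h | h
    · rcases eq_or_ne r L.R with rfl | hne
      · exact Or.inr (Or.inr (by rw [(T.collar _ h).2]; exact T.q_ne))
      · refine Or.inr (Or.inl (mul_ne_zero (T.θ_pos r ⟨?_, h1.le⟩).ne' ?_))
        · linarith [(abs_lt.1 h).1, T.r₀_lt]
        · rcases lt_or_gt_of_ne hne with h2 | h2
          · exact (L.c_neg r ⟨by linarith [(abs_lt.1 h).1, T.r₀_lt, P.r₀_mem.1], h2⟩).ne
          · exact (L.c_pos r ⟨h2, h1.le⟩).ne'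
    · obtain ⟨m, hm, e1, e2, e3⟩ := T.off_collar r ⟨h0, h1.le⟩ h
      rw [e1, e2, e3]
      rcases lt_trichotomy r P.r₀ with h | h | h
      · exact Or.inl (mul_ne_zero hm (P.f₁_pos r ⟨h0, h⟩).ne')
      · exact Or.inr (Or.inr (mul_ne_zero hm (h ▸ P.e_ne)))
      · exact Or.inr (Or.inl (mul_ne_zero hm (P.g₁_pos r ⟨h, h1.le⟩).ne'))
  · rw [hα1]
    exact O.isTurbulization_of_glue T hη (fun q hq t => by rw [t₁ q hq, p₁])
      fun p hp ht => (o₁ p hp ht).eq_of_nhds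

end SupportingOpenBook

end LutzS5

end

theorem mainTheorem7 (m : ℕ) (hm : m = 1 ∨ m = 2) (k : Fin m → ℕ) (hk : k ≠ 0)
    (O : LutzS5.SupportingOpenBook (LutzS5.monodromy m k))
    (hO : O.IsMilnor (LutzS5.singularity m k))
    (L : LutzS5.LutzProfile O.f O.g) :
    (∃ P : LutzS5.ReebProfile, tsupport P.e ⊆ Set.Iio L.R) ∧
    ∀ P : LutzS5.ReebProfile, tsupport P.e ⊆ Set.Iio L.R →
      ∃ η : LutzS5.Form, LutzS5.IsReebForm O P η ∧ LutzS5.IsFoliationForm η ∧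
        ∃ α : ℝ → LutzS5.Form,
          LutzS5.IsLutzInsertion O L (α 0) ∧
          LutzS5.IsContactToFoliation α ∧
          LutzS5.IsTurbulization O L.R (LutzS5.kerField η) (LutzS5.kerField (α 1)) := by
  refine ⟨LutzS5.exists_reebProfile L.R_mem, fun P hP => ?_⟩
  obtain ⟨η, hη, hF⟩ := O.exists_reebForm P hP L.R_mem.2
  exact ⟨η, hη, hF, O.exists_contactToFoliation L hP hη⟩
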